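/- **Setting.** Let $n\ge 1$ and let $m_1,\dots,m_n\ge 0$ be masses. Write $\xi=(k,\lambda)\in\Xi:=\mathbb{R}^3\times\{-\frac12,\frac12\}$, $\int f(\xi)\,d\xi:=\sum_{\lambda}\int_{\mathbb{R}^3} f(k,\lambda)\,dk$ and $\omega_i(k):=\sqrt{|k|^2+m_i^2}$. Let $\mathcal{F}=\bigoplus_{l\ge 0}\otimes_a^l L^2(\Xi)$ be the antisymmetric Fock space over $L^2(\Xi)$ and $\mathcal{H}=\bigotimes_{i=1}^n\mathcal{F}$, so that $\varphi\in\mathcal{H}$ is a square-summable family of functions $\varphi_{l_1,\dots,l_n}\in L^2$ of $l_i$ variables of species $i$ ($1\le i\le n$), antisymmetric in the variables of each species. Let $H_{f,i}=\mathrm{d}\Gamma(\omega_i)$ act on the $i$-th Fock space, let $b_i(\xi),b_i^*(\xi)$ be the fermionic annihilation and creation operators of species $i$ (operators of different species anticommute), and, for $0\le p\le n$ and $G\in L^2(\Xi^n)$, let $$H_I(G)=\int G(\xi_1,\dots,\xi_n)\,b_1^*(\xi_1)\cdots b_p^*(\xi_p)\,b_{p+1}(\xi_{p+1})\cdots b_n(\xi_n)\,d\xi_1\cdots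 d\xi_n$$ as a quadratic form, i.e. $\langle\varphi,H_I(G)\psi\rangle=\int G(\xi)\,\langle b_p(\xi_p)\cdots b_1(\xi_1)\varphi,\;b_{p+1}(\xi_{p+1})\cdots b_n(\xi_n)\psi\rangle\,d\xi$, computed particle-number sector by particle-number sector and summed over the sectors. For $1\le i\le n$ and $1\le j\le 3$ let $\mathrm{h}_i^j=-\partial^2/\partial k_{i,j}^2+k_{i,j}^2$ be the self-adjoint harmonic oscillator in the variable $k_{i,j}$, acting on $L^2(\Xi^n)$. For $i_0\in\{1,\dots,n\}$, $s>\frac12$ and $\theta\in[0,1]$ put $$W_{i_0}:=\Big(\prod_{i\ne i_0,\;m_i>0}\ \prod_{j=1}^3(\mathrm{h}_i^j)^{\theta s}\Big)\Big(\prod_{i\ne i_0,\;m_i=0}\ \prod_{j=1}^3(\mathrm{h}_i^j)^{\frac1{12}+\theta(s-\frac1{12})}\Big).$$ **Proposition 2.3.** Let $s>\frac12$ and $0\le\theta\le1$. There is a constant $\mathrm{C}_{s,\theta}>0$ (depending only on $s$, $\theta$, $n$ and the masses $m_1,\dots,m_n$) such that, for all $0\le p\le n$, all $i_0\in\{1,\dots,n\}$,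 all $G\in\mathcal{D}(W_{i_0})$ and all $\varphi\in\mathcal{D}\big((\sum_{i\ne i_0}H_{f,i})^{\frac{n-1}{2}(1-\theta)}\big)$, the integrals and the sum over the sectors defining $\langle\varphi,H_I(G)\varphi\rangle$ converge absolutely, and $$\big|\langle\varphi,H_I(G)\varphi\rangle\big|\le \mathrm{C}_{s,\theta}\,\big\|W_{i_0}G\big\|_2\,\Big\|\Big(\sum_{i\ne i_0}H_{f,i}+1\Big)^{\frac{n-1}{2}(1-\theta)}\varphi\Big\|^2 .$$ -/

import Mathlib

open MeasureTheory
open scoped ENNReal ContDiff ComplexConjugate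

namespace FermiFields

/-! ### One particle -/

/-- The one-particle variable `ξ = (k, λ)`: a momentum `k ∈ ℝ³` and a spin, the two elements of
`Fin 2` standing for the spins `-1/2` and `1/2`. -/
abbrev Particle : Type := (Fin 3 → ℝ) × Fin 2

/-- `∫ f(ξ) dξ = ∑_λ ∫ f(k, λ) dk`. -/
noncomputable def particleMeasure : Measure Particle :=
  (volume : Measure (Fin 3 → ℝ)).prod Measure.count

instance : SigmaFinite particleMeasure := by
  unfold particleMeasure; infer_instance

/-- The relativistic dispersion relation `ω(k) = √(k² + m²)` of a particle of mass `m`. -/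
noncomputable def omega (m : ℝ) (ξ : Particle) : ℝ :=
  √((∑ j, ξ.1 j ^ 2) + m ^ 2)

/-! ### The Hilbert space: `n` species of fermions -/

/-- Configurations of `l i` particles of species `i`, for each `i`. -/
abbrev Config {n : ℕ} (l : Fin n → ℕ) : Type := ∀ i : Fin n, Fin (l i) → Particle

noncomputable def configMeasure {n : ℕ} (l : Fin n → ℕ) : Measure (Config l) :=
  Measure.pi fun i => Measure.pi fun _ : Fin (l i) => particleMeasure

instance {n : ℕ} (l : Fin n → ℕ) : SigmaFinite (configMeasure l) := by
  unfold configMeasure; infer_instance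

/-- Permute the particles inside each species. -/
def permute {n : ℕ} {l : Fin n → ℕ} (σ : ∀ i, Equiv.Perm (Fin (l i))) (X : Config l) : Config l :=
  fun i r => X i (σ i r)

theorem measurePreserving_permute {n : ℕ} {l : Fin n → ℕ} (σ : ∀ i, Equiv.Perm (Fin (l i))) :
    MeasurePreserving (permute σ) (configMeasure l) (configMeasure l) := by
  refine measurePreserving_pi (fun i => Measure.pi fun _ : Fin (l i) => particleMeasure)
    (fun i => Measure.pi fun _ : Fin (l i) => particleMeasure)
    (f := fun i (x : Fin (l i) → Particle) r => x (σ i r)) (fun i => ?_)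
  have h := measurePreserving_piCongrLeft (fun _ : Fin (l i) => particleMeasure) (σ i).symm
  convert h using 1
  ext x r : 2
  have := MeasurableEquiv.piCongrLeft_apply_apply (β := fun _ : Fin (l i) => Particle)
    (σ i).symm x ((σ i) r)
  simpa using this.symm

/-- The sector with `l i` particles of species `i`: the functions in `L²` that are antisymmetric in
the variables of each species, i.e. `⨂ᵢ ⊗ₐ^{l i} L²(ℝ³ × {-1/2, 1/2})`. -/
noncomputable def Sector {n : ℕ} (l : Fin n → ℕ) : Submodule ℂ (Lp ℂ 2 (configMeasure l)) where
  carrier := {f | ∀ σ : ∀ i, Equiv.Perm (Fin (l i)),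
    (fun X => f (permute σ X)) =ᵐ[configMeasure l]
      fun X => ((∏ i, (Equiv.Perm.sign (σ i) : ℤ) : ℤ) : ℂ) * f X}
  zero_mem' := by
    intro σ
    have h0 := Lp.coeFn_zero ℂ 2 (configMeasure l)
    have h1 := (measurePreserving_permute σ).quasiMeasurePreserving.ae h0
    filter_upwards [h0, h1] with X h2 h3
    simp only [h2, h3, Pi.zero_apply, mul_zero]
  add_mem' := by
    intro f g hf hg σ
    have h0 := Lp.coeFn_add f g
    have h1 := (measurePreserving_permute σ).quasiMeasurePreserving.ae h0
    filter_upwards [h0, h1, hf σ, hg σ] with X h2 h3 h4 h5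
    simp only [h2, h3, Pi.add_apply, h4, h5, mul_add]
  smul_mem' := by
    intro c f hf σ
    have h0 := Lp.coeFn_smul c f
    have h1 := (measurePreserving_permute σ).quasiMeasurePreserving.ae h0
    filter_upwards [h0, h1, hf σ] with X h2 h3 h4
    simp only [h2, h3, Pi.smul_apply, h4, smul_eq_mul]
    ring

/-- The tensor product of `n` antisymmetric Fock spaces over `L²(ℝ³ × {-1/2, 1/2})`, as the
Hilbert direct sum over `(l₁, …, lₙ)` of the sectors with `lᵢ` particles of species `i`. -/
abbrev FockSpace (n : ℕ) : Type := lp (fun l : Fin n → ℕ => Sector l) 2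

/-- The component of a vector in the sector `l`, as a function of the particle variables. -/
noncomputable def component {n : ℕ} (φ : FockSpace n) (l : Fin n → ℕ) : Config l → ℂ :=
  ((φ l : Sector l) : Lp ℂ 2 (configMeasure l))

/-! ### Unbounded operators, given by their graphs -/

/-- An operator given by its graph: `T x y` says that `x` is in the domain of `T` and `T x = y`. -/
abbrev OpGraph (E : Type) : Type := E → E → Prop

/-- The product `T₁ T₂ ⋯ T_N`, whose domain is the set of `x` in the domain of `T_N` such that
`T_N x` is in the domain of `T₁ ⋯ T_{N-1}`. -/
def opProd {E : Type} : List (OpGraph E) → OpGraph E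
  | [] => fun x y => y = x
  | T :: Ts => fun x y => ∃ z, opProd Ts x z ∧ T z y

/-- The real power `T ^ a` of a nonnegative self-adjoint operator `T`, by the multiplication
operator form of the spectral theorem: in a representation `U` in which `T` is the multiplication
by `f` on its maximal domain, `T ^ a` is the multiplication by `f ^ a` on its maximal domain. -/
def opPow {E : Type} [NormedAddCommGroup E] [InnerProductSpace ℂ E] (T : OpGraph E) (a : ℝ) :
    OpGraph E := fun x y =>
  ∃ (Ω : Type) (_ : MeasurableSpace Ω) (ν : Measure Ω) (U : E ≃ₗᵢ[ℂ] Lp ℂ 2 ν) (f : Ω → ℝ),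
    Measurable f ∧ (∀ᵐ w ∂ν, 0 ≤ f w) ∧
    (∀ u v, T u v ↔ ∀ᵐ w ∂ν, U v w = (f w : ℂ) * U u w) ∧
    ∀ᵐ w ∂ν, U y w = ((f w ^ a : ℝ) : ℂ) * U x w

/-! ### The free field energy -/

/-- The total energy of the particles of all species other than `i₀`. -/
noncomputable def energy {n : ℕ} (m : Fin n → ℝ) (i₀ : Fin n) {l : Fin n → ℕ} (X : Config l) : ℝ :=
  ∑ i ∈ Finset.univ.erase i₀, ∑ r, omega (m i) (X i r)

/-- `g(∑_{i ≠ i₀} H_{f,i})` with `H_{f,i} = dΓ(ω_i)`: since `dΓ(ω_i)` is, in the sector `l`, the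
multiplication by the sum of the `ω_i(k)` over the particles of species `i`, this is the
multiplication by `g` of the energy, on its maximal domain. -/
def freeEnergyFun {n : ℕ} (m : Fin n → ℝ) (i₀ : Fin n) (g : ℝ → ℝ) : OpGraph (FockSpace n) :=
  fun φ η => ∀ l, ∀ᵐ X ∂(configMeasure l), component η l X = (g (energy m i₀ X) : ℂ) * component φ l X

/-! ### Kernels and harmonic oscillators -/

noncomputable def kernelMeasure (n : ℕ) : Measure (Fin n → Particle) :=
  Measure.pi fun _ => particleMeasure

instance (n : ℕ) : SigmaFinite (kernelMeasure n) := by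
  unfold kernelMeasure; infer_instance

/-- The space `⨂ᵢ L²(ℝ³ × {-1/2, 1/2}) = L²((ℝ³ × {-1/2, 1/2})ⁿ)` of the kernels `G`. -/
abbrev KernelSpace (n : ℕ) : Type := Lp ℂ 2 (kernelMeasure n)

/-- Test functions: for all values of the spins, smooth with compact support in the momenta. -/
def IsTest {n : ℕ} (χ : (Fin n → Particle) → ℂ) : Prop :=
  ∀ τ : Fin n → Fin 2,
    ContDiff ℝ ∞ (fun k : Fin n → Fin 3 → ℝ => χ fun i => (k i, τ i)) ∧
    HasCompactSupport (fun k : Fin n → Fin 3 → ℝ => χ fun i => (k i, τ i))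

/-- The differential expression `-∂²χ/∂k_{i,j}² + k_{i,j}² χ`. -/
noncomputable def oscExpr {n : ℕ} (i : Fin n) (j : Fin 3) (χ : (Fin n → Particle) → ℂ)
    (ξ : Fin n → Particle) : ℂ :=
  - iteratedDeriv 2
      (fun t : ℝ => χ (Function.update ξ i (Function.update (ξ i).1 j t, (ξ i).2))) ((ξ i).1 j)
    + (((ξ i).1 j ^ 2 : ℝ) : ℂ) * χ ξ

/-- The harmonic oscillator `h_i^j = -∂²/∂k_{i,j}² + k_{i,j}²` in `L²`, with its maximal domain:
`h_i^j G = F` in the sense of distributions, with `G` and `F` in `L²`. -/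
def oscillator {n : ℕ} (i : Fin n) (j : Fin 3) : OpGraph (KernelSpace n) := fun G F =>
  ∀ χ : (Fin n → Particle) → ℂ, IsTest χ →
    ∫ ξ, F ξ * χ ξ ∂(kernelMeasure n) = ∫ ξ, G ξ * oscExpr i j χ ξ ∂(kernelMeasure n)

/-- `(∏_{i ∈ I, j} (h_i^j)^{θ s}) (∏_{i ∈ J, j} (h_i^j)^{1/12 + θ (s - 1/12)})`, where `I` and `J`
are the sets of massive and of massless species other than `i₀`. -/
noncomputable def weightOp {n : ℕ} (m : Fin n → ℝ) (s θ : ℝ) (i₀ : Fin n) :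
    OpGraph (KernelSpace n) :=
  opProd
    ((((List.finRange n).filter fun i => i ≠ i₀ ∧ 0 < m i).flatMap fun i =>
        (List.finRange 3).map fun j => opPow (oscillator i j) (θ * s)) ++
     (((List.finRange n).filter fun i => i ≠ i₀ ∧ m i = 0).flatMap fun i =>
        (List.finRange 3).map fun j => opPow (oscillator i j) (1 / 12 + θ * (s - 1 / 12))))

/-! ### The interaction -/

/-- Put one more particle in front of a list of particles (`true`), or do nothing (`false`). -/
def addIf {N : ℕ} : (b : Bool) → Particle → (Fin N → Particle) → Fin (N + b.toNat) → Particle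
  | true, ξ, x => Fin.cons (α := fun _ => Particle) ξ x
  | false, _, x => x

/-- Add one to the number of particles of species `i`. -/
def incr {n : ℕ} (i : Fin n) (l : Fin n → ℕ) : Fin n → ℕ :=
  fun j => l j + (decide (j = i)).toNat

/-- Add a particle of species `i` to a configuration. -/
def insertParticle {n : ℕ} (i : Fin n) {l : Fin n → ℕ} (ξ : Particle) (X : Config l) :
    Config (incr i l) :=
  fun j => addIf (decide (j = i)) ξ (X j)

/-- The annihilation operator `b_i(ξ)`, acting on families of wave functions:
`(b_i(ξ) Ψ)_l (X) = (-1)^{∑_{j < i} l_j} √(l_i + 1) Ψ_{l + e_i}(ξ, X)`.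
The sign makes operators of different species anticommute. -/
noncomputable def annihilate {n : ℕ} (i : Fin n) (ξ : Particle)
    (Ψ : ∀ l : Fin n → ℕ, Config l → ℂ) : ∀ l : Fin n → ℕ, Config l → ℂ := fun l X =>
  (-1) ^ (∑ j ∈ Finset.univ.filter (· < i), l j) * (√((l i : ℝ) + 1) : ℂ) *
    Ψ (incr i l) (insertParticle i ξ X)

/-- `b_{i₁}(ξ_{i₁}) ⋯ b_{i_N}(ξ_{i_N}) Ψ` for the list `[i₁, …, i_N]`. -/
noncomputable def annihilateList {n : ℕ} (L : List (Fin n)) (ξ : Fin n → Particle)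
    (Ψ : ∀ l : Fin n → ℕ, Config l → ℂ) : ∀ l : Fin n → ℕ, Config l → ℂ :=
  L.foldr (fun i Ψ' => annihilate i (ξ i) Ψ') Ψ

/-- The function of `(ξ, X)` whose integral is the contribution of the sector `l` to
`∫ G(ξ) ⟨b_p(ξ_p) ⋯ b_1(ξ_1) φ, b_{p+1}(ξ_{p+1}) ⋯ b_n(ξ_n) ψ⟩ dξ`. -/
noncomputable def interactionIntegrand {n : ℕ} (p : ℕ) (G : KernelSpace n) (φ ψ : FockSpace n)
    (l : Fin n → ℕ) (z : (Fin n → Particle) × Config l) : ℂ :=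
  G z.1 *
    (conj (annihilateList ((List.finRange n).filter fun i => i.val < p).reverse z.1
        (component φ) l z.2) *
      annihilateList ((List.finRange n).filter fun i => p ≤ i.val) z.1 (component ψ) l z.2)

/-- The contribution of the sector `l` (after annihilation) to `⟨φ, H_I(G) ψ⟩`. -/
noncomputable def interactionTerm {n : ℕ} (p : ℕ) (G : KernelSpace n) (φ ψ : FockSpace n)
    (l : Fin n → ℕ) : ℂ :=
  ∫ z, interactionIntegrand p G φ ψ l z ∂((kernelMeasure n).prod (configMeasure l))

/-- `⟨φ, H_I(G) ψ⟩` for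
`H_I(G) = ∫ G(ξ₁, …, ξₙ) b₁*(ξ₁) ⋯ b_p*(ξ_p) b_{p+1}(ξ_{p+1}) ⋯ b_n(ξ_n) dξ₁ ⋯ dξₙ`. -/
noncomputable def interactionForm {n : ℕ} (p : ℕ) (G : KernelSpace n) (φ ψ : FockSpace n) : ℂ :=
  ∑' l, interactionTerm p G φ ψ l

/-- The integrals and the series that define `⟨φ, H_I(G) ψ⟩` converge absolutely. -/
def InteractionConverges {n : ℕ} (p : ℕ) (G : KernelSpace n) (φ ψ : FockSpace n) : Prop :=
  (∀ l, Integrable (interactionIntegrand p G φ ψ l)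
    ((kernelMeasure n).prod (configMeasure l))) ∧
  Summable fun l => ‖interactionTerm p G φ ψ l‖

end FermiFields

open FermiFields

/-! In a sector the form is `sectorFactor`, the root of ∏(lᵢ+1), times the integral of G against two
antisymmetric wave functions f and g, up to a constant of modulus 1
(`exists_interactionIntegrand_eq`). Each species gives its additional argument to exactly one of f
and g. Two estimates, uniform in the sector, hold for this quantity.

For a product kernel ∏ uᵢ(ξᵢ), every smeared fermionic operator is bounded by the norm of its test
function (`fermi_bound`), so the form is at most ∏‖uᵢ‖ ‖f‖ ‖g‖ (`mode_bound`). For a general kernel,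
only the operator of species i₀ is treated in this way. Cauchy–Schwarz with weight ω in each other
species puts ∏ω^{-1/2} on G and turns the weights on |f|² and |g|² into energies of single species,
whose product is at most (E+1)^{n-1} on either side (`energy_bound`). For a massless species ω⁻¹ is
singular; since ω⁻¹ ≤ ∏ⱼ|kⱼ|^{-1/3} and |x|^{-1/3} is form-bounded by a multiple of h^{1/6}
(`weightedBound_hermFun`), the factor ω^{-1/2} costs h^{1/12} in each of the three directions.

To interpolate, expand G in Hermite modes β of the species other than i₀, keeping the dependence on
ξ_{i₀} whole. The first estimate bounds the contribution of each β by the norm of its slice. The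
second, applied with arbitrary multipliers in β, gives by duality a weighted ℓ² bound on these
contributions. The θ-th power of one times the (1-θ)-th power of the other is summed by Hölder's
inequality, because the eigenvalues to the power -2s are summable for s > 1/2
(`norm_sum_le_interpolation`, `sectorForm_interpolation`).

The outcome contains ‖f‖^θ ‖(E+1)^{(n-1)/2} f‖^{1-θ}, which dominates the wanted norm
‖(E+1)^{(n-1)(1-θ)/2} f‖ instead of being dominated by it. On a dyadic shell of the energy the two
are comparable. To sum the shells, θ is raised to θ' with s'θ' = sθ and still s' > 1/2; each shell
then gains a negative power of its energy and the sum is geometric (`sectorForm_shell_le`,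
`sectorBound_interior`). For θ = 0, θ = 1 or a single species there is no mismatch
(`sectorBound_endpoint`).

Hermite functions are eigenvectors of the oscillators, so the coefficients of W G are those of G
times powers of eigenvalues (`integral_pairMode_mul_of_weightOp`), and Bessel's inequality replaces
mode sums by ‖W G‖. The sectors are summed in `summable_and_norm_tsum_le`. In the lemmas indexed by
`Fin (n + 1)`, n is the number of species other than i₀. -/

namespace FermiFields

/-! ### Square integrals -/

/-- `∫ |f|²` as an extended nonnegative real. -/
noncomputable def sqInt {α E : Type*} [MeasurableSpace α] [ENorm E] (μ : Measure α) (f : α → E) :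
    ℝ≥0∞ :=
  ∫⁻ x, ‖f x‖ₑ ^ 2 ∂μ

/-- Cauchy–Schwarz for √a and √b, phrased so that h enters only through its square and needs no
measurability. -/
theorem sq_lintegral_le_of_sq_le {α : Type*} [MeasurableSpace α] {μ : Measure α}
    {h a b : α → ℝ≥0∞} (ha : AEMeasurable a μ) (hb : AEMeasurable b μ)
    (hab : ∀ᵐ x ∂μ, h x ^ 2 ≤ a x * b x) :
    (∫⁻ x, h x ∂μ) ^ 2 ≤ (∫⁻ x, a x ∂μ) * ∫⁻ x, b x ∂μ := by
  have h1 : ∀ᵐ x ∂μ, h x ≤ (a x) ^ (1 / 2 : ℝ) * (b x) ^ (1 / 2 : ℝ) := by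
    filter_upwards [hab] with x hx
    rw [← ENNReal.mul_rpow_of_nonneg _ _ (by norm_num)]
    calc h x = (h x ^ 2) ^ (1 / 2 : ℝ) := by
          rw [← ENNReal.rpow_natCast, ← ENNReal.rpow_mul]; norm_num
      _ ≤ _ := ENNReal.rpow_le_rpow hx (by norm_num)
  have h2 : ∫⁻ x, h x ∂μ ≤ (∫⁻ x, a x ∂μ) ^ (1 / 2 : ℝ) * (∫⁻ x, b x ∂μ) ^ (1 / 2 : ℝ) := by
    refine (lintegral_mono_ae h1).trans ?_
    refine (ENNReal.lintegral_mul_le_Lp_mul_Lq μ (p := 2) (q := 2) ?_ (ha.pow_const _)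
      (hb.pow_const _)).trans ?_
    · exact ⟨by norm_num, by norm_num, by norm_num⟩
    · simp only [← ENNReal.rpow_mul]
      norm_num
  calc (∫⁻ x, h x ∂μ) ^ 2
      ≤ ((∫⁻ x, a x ∂μ) ^ (1 / 2 : ℝ) * (∫⁻ x, b x ∂μ) ^ (1 / 2 : ℝ)) ^ 2 := by gcongr
    _ = _ := by
      rw [mul_pow, ← ENNReal.rpow_natCast, ← ENNReal.rpow_natCast, ← ENNReal.rpow_mul,
        ← ENNReal.rpow_mul]
      norm_num

theorem sqInt_lt_top_iff {α : Type*} [MeasurableSpace α] {μ : Measure α} {f : α → ℂ}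
    (hf : AEStronglyMeasurable f μ) : sqInt μ f < ⊤ ↔ MemLp f 2 μ := by
  have := eLpNorm_lt_top_iff_lintegral_rpow_enorm_lt_top (p := 2) (f := f) (μ := μ)
    (by norm_num) (by norm_num)
  simp only [ENNReal.toReal_ofNat] at this
  rw [MemLp]
  simp only [hf, true_and]
  rw [this, sqInt]
  norm_cast

theorem sqInt_eq_ofReal {α : Type*} [MeasurableSpace α] {μ : Measure α} {f : α → ℂ}
    (hf : MemLp f 2 μ) : sqInt μ f = ENNReal.ofReal (∫ x, ‖f x‖ ^ 2 ∂μ) := by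
  rw [ofReal_integral_eq_lintegral_ofReal]
  · refine lintegral_congr fun x => ?_
    rw [ENNReal.ofReal_pow (norm_nonneg _), ofReal_norm]
  · exact hf.integrable_norm_pow (by norm_num)
  · exact Filter.Eventually.of_forall fun x => by positivity

/-- Removing the component of `φ` along `conj u`. -/
theorem sqInt_sub_mul_conj_add {α : Type*} [MeasurableSpace α] {μ : Measure α} {u φ : α → ℂ}
    (hu : MemLp u 2 μ) (hφ : MemLp φ 2 μ) (hu1 : sqInt μ u = 1) :
    sqInt μ (fun x => φ x - (∫ y, u y * φ y ∂μ) * conj (u x)) + ‖∫ y, u y * φ y ∂μ‖ₑ ^ 2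
      = sqInt μ φ := by
  set c := ∫ y, u y * φ y ∂μ with hc
  have hcu : MemLp (fun x => conj (u x)) 2 μ := hu.star
  have hd : MemLp (fun x => φ x - c * conj (u x)) 2 μ := hφ.sub (hcu.const_mul c)
  rw [sqInt_eq_ofReal hd, sqInt_eq_ofReal hφ, ← ofReal_norm, ← ENNReal.ofReal_pow (norm_nonneg _),
    ← ENNReal.ofReal_add (integral_nonneg fun x => by positivity) (by positivity)]
  congr 1
  have hu1' : ∫ x, ‖u x‖ ^ 2 ∂μ = 1 := by
    rw [sqInt_eq_ofReal hu] at hu1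
    have := congrArg ENNReal.toReal hu1
    rwa [ENNReal.toReal_ofReal (integral_nonneg fun x => by positivity), ENNReal.toReal_one] at this
  have huφ : Integrable (fun x => u x * φ x) μ := hu.integrable_mul hφ
  have hexp : ∀ x, ‖φ x - c * conj (u x)‖ ^ 2
      = ‖φ x‖ ^ 2 - 2 * (conj c * (u x * φ x)).re + ‖c‖ ^ 2 * ‖u x‖ ^ 2 := by
    intro x
    rw [← Complex.normSq_eq_norm_sq, Complex.normSq_sub, Complex.normSq_eq_norm_sq,
      Complex.normSq_eq_norm_sq, norm_mul, Complex.norm_conj, map_mul, Complex.conj_conj]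
    ring_nf
  simp_rw [hexp]
  have i1 : Integrable (fun x => ‖φ x‖ ^ 2) μ := hφ.integrable_norm_pow (by norm_num)
  have i2 : Integrable (fun x => 2 * (conj c * (u x * φ x)).re) μ :=
    ((huφ.const_mul (conj c)).re).const_mul 2
  have i3 : Integrable (fun x => ‖c‖ ^ 2 * ‖u x‖ ^ 2) μ :=
    (hu.integrable_norm_pow (by norm_num)).const_mul _
  have e2 : ∫ x, (conj c * (u x * φ x)).re ∂μ = ‖c‖ ^ 2 := by
    have := integral_re (huφ.const_mul (conj c))
    simp only [RCLike.re_to_complex] at this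
    rw [this, integral_const_mul, ← hc, ← Complex.normSq_eq_norm_sq, ← Complex.normSq_eq_conj_mul_self]
    simp
  rw [integral_add (by exact i1.sub i2) i3, integral_sub i1 i2, integral_const_mul, integral_const_mul, e2,
    hu1']
  ring

/-! ### The one-species fermionic bound -/

section Fermi

variable {X : Type*} [MeasurableSpace X] {μ : Measure X} [SigmaFinite μ]

theorem measurePreserving_cons (N : ℕ) :
    MeasurePreserving (fun z : X × (Fin N → X) => (Fin.cons z.1 z.2 : Fin (N + 1) → X))
      (μ.prod (Measure.pi fun _ => μ)) (Measure.pi fun _ => μ) := by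
  have := (measurePreserving_piFinSuccAbove (fun _ : Fin (N + 1) => μ) 0).symm
  convert this using 1
  ext z : 1
  simp [MeasurableEquiv.piFinSuccAbove, Fin.consEquiv]

theorem lintegral_cons {N : ℕ} {F : (Fin (N + 1) → X) → ℝ≥0∞} (hF : Measurable F) :
    ∫⁻ y, F y ∂(Measure.pi fun _ => μ)
      = ∫⁻ x, ∫⁻ ξ, F (Fin.cons ξ x) ∂μ ∂(Measure.pi fun _ : Fin N => μ) := by
  rw [← (measurePreserving_cons (μ := μ) N).lintegral_comp hF, lintegral_prod_symm']
  exact hF.comp (measurePreserving_cons (μ := μ) N).measurable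

theorem lintegral_cons' {N : ℕ} {F : (Fin (N + 1) → X) → ℝ≥0∞} (hF : Measurable F) :
    ∫⁻ y, F y ∂(Measure.pi fun _ => μ)
      = ∫⁻ ξ, ∫⁻ x, F (Fin.cons ξ x) ∂(Measure.pi fun _ : Fin N => μ) ∂μ := by
  rw [← (measurePreserving_cons (μ := μ) N).lintegral_comp hF, lintegral_prod]
  exact (hF.comp (measurePreserving_cons (μ := μ) N).measurable).aemeasurable

/-- Antisymmetry under all transpositions. -/
def IsAntisymm {X : Type*} {N : ℕ} (f : (Fin N → X) → ℂ) : Prop :=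
  ∀ i j, i ≠ j → ∀ x, f (x ∘ Equiv.swap i j) = - f x

theorem cons_comp_swap_succ {X : Type*} {N : ℕ} (ξ : X) (x : Fin N → X) (i j : Fin N) :
    (Fin.cons ξ (x ∘ Equiv.swap i j) : Fin (N + 1) → X)
      = (Fin.cons ξ x : Fin (N + 1) → X) ∘ Equiv.swap i.succ j.succ := by
  ext r : 1
  refine Fin.cases ?_ (fun r => ?_) r
  · simp [Equiv.swap_apply_of_ne_of_ne (Fin.succ_ne_zero i).symm (Fin.succ_ne_zero j).symm]
  · simp only [Fin.cons_succ, Function.comp_apply]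
    rw [← (Fin.succ_injective N).map_swap, Fin.cons_succ]

theorem cons_cons_comp_swap {X : Type*} {N : ℕ} (ξ η : X) (x : Fin N → X) :
    (Fin.cons η (Fin.cons ξ x) : Fin (N + 2) → X)
      = (Fin.cons ξ (Fin.cons η x) : Fin (N + 2) → X) ∘ Equiv.swap 0 1 := by
  ext r : 1
  refine Fin.cases ?_ (fun r => Fin.cases ?_ (fun r => ?_) r) r
  · simp
  · simp
  · simp only [Fin.cons_succ, Function.comp_apply]
    rw [Equiv.swap_apply_of_ne_of_ne (Fin.succ_ne_zero _) (by simp [Fin.ext_iff])]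
    simp

theorem measurable_integral_mul_cons {N : ℕ} {u : X → ℂ} {f : (Fin (N + 1) → X) → ℂ}
    (hu : Measurable u) (hf : Measurable f) :
    Measurable fun x : Fin N → X => ∫ ξ, u ξ * f (Fin.cons ξ x) ∂μ := by
  have h : Measurable fun z : (Fin N → X) × X => u z.2 * f (Fin.cons z.2 z.1) :=
    (hu.comp measurable_snd).mul
      (hf.comp ((measurePreserving_cons (μ := μ) N).measurable.comp measurable_swap))
  exact (h.stronglyMeasurable.integral_prod_right (ν := μ)).measurable

/-- Induction on the number of particles replaces the anticommutation relations. With a(x) = ∫ u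
f(·, x), split f(ξ, x) = g_ξ(x) + a(x) ū(ξ); the parts are orthogonal on each fibre, so ‖f‖² = ‖g‖²
+ ‖a‖². By antisymmetry a second contraction with u kills a, hence the contraction of g_ξ with u is
-a(ξ, ·). The induction hypothesis for every g_ξ bounds ‖a‖² by ‖g‖² with the previous factor, and
the Pythagorean term adds one to it. -/
theorem fermi_bound_of_normalized {N : ℕ} {u : X → ℂ} (hu : Measurable u) (hu1 : sqInt μ u = 1)
    {f : (Fin (N + 1) → X) → ℂ} (hf : Measurable f) (hfin : sqInt (Measure.pi fun _ => μ) f < ⊤)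
    (hanti : IsAntisymm f) :
    (N + 1 : ℝ≥0∞) * sqInt (Measure.pi fun _ : Fin N => μ) (fun x => ∫ ξ, u ξ * f (Fin.cons ξ x) ∂μ)
      ≤ sqInt (Measure.pi fun _ => μ) f := by
  have huL : MemLp u 2 μ := (sqInt_lt_top_iff hu.aestronglyMeasurable).1 (by simp [hu1])
  have mcons : ∀ N, Measurable fun z : X × (Fin N → X) => (Fin.cons z.1 z.2 : Fin (N + 1) → X) :=
    fun N => (measurePreserving_cons (μ := μ) N).measurable
  induction N with
  | zero =>
    simp only [Nat.cast_zero, zero_add, one_mul]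
    have hsq := lintegral_cons (μ := μ) (F := fun y => ‖f y‖ₑ ^ 2) (by fun_prop)
    rw [sqInt] at hfin
    rw [sqInt, sqInt, hsq]
    rw [hsq] at hfin
    have hfib := ae_lt_top ((Measurable.lintegral_prod_right'
      (f := fun z : (Fin 0 → X) × X => ‖f (Fin.cons z.2 z.1)‖ₑ ^ 2)
      ((hf.comp ((mcons 0).comp measurable_swap)).enorm.pow_const 2))) hfin.ne
    refine lintegral_mono_ae ?_
    filter_upwards [hfib] with x hx
    have hxL : MemLp (fun ξ => f (Fin.cons ξ x)) 2 μ :=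
      (sqInt_lt_top_iff (hf.comp ((mcons 0).comp measurable_prodMk_right)).aestronglyMeasurable).1 hx
    have := sqInt_sub_mul_conj_add huL hxL hu1
    exact le_of_le_of_eq le_add_self this
  | succ N ih =>
    set a : (Fin (N + 1) → X) → ℂ := fun x => ∫ ξ, u ξ * f (Fin.cons ξ x) ∂μ with ha
    have ham : Measurable a := measurable_integral_mul_cons hu hf
    have hsq := lintegral_cons (μ := μ) (F := fun y => ‖f y‖ₑ ^ 2) (by fun_prop)
    have hfm : Measurable fun z : X × (Fin (N + 1) → X) => f (Fin.cons z.1 z.2) := hf.comp (mcons _)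
    have hfin' := hfin
    rw [sqInt, hsq] at hfin'
    have hfib := ae_lt_top ((Measurable.lintegral_prod_right'
      (f := fun z : (Fin (N + 1) → X) × X => ‖f (Fin.cons z.2 z.1)‖ₑ ^ 2)
      ((hfm.comp measurable_swap).enorm.pow_const 2))) hfin'.ne
    have hpyth : sqInt (Measure.pi fun _ => μ) f
        = (∫⁻ x, sqInt μ (fun ξ => f (Fin.cons ξ x) - a x * conj (u ξ))
            ∂(Measure.pi fun _ : Fin (N + 1) => μ))
          + sqInt (Measure.pi fun _ => μ) a := by
      rw [sqInt, hsq, sqInt, ← lintegral_add_right _ (by fun_prop)]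
      refine lintegral_congr_ae ?_
      filter_upwards [hfib] with x hx
      have hxL : MemLp (fun ξ => f (Fin.cons ξ x)) 2 μ :=
        (sqInt_lt_top_iff (hfm.comp measurable_prodMk_right).aestronglyMeasurable).1 hx
      exact (sqInt_sub_mul_conj_add huL hxL hu1).symm
    have hanti_a : IsAntisymm a := by
      intro i j hij x
      simp only [ha]
      rw [← integral_neg]
      refine integral_congr_ae (Filter.Eventually.of_forall fun ξ => ?_)
      simp only
      rw [cons_comp_swap_succ, hanti _ _ (by simpa using hij)]
      ring
    -- integrability on fibres
    have hff : ∀ᵐ x' ∂(Measure.pi fun _ : Fin N => μ),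
        Integrable (fun z : X × X => u z.2 * (u z.1 * f (Fin.cons z.1 (Fin.cons z.2 x'))))
          (μ.prod μ) ∧ (∀ᵐ η ∂μ, Integrable (fun ξ => u ξ * f (Fin.cons ξ (Fin.cons η x'))) μ) := by
      have hm2 : Measurable fun w : (Fin N → X) × X × X =>
          f (Fin.cons w.2.1 (Fin.cons w.2.2 w.1)) :=
        hfm.comp ((measurable_fst.comp measurable_snd).prodMk
          ((mcons N).comp ((measurable_snd.comp measurable_snd).prodMk measurable_fst)))
      have h3 : ∫⁻ x', ∫⁻ η, ∫⁻ ξ, ‖f (Fin.cons ξ (Fin.cons η x'))‖ₑ ^ 2 ∂μ ∂μ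
          ∂(Measure.pi fun _ : Fin N => μ) < ⊤ := by
        rwa [lintegral_cons (μ := μ) (F := fun x => ∫⁻ ξ, ‖f (Fin.cons ξ x)‖ₑ ^ 2 ∂μ)] at hfin'
        exact (Measurable.lintegral_prod_right'
          (f := fun z : (Fin (N + 1) → X) × X => ‖f (Fin.cons z.2 z.1)‖ₑ ^ 2)
          ((hfm.comp measurable_swap).enorm.pow_const 2))
      have h4 : ∫⁻ x', ∫⁻ w : X × X, ‖f (Fin.cons w.1 (Fin.cons w.2 x'))‖ₑ ^ 2 ∂(μ.prod μ)
          ∂(Measure.pi fun _ : Fin N => μ) < ⊤ := by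
        refine lt_of_eq_of_lt (lintegral_congr fun x' => ?_) h3
        rw [lintegral_prod_symm']
        exact (hm2.comp measurable_prodMk_left).enorm.pow_const 2
      have h5 := ae_lt_top (Measurable.lintegral_prod_right'
        (f := fun w : (Fin N → X) × X × X => ‖f (Fin.cons w.2.1 (Fin.cons w.2.2 w.1))‖ₑ ^ 2)
          (hm2.enorm.pow_const 2)) h4.ne
      have h6 := ae_lt_top (Measurable.lintegral_prod_right'
        (f := fun w : (Fin N → X) × X => ∫⁻ ξ, ‖f (Fin.cons ξ (Fin.cons w.2 w.1))‖ₑ ^ 2 ∂μ)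
          (Measurable.lintegral_prod_right' (f := fun w : ((Fin N → X) × X) × X =>
            ‖f (Fin.cons w.2 (Fin.cons w.1.2 w.1.1))‖ₑ ^ 2)
            ((hm2.comp ((measurable_fst.comp measurable_fst).prodMk (measurable_snd.prodMk
              (measurable_snd.comp measurable_fst)))).enorm.pow_const 2))) h3.ne
      filter_upwards [h5, h6] with x' h5 h6
      constructor
      · have hL : MemLp (fun w : X × X => f (Fin.cons w.1 (Fin.cons w.2 x'))) 2 (μ.prod μ) :=
          (sqInt_lt_top_iff (hm2.comp measurable_prodMk_left).aestronglyMeasurable).1 h5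
        have huu : MemLp (fun w : X × X => u w.2 * u w.1) 2 (μ.prod μ) := by
          refine (sqInt_lt_top_iff (by fun_prop)).1 ?_
          rw [sqInt, lintegral_prod_symm' _ (by fun_prop)]
          simp_rw [enorm_mul, mul_pow]
          rw [lintegral_congr fun y => lintegral_const_mul _ (by fun_prop)]
          rw [lintegral_mul_const _ (by fun_prop)]
          change sqInt μ u * sqInt μ u < ⊤
          simp [hu1]
        have := huu.integrable_mul hL
        refine this.congr (Filter.Eventually.of_forall fun w => ?_)
        simp only [Pi.mul_apply]; ring
      · have hm6 : Measurable fun η => ∫⁻ ξ, ‖f (Fin.cons ξ (Fin.cons η x'))‖ₑ ^ 2 ∂μ :=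
          Measurable.lintegral_prod_right' (f := fun w : X × X =>
            ‖f (Fin.cons w.2 (Fin.cons w.1 x'))‖ₑ ^ 2)
            ((hm2.comp (measurable_const.prodMk measurable_swap)).enorm.pow_const 2)
        filter_upwards [ae_lt_top hm6 h6.ne] with η hη
        have hL : MemLp (fun ξ => f (Fin.cons ξ (Fin.cons η x'))) 2 μ :=
          (sqInt_lt_top_iff (hm2.comp (measurable_const.prodMk
            measurable_prodMk_right)).aestronglyMeasurable).1 hη
        exact huL.integrable_mul hL
    -- The symmetric weight u(η)u(ξ) is integrated against a function antisymmetric in (ξ, η); by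
    -- Fubini the integral equals its own opposite.
    have hzero : ∀ᵐ x' ∂(Measure.pi fun _ : Fin N => μ),
        ∫ η, u η * a (Fin.cons η x') ∂μ = 0 := by
      filter_upwards [hff] with x' hx'
      have h1 : ∫ η, u η * a (Fin.cons η x') ∂μ
          = ∫ η, ∫ ξ, u η * (u ξ * f (Fin.cons ξ (Fin.cons η x'))) ∂μ ∂μ := by
        simp only [ha, integral_const_mul]
      have h2 := integral_integral_swap (f := fun η ξ => u η * (u ξ * f (Fin.cons ξ (Fin.cons η x'))))
        (μ := μ) (ν := μ) hx'.1.swap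
      have h3 : ∫ ξ, ∫ η, u η * (u ξ * f (Fin.cons ξ (Fin.cons η x'))) ∂μ ∂μ
          = - ∫ η, ∫ ξ, u η * (u ξ * f (Fin.cons ξ (Fin.cons η x'))) ∂μ ∂μ := by
        rw [← integral_neg]
        refine integral_congr_ae (Filter.Eventually.of_forall fun ξ => ?_)
        simp only
        rw [← integral_neg]
        refine integral_congr_ae (Filter.Eventually.of_forall fun η => ?_)
        simp only
        rw [cons_cons_comp_swap η ξ, hanti 0 1 (by simp)]
        ring
      rw [h1]
      rw [← h2] at h3
      exact self_eq_neg.1 h3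
    have hperp : ∀ᵐ ξ ∂μ, (N + 1 : ℝ≥0∞) * ∫⁻ x', ‖a (Fin.cons ξ x')‖ₑ ^ 2
          ∂(Measure.pi fun _ : Fin N => μ)
        ≤ ∫⁻ x, ‖f (Fin.cons ξ x) - a x * conj (u ξ)‖ₑ ^ 2 ∂(Measure.pi fun _ => μ) := by
      have hgm : Measurable fun z : X × (Fin (N + 1) → X) =>
          f (Fin.cons z.1 z.2) - a z.2 * conj (u z.1) :=
        hfm.sub ((ham.comp measurable_snd).mul
          (Complex.continuous_conj.measurable.comp (hu.comp measurable_fst)))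
      have hgfin : ∫⁻ ξ, ∫⁻ x, ‖f (Fin.cons ξ x) - a x * conj (u ξ)‖ₑ ^ 2
          ∂(Measure.pi fun _ : Fin (N + 1) => μ) ∂μ < ⊤ := by
        rw [lintegral_lintegral_swap (hgm.enorm.pow_const 2).aemeasurable]
        exact lt_of_le_of_lt (le_of_le_of_eq le_self_add hpyth.symm) hfin
      have hgf := ae_lt_top (Measurable.lintegral_prod_right' (f := fun z : X × (Fin (N + 1) → X) =>
        ‖f (Fin.cons z.1 z.2) - a z.2 * conj (u z.1)‖ₑ ^ 2) (hgm.enorm.pow_const 2)) hgfin.ne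
      have hintg : ∀ᵐ ξ ∂μ, ∀ᵐ x' ∂(Measure.pi fun _ : Fin N => μ),
          Integrable (fun η => u η * f (Fin.cons η (Fin.cons ξ x'))) μ := by
        -- The set where the fibre is integrable must be measurable to exchange the two
        -- almost-everywhere quantifiers.
        have hms : MeasurableSet {w : X × (Fin N → X) |
            Integrable (fun η => u η * f (Fin.cons η (Fin.cons w.1 w.2))) μ} := by
          refine measurableSet_integrable ?_
          refine Measurable.stronglyMeasurable ?_
          exact (hu.comp measurable_snd).mul
            (hfm.comp (measurable_snd.prodMk ((mcons N).comp measurable_fst)))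
        have := (Measure.ae_prod_iff_ae_ae (μ := Measure.pi fun _ : Fin N => μ) (ν := μ)
          (p := fun w : (Fin N → X) × X =>
            Integrable (fun η => u η * f (Fin.cons η (Fin.cons w.2 w.1))) μ)
          (measurable_swap hms)).2 (hff.mono fun x' h => h.2)
        have h2 := (Measure.measurePreserving_swap (μ := μ)
          (ν := Measure.pi fun _ : Fin N => μ)).quasiMeasurePreserving.ae this
        exact Measure.ae_ae_of_ae_prod h2
      have hint2 : ∀ᵐ x' ∂(Measure.pi fun _ : Fin N => μ),
          Integrable (fun η => u η * a (Fin.cons η x')) μ := by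
        filter_upwards [hff] with x' hx'
        have := hx'.1.integral_prod_right
        refine this.congr (Filter.Eventually.of_forall fun η => ?_)
        simp only [ha, integral_const_mul]
      filter_upwards [hgf, hintg] with ξ hξ hξi
      have key := ih (f := fun x => f (Fin.cons ξ x) - a x * conj (u ξ))
        (hgm.comp measurable_prodMk_left) hξ (by
          intro i j hij x
          simp only
          rw [cons_comp_swap_succ, hanti _ _ (by simpa using hij), hanti_a i j hij]
          ring)
      refine le_trans (le_of_eq ?_) key
      congr 1
      refine lintegral_congr_ae ?_
      filter_upwards [hzero, hint2, hξi] with x' h0 hi2 hi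
      have hi3 : Integrable (fun η => u η * f (Fin.cons ξ (Fin.cons η x'))) μ := by
        refine hi.neg.congr (Filter.Eventually.of_forall fun η => ?_)
        simp only [Pi.neg_apply]
        rw [cons_cons_comp_swap ξ η, hanti 0 1 (by simp)]
        ring
      have e1 : ∫ η, u η * (f (Fin.cons ξ (Fin.cons η x')) - a (Fin.cons η x') * conj (u ξ)) ∂μ
          = - a (Fin.cons ξ x') := by
        have : ∀ η, u η * (f (Fin.cons ξ (Fin.cons η x')) - a (Fin.cons η x') * conj (u ξ))
            = u η * f (Fin.cons ξ (Fin.cons η x')) - u η * a (Fin.cons η x') * conj (u ξ) :=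
          fun η => by ring
        simp_rw [this]
        rw [integral_sub hi3 (hi2.mul_const _), integral_mul_const, h0, zero_mul, sub_zero]
        simp only [ha]
        rw [← integral_neg]
        refine integral_congr_ae (Filter.Eventually.of_forall fun η => ?_)
        simp only
        rw [cons_cons_comp_swap η ξ, hanti 0 1 (by simp)]
        ring
      rw [e1, enorm_neg]
    have hNa : (N + 1 : ℝ≥0∞) * sqInt (Measure.pi fun _ => μ) a
        ≤ ∫⁻ x, sqInt μ (fun ξ => f (Fin.cons ξ x) - a x * conj (u ξ))
            ∂(Measure.pi fun _ : Fin (N + 1) => μ) := by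
      have hgm : Measurable fun z : (Fin (N + 1) → X) × X =>
          f (Fin.cons z.2 z.1) - a z.1 * conj (u z.2) :=
        (hfm.comp measurable_swap).sub ((ham.comp measurable_fst).mul
          (Complex.continuous_conj.measurable.comp (hu.comp measurable_snd)))
      unfold sqInt
      rw [lintegral_lintegral_swap (hgm.enorm.pow_const 2).aemeasurable,
        lintegral_cons' (by fun_prop), ← lintegral_const_mul]
      · exact lintegral_mono_ae hperp
      · exact Measurable.lintegral_prod_right' (f := fun z : X × (Fin N → X) =>
          ‖a (Fin.cons z.1 z.2)‖ₑ ^ 2) ((ham.comp (mcons N)).enorm.pow_const 2)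
    rw [hpyth]
    push_cast
    rw [add_mul, one_mul]
    gcongr

/-- `√(N+1) ‖∫ u(ξ) f(ξ, ·) dξ‖ ≤ ‖u‖ ‖f‖` for an antisymmetric `f`. -/
theorem fermi_bound {N : ℕ} {u : X → ℂ} (hu : Measurable u) (huf : sqInt μ u < ⊤)
    {f : (Fin (N + 1) → X) → ℂ} (hf : Measurable f) (hfin : sqInt (Measure.pi fun _ => μ) f < ⊤)
    (hanti : IsAntisymm f) :
    (N + 1 : ℝ≥0∞) * sqInt (Measure.pi fun _ : Fin N => μ) (fun x => ∫ ξ, u ξ * f (Fin.cons ξ x) ∂μ)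
      ≤ sqInt μ u * sqInt (Measure.pi fun _ => μ) f := by
  by_cases h0 : sqInt μ u = 0
  · have hz : ∀ᵐ ξ ∂μ, u ξ = 0 := by
      rw [sqInt, lintegral_eq_zero_iff (by fun_prop)] at h0
      filter_upwards [h0] with ξ hξ
      simpa using hξ
    have : ∀ x : Fin N → X, ∫ ξ, u ξ * f (Fin.cons ξ x) ∂μ = 0 := fun x => by
      rw [integral_congr_ae (g := fun _ => 0) (by filter_upwards [hz] with ξ hξ; simp [hξ])]
      simp
    simp [this, sqInt]
  · set t : ℝ := (sqInt μ u).toReal with ht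
    have htpos : 0 < t := ENNReal.toReal_pos h0 huf.ne
    -- The reciprocal of ‖u‖, so that multiplication by it divides square integrals by `sqInt μ u`.
    set r : ℝ := (√t)⁻¹ with hr
    have hscale : ∀ {α : Type _} [MeasurableSpace α] (ν : Measure α) (g : α → ℂ), Measurable g →
        sqInt ν (fun x => (r : ℂ) * g x) = (sqInt μ u)⁻¹ * sqInt ν g := by
      intro α _ ν g hg
      unfold sqInt
      simp_rw [enorm_mul, mul_pow]
      rw [lintegral_const_mul _ (by fun_prop)]
      congr 1
      have : ‖(r : ℂ)‖ₑ = ENNReal.ofReal r := by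
        rw [← ofReal_norm, Complex.norm_real, Real.norm_of_nonneg (by positivity)]
      rw [this, ← ENNReal.ofReal_pow (by positivity), hr, inv_pow, Real.sq_sqrt htpos.le,
        ENNReal.ofReal_inv_of_pos htpos, ht, ENNReal.ofReal_toReal huf.ne, sqInt]
    have key := fermi_bound_of_normalized (u := fun ξ => (r : ℂ) * u ξ) (hu.const_mul _)
      (by rw [hscale μ u hu, ENNReal.inv_mul_cancel h0 huf.ne]) hf hfin hanti
    have e : (fun x : Fin N → X => ∫ ξ, (r : ℂ) * u ξ * f (Fin.cons ξ x) ∂μ)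
        = fun x => (r : ℂ) * ∫ ξ, u ξ * f (Fin.cons ξ x) ∂μ := by
      ext x
      rw [← integral_const_mul]
      simp_rw [mul_assoc]
    rw [e, hscale _ _ (measurable_integral_mul_cons hu hf)] at key
    calc _ = sqInt μ u * ((N + 1 : ℝ≥0∞) * ((sqInt μ u)⁻¹ * sqInt (Measure.pi fun _ : Fin N => μ)
            (fun x => ∫ ξ, u ξ * f (Fin.cons ξ x) ∂μ))) := by
          rw [mul_left_comm, ← mul_assoc (sqInt μ u), ENNReal.mul_inv_cancel h0 huf.ne, one_mul]
      _ ≤ _ := by gcongr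

end Fermi

/-! ### Splitting off one species -/

theorem measurePreserving_prodProdProdComm {α β γ δ : Type*} [MeasurableSpace α]
    [MeasurableSpace β] [MeasurableSpace γ] [MeasurableSpace δ] (μa : Measure α) (μb : Measure β)
    (μc : Measure γ) (μd : Measure δ) [SFinite μa] [SFinite μb] [SFinite μc] [SFinite μd] :
    MeasurePreserving (fun z : (α × β) × γ × δ => ((z.1.1, z.2.1), (z.1.2, z.2.2)))
      ((μa.prod μb).prod (μc.prod μd)) ((μa.prod μc).prod (μb.prod μd)) := by
  have h1 := measurePreserving_prodAssoc μa μb (μc.prod μd)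
  have h2 := (MeasurePreserving.id μa).prod
    ((measurePreserving_prodAssoc μb μc μd).symm MeasurableEquiv.prodAssoc)
  have h3 := (MeasurePreserving.id μa).prod
    ((Measure.measurePreserving_swap (μ := μb) (ν := μc)).prod (MeasurePreserving.id μd))
  have h4 := (MeasurePreserving.id μa).prod (measurePreserving_prodAssoc μc μb μd)
  have h5 := (measurePreserving_prodAssoc μa μc (μb.prod μd)).symm MeasurableEquiv.prodAssoc
  exact h5.comp (h4.comp (h3.comp (h2.comp h1)))

/-- The occupation numbers after adding one particle of each species in `S`. -/
abbrev addOcc {n : ℕ} (S : Fin n → Bool) (l : Fin n → ℕ) : Fin n → ℕ := fun i => l i + (S i).toNat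

/-- Add a particle of each species in `S` to a configuration. -/
def insertFor {n : ℕ} (S : Fin n → Bool) {l : Fin n → ℕ} (ξ : Fin n → Particle) (X : Config l) :
    Config (addOcc S l) :=
  fun i => addIf (S i) (ξ i) (X i)

/-- Put a group of particles of species `i` into a configuration of the other species. -/
def insertSpecies {n : ℕ} {l : Fin (n + 1) → ℕ} (i : Fin (n + 1)) (x : Fin (l i) → Particle)
    (X : Config fun j => l (i.succAbove j)) : Config l :=
  Fin.insertNth (α := fun j => Fin (l j) → Particle) i x X

@[simp] theorem insertSpecies_same {n : ℕ} {l : Fin (n + 1) → ℕ} (i : Fin (n + 1))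
    (x : Fin (l i) → Particle) (X : Config fun j => l (i.succAbove j)) :
    insertSpecies i x X i = x := by simp [insertSpecies]

@[simp] theorem insertSpecies_succAbove {n : ℕ} {l : Fin (n + 1) → ℕ} (i : Fin (n + 1))
    (x : Fin (l i) → Particle) (X : Config fun j => l (i.succAbove j)) (j : Fin n) :
    insertSpecies i x X (i.succAbove j) = X j := by simp [insertSpecies]

theorem measurePreserving_insertSpecies {n : ℕ} (l : Fin (n + 1) → ℕ) (i : Fin (n + 1)) :
    MeasurePreserving (fun z : (Fin (l i) → Particle) × Config (fun j => l (i.succAbove j)) =>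
      (insertSpecies i z.1 z.2 : Config l))
      ((Measure.pi fun _ => particleMeasure).prod (configMeasure _)) (configMeasure l) :=
  (measurePreserving_piFinSuccAbove (fun j : Fin (n + 1) => Measure.pi fun _ : Fin (l j) =>
    particleMeasure) i).symm

theorem measurePreserving_insertNth (n : ℕ) (i : Fin (n + 1)) :
    MeasurePreserving (fun z : Particle × (Fin n → Particle) =>
      (Fin.insertNth i z.1 z.2 : Fin (n + 1) → Particle))
      (particleMeasure.prod (kernelMeasure n)) (kernelMeasure (n + 1)) :=
  (measurePreserving_piFinSuccAbove (fun _ : Fin (n + 1) => particleMeasure) i).symm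

/-- Assemble the particles to be added and a configuration from the part of species `i` and the
part of the other species. -/
def joinSpecies {n : ℕ} {l : Fin (n + 1) → ℕ} (i : Fin (n + 1))
    (z : (Particle × (Fin (l i) → Particle)) ×
      (Fin n → Particle) × Config fun j => l (i.succAbove j)) :
    (Fin (n + 1) → Particle) × Config l :=
  (Fin.insertNth i z.1.1 z.2.1, insertSpecies i z.1.2 z.2.2)

theorem measurePreserving_joinSpecies {n : ℕ} (l : Fin (n + 1) → ℕ) (i : Fin (n + 1)) :
    MeasurePreserving (joinSpecies (l := l) i)
      ((particleMeasure.prod (Measure.pi fun _ => particleMeasure)).prod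
        ((kernelMeasure n).prod (configMeasure _)))
      ((kernelMeasure (n + 1)).prod (configMeasure l)) :=
  ((measurePreserving_insertNth n i).prod (measurePreserving_insertSpecies l i)).comp
    (measurePreserving_prodProdProdComm _ _ _ _)

theorem insertFor_joinSpecies {n : ℕ} {l : Fin (n + 1) → ℕ} (S : Fin (n + 1) → Bool)
    (i : Fin (n + 1)) (z : (Particle × (Fin (l i) → Particle)) ×
      (Fin n → Particle) × Config fun j => l (i.succAbove j)) :
    insertFor S (joinSpecies i z).1 (joinSpecies i z).2
      = insertSpecies (l := addOcc S l) i (addIf (S i) z.1.1 z.1.2)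
          (insertFor (fun j => S (i.succAbove j)) z.2.1 z.2.2) := by
  ext j : 1
  refine (Fin.forall_iff_succAbove (P := fun j => insertFor S (joinSpecies i z).1
    (joinSpecies i z).2 j = insertSpecies (l := addOcc S l) i (addIf (S i) z.1.1 z.1.2)
          (insertFor (fun j => S (i.succAbove j)) z.2.1 z.2.2) j) i).2 ⟨?_, fun j => ?_⟩ j
  · rw [insertSpecies_same]; simp [insertFor, joinSpecies]
  · rw [insertSpecies_succAbove]; simp [insertFor, joinSpecies]

/-! ### Adding particles is measurable and respects null sets. -/

theorem measurable_addIf {N : ℕ} (b : Bool) :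
    Measurable fun z : Particle × (Fin N → Particle) => addIf b z.1 z.2 := by
  cases b
  · exact measurable_snd
  · exact (measurePreserving_cons (μ := particleMeasure) N).measurable

theorem measurable_insertFor {n : ℕ} (S : Fin n → Bool) (l : Fin n → ℕ) :
    Measurable fun z : (Fin n → Particle) × Config l => insertFor S z.1 z.2 :=
  measurable_pi_lambda _ fun i => by
    have h : Measurable fun z : (Fin n → Particle) × Config l => (z.1 i, z.2 i) :=
      ((measurable_pi_apply i).comp measurable_fst).prodMk
        ((measurable_pi_apply i).comp measurable_snd)
    exact (measurable_addIf (N := l i) (S i)).comp h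

theorem quasiMeasurePreserving_addIf {N : ℕ} (b : Bool) :
    Measure.QuasiMeasurePreserving (fun z : Particle × (Fin N → Particle) => addIf b z.1 z.2)
      (particleMeasure.prod (Measure.pi fun _ => particleMeasure))
      (Measure.pi fun _ => particleMeasure) := by
  cases b
  · exact Measure.quasiMeasurePreserving_snd
  · exact (measurePreserving_cons (μ := particleMeasure) N).quasiMeasurePreserving

/-- A species outside S loses its variable ξᵢ, so the map contains projections and only null sets
can be controlled. This suffices to replace wave functions by almost everywhere equal
representatives inside the integrand. -/
theorem quasiMeasurePreserving_insertFor {n : ℕ} (S : Fin n → Bool) (l : Fin n → ℕ) :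
    Measure.QuasiMeasurePreserving
      (fun z : (Fin n → Particle) × Config l => insertFor S z.1 z.2)
      ((kernelMeasure n).prod (configMeasure l)) (configMeasure (addOcc S l)) := by
  induction n with
  | zero =>
    refine ⟨measurable_insertFor S l, Measure.AbsolutelyContinuous.mk fun s hs h0 => ?_⟩
    -- Without species the configuration space is one point with unit mass, so null sets are empty.
    have hs0 : s = ∅ := by
      by_contra hne
      obtain ⟨x, hx⟩ := Set.nonempty_iff_ne_empty.2 hne
      unfold configMeasure at h0
      rw [Measure.pi_of_empty (x := x), Measure.dirac_apply' _ hs] at h0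
      simp [hx] at h0
    simp [hs0]
  | succ n ih =>
    refine ⟨measurable_insertFor S l, Measure.AbsolutelyContinuous.mk fun s hs h0 => ?_⟩
    rw [Measure.map_apply (measurable_insertFor S l) hs,
      ← (measurePreserving_joinSpecies l 0).measure_preimage
        ((measurable_insertFor S l) hs).nullMeasurableSet]
    have hq := (measurePreserving_insertSpecies (addOcc S l) 0).quasiMeasurePreserving.comp
      (MeasureTheory.QuasiMeasurePreserving.prodMap (quasiMeasurePreserving_addIf (N := l 0) (S 0))
        (ih (fun j => S (Fin.succAbove 0 j)) (fun j => l (Fin.succAbove 0 j))))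
    have := hq.preimage_null h0
    convert this using 2
    ext z
    simp only [Set.mem_preimage]
    rw [insertFor_joinSpecies]
    rfl

/-! ### Symmetric and antisymmetric functions -/

/-- Invariance under the permutations inside each species. -/
def IsSymmConfig {n : ℕ} {l : Fin n → ℕ} (Φ : Config l → ℝ≥0∞) : Prop :=
  ∀ (σ : ∀ i, Equiv.Perm (Fin (l i))) (X : Config l), Φ (permute σ X) = Φ X

/-- Antisymmetry under the permutations inside each species. -/
def IsAntisymmConfig {n : ℕ} {l : Fin n → ℕ} (f : Config l → ℂ) : Prop :=
  ∀ (σ : ∀ i, Equiv.Perm (Fin (l i))) (X : Config l),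
    f (permute σ X) = ((∏ i, (Equiv.Perm.sign (σ i) : ℤ) : ℤ) : ℂ) * f X

theorem permute_insertSpecies {n : ℕ} {l : Fin (n + 1) → ℕ} (i : Fin (n + 1))
    (τ : Equiv.Perm (Fin (l i))) (σ : ∀ j, Equiv.Perm (Fin (l (i.succAbove j))))
    (x : Fin (l i) → Particle) (X : Config fun j => l (i.succAbove j)) :
    permute (Fin.insertNth (α := fun j => Equiv.Perm (Fin (l j))) i τ σ) (insertSpecies i x X)
      = insertSpecies i (x ∘ τ) (permute σ X) := by
  ext j : 1
  refine (Fin.forall_iff_succAbove (P := fun j => permute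
    (Fin.insertNth (α := fun j => Equiv.Perm (Fin (l j))) i τ σ) (insertSpecies i x X) j
      = insertSpecies i (x ∘ τ) (permute σ X) j) i).2 ⟨?_, fun j => ?_⟩ j
  · rw [insertSpecies_same]; ext r : 1; simp [permute]
  · rw [insertSpecies_succAbove]; ext r : 1; simp [permute]

theorem IsSymmConfig.species {n : ℕ} {l : Fin (n + 1) → ℕ} {Φ : Config l → ℝ≥0∞}
    (h : IsSymmConfig Φ) (i : Fin (n + 1)) (τ : Equiv.Perm (Fin (l i)))
    (x : Fin (l i) → Particle) (X : Config fun j => l (i.succAbove j)) :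
    Φ (insertSpecies i (x ∘ τ) X) = Φ (insertSpecies i x X) := by
  have := permute_insertSpecies i τ (fun _ => 1) x X
  rw [show permute (fun _ => 1) X = X from rfl] at this
  rw [← this, h]

theorem IsSymmConfig.others {n : ℕ} {l : Fin (n + 1) → ℕ} {Φ : Config l → ℝ≥0∞}
    (h : IsSymmConfig Φ) (i : Fin (n + 1)) (x : Fin (l i) → Particle) :
    IsSymmConfig fun X : Config fun j => l (i.succAbove j) => Φ (insertSpecies i x X) := by
  intro σ X
  have := permute_insertSpecies i 1 σ x X
  rw [show x ∘ (1 : Equiv.Perm (Fin (l i))) = x from rfl] at this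
  simp only
  rw [← this, h]

theorem IsAntisymmConfig.species {n : ℕ} {l : Fin (n + 1) → ℕ} {f : Config l → ℂ}
    (h : IsAntisymmConfig f) (i : Fin (n + 1)) (X : Config fun j => l (i.succAbove j)) :
    IsAntisymm fun x : Fin (l i) → Particle => f (insertSpecies i x X) := by
  intro r s hrs x
  have := permute_insertSpecies i (Equiv.swap r s) (fun _ => 1) x X
  rw [show permute (fun _ => 1) X = X from rfl] at this
  simp only
  rw [← this, h, Fin.prod_univ_succAbove _ i]
  simp [Equiv.Perm.sign_swap hrs]

theorem IsAntisymmConfig.others {n : ℕ} {l : Fin (n + 1) → ℕ} {f : Config l → ℂ}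
    (h : IsAntisymmConfig f) (i : Fin (n + 1)) (x : Fin (l i) → Particle) :
    IsAntisymmConfig fun X : Config fun j => l (i.succAbove j) => f (insertSpecies i x X) := by
  intro σ X
  have := permute_insertSpecies i 1 σ x X
  rw [show x ∘ (1 : Equiv.Perm (Fin (l i))) = x from rfl] at this
  simp only
  rw [← this, h, Fin.prod_univ_succAbove _ i]
  simp

theorem IsAntisymmConfig.enorm_sq {n : ℕ} {l : Fin n → ℕ} {f : Config l → ℂ}
    (h : IsAntisymmConfig f) : IsSymmConfig fun X => ‖f X‖ₑ ^ 2 := by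
  intro σ X
  simp only
  rw [h, enorm_mul]
  have : ‖((∏ i, (Equiv.Perm.sign (σ i) : ℤ) : ℤ) : ℂ)‖ₑ = 1 := by
    rw [← ofReal_norm]
    push_cast
    rw [norm_prod]
    simp [Complex.norm_intCast, ← Int.cast_abs]
  rw [this, one_mul]

/-! ### The energy bound -/

theorem mul_sq_lintegral_le_of_mul_sq_le {α : Type*} [MeasurableSpace α] {μ : Measure α}
    {c : ℝ≥0∞} (hc0 : c ≠ 0) (hc : c ≠ ⊤)
    {h a b : α → ℝ≥0∞} (ha : AEMeasurable a μ) (hb : AEMeasurable b μ)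
    (hab : ∀ᵐ x ∂μ, c * h x ^ 2 ≤ a x * b x) :
    c * (∫⁻ x, h x ∂μ) ^ 2 ≤ (∫⁻ x, a x ∂μ) * ∫⁻ x, b x ∂μ := by
  have := sq_lintegral_le_of_sq_le (h := h) (a := fun x => c⁻¹ * a x) (ha.const_mul _) hb (by
    filter_upwards [hab] with x hx
    rw [mul_assoc]
    calc h x ^ 2 = c⁻¹ * (c * h x ^ 2) := by
          rw [← mul_assoc, ENNReal.inv_mul_cancel hc0 hc, one_mul]
      _ ≤ _ := by gcongr)
  rw [lintegral_const_mul'' _ ha] at this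
  calc _ ≤ c * (c⁻¹ * (∫⁻ x, a x ∂μ) * ∫⁻ x, b x ∂μ) := by gcongr
    _ = _ := by rw [← mul_assoc, ← mul_assoc, ENNReal.mul_inv_cancel hc0 hc, one_mul]

theorem measurePreserving_comp_perm {X : Type*} [MeasurableSpace X] (μ : Measure X) [SigmaFinite μ]
    {N : ℕ} (σ : Equiv.Perm (Fin N)) :
    MeasurePreserving (fun x : Fin N → X => x ∘ σ) (Measure.pi fun _ => μ)
      (Measure.pi fun _ => μ) := by
  have h := measurePreserving_piCongrLeft (fun _ : Fin N => μ) σ.symm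
  convert h using 1
  ext x r : 2
  have := MeasurableEquiv.piCongrLeft_apply_apply (β := fun _ : Fin N => X) σ.symm x (σ r)
  simpa using this.symm

/-- The factor `∑ᵣ w(xᵣ)` if a particle is to be removed from `x`, and `1` otherwise. -/
noncomputable def occWeight (b : Bool) (w : Particle → ℝ≥0∞) {N : ℕ} (x : Fin N → Particle) :
    ℝ≥0∞ :=
  if b then ∑ r, w (x r) else 1

theorem measurable_occWeight (b : Bool) {w : Particle → ℝ≥0∞} (hw : Measurable w) (N : ℕ) :
    Measurable fun x : Fin N → Particle => occWeight b w x := by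
  unfold occWeight; cases b
  · simp
  · simp; fun_prop

/-- By symmetry of Φ, each of the N+1 terms of the sum over particles has the same integral as the
one for the first particle. For Φ = |f|² this is ∫ w(ξ) ‖b(ξ) f‖² dξ = ⟨f, dΓ(w) f⟩. -/
theorem lintegral_cons_weight {N : ℕ} {w : Particle → ℝ≥0∞} (hw : Measurable w)
    {Φ : (Fin (N + 1) → Particle) → ℝ≥0∞} (hΦ : Measurable Φ)
    (hsymm : ∀ (σ : Equiv.Perm (Fin (N + 1))) x, Φ (x ∘ σ) = Φ x) :
    (N + 1 : ℝ≥0∞) * ∫⁻ z : Particle × (Fin N → Particle), w z.1 * Φ (Fin.cons z.1 z.2)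
        ∂(particleMeasure.prod (Measure.pi fun _ => particleMeasure))
      = ∫⁻ x, Φ x * occWeight true w x ∂(Measure.pi fun _ => particleMeasure) := by
  have h1 : ∀ r : Fin (N + 1), ∫⁻ x, Φ x * w (x r) ∂(Measure.pi fun _ => particleMeasure)
      = ∫⁻ z : Particle × (Fin N → Particle), w z.1 * Φ (Fin.cons z.1 z.2)
        ∂(particleMeasure.prod (Measure.pi fun _ => particleMeasure)) := by
    intro r
    rw [← (measurePreserving_comp_perm particleMeasure (Equiv.swap r 0)).lintegral_comp
      (f := fun x => Φ x * w (x r)) (by fun_prop)]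
    simp only [hsymm, Function.comp_apply, Equiv.swap_apply_left]
    rw [← (measurePreserving_cons (μ := particleMeasure) N).lintegral_comp
      (f := fun x => Φ x * w (x 0)) (by fun_prop)]
    simp only [Fin.cons_zero, mul_comm]
  simp only [occWeight, if_true, Finset.mul_sum]
  rw [lintegral_finsetSum _ (fun r _ => by fun_prop)]
  simp [h1]

/-- Insert w⁻¹w before Cauchy–Schwarz: w⁻¹ stays with A, while w joins the function that carries the
particle, where `lintegral_cons_weight` absorbs the factor N+1. -/
theorem occ_bound_aux {N : ℕ} {w A : Particle → ℝ≥0∞} (hw : Measurable w)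
    (hA : Measurable A) (hw0 : ∀ᵐ ξ ∂particleMeasure, w ξ ≠ 0) (hwt : ∀ ξ, w ξ ≠ ⊤)
    {Φ : (Fin (N + 1) → Particle) → ℝ≥0∞} {Γ : (Fin N → Particle) → ℝ≥0∞}
    (hΦ : Measurable Φ) (hΓ : Measurable Γ)
    (hsΦ : ∀ (σ : Equiv.Perm (Fin (N + 1))) x, Φ (x ∘ σ) = Φ x)
    {c : ℝ≥0∞} (hc0 : c ≠ 0) (hc : c ≠ ⊤) {h : Particle × (Fin N → Particle) → ℝ≥0∞}
    (hh : ∀ᵐ z ∂(particleMeasure.prod (Measure.pi fun _ => particleMeasure)),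
      c * h z ^ 2 ≤ A z.1 * Φ (Fin.cons z.1 z.2) * Γ z.2) :
    (N + 1 : ℝ≥0∞) * c * (∫⁻ z, h z ∂(particleMeasure.prod
        (Measure.pi fun _ => particleMeasure))) ^ 2
      ≤ (∫⁻ ξ, A ξ * (w ξ)⁻¹ ∂particleMeasure)
        * (∫⁻ x, Φ x * occWeight true w x ∂(Measure.pi fun _ => particleMeasure))
        * (∫⁻ x, Γ x ∂(Measure.pi fun _ => particleMeasure)) := by
  have mc := (measurePreserving_cons (μ := particleMeasure) N).measurable
  have key := mul_sq_lintegral_le_of_mul_sq_le hc0 hc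
    (μ := particleMeasure.prod (Measure.pi fun _ : Fin N => particleMeasure)) (h := h)
    (a := fun z => A z.1 * (w z.1)⁻¹ * Γ z.2) (b := fun z => w z.1 * Φ (Fin.cons z.1 z.2))
    (by fun_prop) (((hw.comp measurable_fst).mul (hΦ.comp mc)).aemeasurable) (by
      have h0 : ∀ᵐ z ∂(particleMeasure.prod (Measure.pi fun _ : Fin N => particleMeasure)),
        w z.1 ≠ 0 := Measure.quasiMeasurePreserving_fst.ae hw0
      filter_upwards [hh, h0] with z hz hz0
      refine hz.trans (le_of_eq ?_)
      calc _ = (w z.1)⁻¹ * w z.1 * (A z.1 * Φ (Fin.cons z.1 z.2) * Γ z.2) := by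
            rw [ENNReal.inv_mul_cancel hz0 (hwt _), one_mul]
        _ = _ := by ring)
  rw [lintegral_prod_mul (f := fun ξ => A ξ * (w ξ)⁻¹) (by fun_prop) (by fun_prop)] at key
  rw [← lintegral_cons_weight hw hΦ hsΦ, mul_assoc]
  refine (mul_le_mul_right key _).trans (le_of_eq ?_)
  ring

/-- Creation and annihilation together: exactly one of Φ and Γ receives the particle, and only that
one acquires the weight. -/
theorem occ_bound {N : ℕ} {b b' : Bool} (hb : b' = !b) {w A : Particle → ℝ≥0∞} (hw : Measurable w)
    (hA : Measurable A) (hw0 : ∀ᵐ ξ ∂particleMeasure, w ξ ≠ 0) (hwt : ∀ ξ, w ξ ≠ ⊤)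
    {Φ : (Fin (N + b.toNat) → Particle) → ℝ≥0∞} {Γ : (Fin (N + b'.toNat) → Particle) → ℝ≥0∞}
    (hΦ : Measurable Φ) (hΓ : Measurable Γ)
    (hsΦ : ∀ (σ : Equiv.Perm (Fin (N + b.toNat))) x, Φ (x ∘ σ) = Φ x)
    (hsΓ : ∀ (σ : Equiv.Perm (Fin (N + b'.toNat))) x, Γ (x ∘ σ) = Γ x)
    {c : ℝ≥0∞} (hc0 : c ≠ 0) (hc : c ≠ ⊤) {h : Particle × (Fin N → Particle) → ℝ≥0∞}
    (hh : ∀ᵐ z ∂(particleMeasure.prod (Measure.pi fun _ => particleMeasure)),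
      c * h z ^ 2 ≤ A z.1 * Φ (addIf b z.1 z.2) * Γ (addIf b' z.1 z.2)) :
    (N + 1 : ℝ≥0∞) * c * (∫⁻ z, h z ∂(particleMeasure.prod
        (Measure.pi fun _ => particleMeasure))) ^ 2
      ≤ (∫⁻ ξ, A ξ * (w ξ)⁻¹ ∂particleMeasure)
        * (∫⁻ x, Φ x * occWeight b w x ∂(Measure.pi fun _ => particleMeasure))
        * (∫⁻ x, Γ x * occWeight b' w x ∂(Measure.pi fun _ => particleMeasure)) := by
  subst hb
  cases b
  · have := occ_bound_aux hw hA hw0 hwt (Φ := Γ) (Γ := Φ) hΓ hΦ hsΓ hc0 hc (h := h) (by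
      filter_upwards [hh] with z hz
      refine hz.trans (le_of_eq ?_)
      exact mul_right_comm _ _ _)
    refine this.trans (le_of_eq ?_)
    rw [mul_right_comm]
    simp [occWeight]
    rfl
  · have := occ_bound_aux hw hA hw0 hwt (Φ := Φ) (Γ := Γ) hΦ hΓ hsΦ hc0 hc (h := h) hh
    refine this.trans (le_of_eq ?_)
    simp [occWeight]
    rfl

theorem measurable_insertSpecies {n : ℕ} (l : Fin (n + 1) → ℕ) (i : Fin (n + 1)) :
    Measurable fun z : (Fin (l i) → Particle) × Config (fun j => l (i.succAbove j)) =>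
      (insertSpecies i z.1 z.2 : Config l) :=
  (measurePreserving_insertSpecies l i).measurable

theorem lintegral_insertSpecies {n : ℕ} (l : Fin (n + 1) → ℕ) (i : Fin (n + 1))
    {Φ : Config l → ℝ≥0∞} (hΦ : Measurable Φ) :
    ∫⁻ Y, Φ Y ∂(configMeasure l) = ∫⁻ x, ∫⁻ Y, Φ (insertSpecies i x Y)
      ∂(configMeasure fun j => l (i.succAbove j)) ∂(Measure.pi fun _ => particleMeasure) := by
  rw [← (measurePreserving_insertSpecies l i).lintegral_comp hΦ, lintegral_prod]
  exact (hΦ.comp (measurable_insertSpecies l i)).aemeasurable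

theorem lintegral_insertNth {n : ℕ} (i : Fin (n + 1))
    {A : (Fin (n + 1) → Particle) → ℝ≥0∞} (hA : Measurable A) :
    ∫⁻ ξ, A ξ ∂(kernelMeasure (n + 1)) = ∫⁻ x, ∫⁻ ξ, A (Fin.insertNth (α := fun _ => Particle) i x ξ)
      ∂(kernelMeasure n) ∂particleMeasure := by
  rw [← (measurePreserving_insertNth n i).lintegral_comp hA, lintegral_prod]
  exact (hA.comp (measurePreserving_insertNth n i).measurable).aemeasurable

theorem measurable_prod_occWeight {n : ℕ} (S : Fin n → Bool) {w : Fin n → Particle → ℝ≥0∞}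
    (hw : ∀ i, Measurable (w i)) (l : Fin n → ℕ) :
    Measurable fun Y : Config l => ∏ i, occWeight (S i) (w i) (Y i) :=
  Finset.measurable_prod _ fun i _ =>
    (measurable_occWeight (S i) (hw i) (l i)).comp (measurable_pi_apply i)

theorem lintegral_prod_occWeight {n : ℕ} (l : Fin (n + 1) → ℕ) (i : Fin (n + 1))
    (S : Fin (n + 1) → Bool) {w : Fin (n + 1) → Particle → ℝ≥0∞} (hw : ∀ i, Measurable (w i))
    {Φ : Config l → ℝ≥0∞} (hΦ : Measurable Φ) :
    ∫⁻ Y, Φ Y * ∏ j, occWeight (S j) (w j) (Y j) ∂(configMeasure l)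
      = ∫⁻ x, (∫⁻ Y, Φ (insertSpecies i x Y) * ∏ j, occWeight (S (i.succAbove j))
          (w (i.succAbove j)) (Y j) ∂(configMeasure fun j => l (i.succAbove j)))
          * occWeight (S i) (w i) x ∂(Measure.pi fun _ => particleMeasure) := by
  have hm : Measurable fun Y : Config l => Φ Y * ∏ j, occWeight (S j) (w j) (Y j) :=
    hΦ.mul (measurable_prod_occWeight S hw l)
  rw [lintegral_insertSpecies l i hm]
  refine lintegral_congr fun x => ?_
  rw [← lintegral_mul_const]
  · refine lintegral_congr fun Y => ?_
    simp only
    rw [Fin.prod_univ_succAbove _ i]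
    simp only [insertSpecies_same, insertSpecies_succAbove]
    ring
  · exact (hΦ.comp ((measurable_insertSpecies l i).comp measurable_prodMk_left)).mul
      (measurable_prod_occWeight _ (fun j => hw _) _)

/-- The absolute bound: Cauchy-Schwarz, species by species, with weights `w i`. -/
theorem config_bound {n : ℕ} (l : Fin n → ℕ) (S R : Fin n → Bool) (hSR : ∀ i, R i = !S i)
    {w : Fin n → Particle → ℝ≥0∞} (hw : ∀ i, Measurable (w i))
    (hw0 : ∀ i, ∀ᵐ ξ ∂particleMeasure, w i ξ ≠ 0) (hwt : ∀ i ξ, w i ξ ≠ ⊤)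
    {A : (Fin n → Particle) → ℝ≥0∞} {Φ : Config (addOcc S l) → ℝ≥0∞}
    {Γ : Config (addOcc R l) → ℝ≥0∞} (hA : Measurable A) (hΦ : Measurable Φ) (hΓ : Measurable Γ)
    (hsΦ : IsSymmConfig Φ) (hsΓ : IsSymmConfig Γ) {c : ℝ≥0∞} (hc0 : c ≠ 0) (hc : c ≠ ⊤)
    {h : (Fin n → Particle) × Config l → ℝ≥0∞} (hhm : Measurable h)
    (hh : ∀ᵐ z ∂((kernelMeasure n).prod (configMeasure l)),
      c * h z ^ 2 ≤ A z.1 * Φ (insertFor S z.1 z.2) * Γ (insertFor R z.1 z.2)) :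
    (∏ i, (l i + 1 : ℝ≥0∞)) * c * (∫⁻ z, h z ∂((kernelMeasure n).prod (configMeasure l))) ^ 2
      ≤ (∫⁻ ξ, A ξ * ∏ i, (w i (ξ i))⁻¹ ∂(kernelMeasure n))
        * (∫⁻ Y, Φ Y * ∏ i, occWeight (S i) (w i) (Y i) ∂(configMeasure (addOcc S l)))
        * (∫⁻ Y, Γ Y * ∏ i, occWeight (R i) (w i) (Y i) ∂(configMeasure (addOcc R l))) := by
  induction n generalizing c with
  | zero =>
    have hk : kernelMeasure 0 Set.univ = 1 := by
      unfold kernelMeasure; rw [Measure.pi_of_empty, measure_univ]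
    have hcm : ∀ l : Fin 0 → ℕ, configMeasure l Set.univ = 1 := fun l => by
      unfold configMeasure; rw [Measure.pi_of_empty, measure_univ]
    have hz : c * h default ^ 2 ≤ A default * Φ (insertFor S default default)
        * Γ (insertFor R default default) := by
      have hne : (kernelMeasure 0).prod (configMeasure l) ≠ 0 := by
        intro h0
        have := congrArg (fun μ => μ Set.univ) h0
        simp only [← Set.univ_prod_univ, Measure.prod_prod, hk, hcm] at this
        simp at this
      have : (ae ((kernelMeasure 0).prod (configMeasure l))).NeBot := ae_neBot.2 hne
      obtain ⟨z, hz⟩ := hh.exists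
      rwa [Subsingleton.elim z default] at hz
    let _ : Unique ((Fin 0 → Particle) × Config l) := Unique.mk' _
    rw [lintegral_unique, lintegral_unique, lintegral_unique, lintegral_unique,
      ← Set.univ_prod_univ, Measure.prod_prod, hk, hcm, hcm, hcm]
    simp only [Finset.univ_eq_empty, Finset.prod_empty, mul_one, one_mul]
    rw [Subsingleton.elim (insertFor S _ _) default, Subsingleton.elim (insertFor R _ _) default]
      at hz
    convert hz using 4
  | succ n ih =>
    have mj := measurePreserving_joinSpecies l 0
    have mhj : Measurable fun z => h (joinSpecies 0 z) := hhm.comp mj.measurable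
    have hae := Measure.ae_ae_of_ae_prod (mj.quasiMeasurePreserving.ae hh)
    have mΦ : Measurable fun z : (Fin (addOcc S l 0) → Particle) ×
        Config (fun j => addOcc S l (Fin.succAbove 0 j)) => Φ (insertSpecies 0 z.1 z.2) :=
      hΦ.comp (measurable_insertSpecies _ 0)
    have mΓ : Measurable fun z : (Fin (addOcc R l 0) → Particle) ×
        Config (fun j => addOcc R l (Fin.succAbove 0 j)) => Γ (insertSpecies 0 z.1 z.2) :=
      hΓ.comp (measurable_insertSpecies _ 0)
    have mA : Measurable fun z : Particle × (Fin n → Particle) =>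
        A (Fin.insertNth (α := fun _ => Particle) 0 z.1 z.2) :=
      hA.comp (measurePreserving_insertNth n 0).measurable
    have hprod0 : (∏ j : Fin n, (l (Fin.succAbove 0 j) + 1 : ℝ≥0∞)) ≠ 0 :=
      Finset.prod_ne_zero_iff.2 fun i _ => by simp
    have hprodt : (∏ j : Fin n, (l (Fin.succAbove 0 j) + 1 : ℝ≥0∞)) ≠ ⊤ :=
      ENNReal.prod_ne_top fun i _ => by simp
    -- The other species are integrated first, at fixed variables of species 0. The induction
    -- hypothesis for them is precisely the pointwise inequality required here, with their factors
    -- lⱼ+1 absorbed into the constant.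
    have step := occ_bound (N := l 0) (hSR 0) (hw 0)
      (A := fun ξ => ∫⁻ ξr, A (Fin.insertNth (α := fun _ => Particle) 0 ξ ξr)
        * ∏ j, (w (Fin.succAbove 0 j) (ξr j))⁻¹ ∂(kernelMeasure n))
      (Measurable.lintegral_prod_right' (f := fun z : Particle × (Fin n → Particle) =>
        A (Fin.insertNth (α := fun _ => Particle) 0 z.1 z.2)
          * ∏ j, (w (Fin.succAbove 0 j) (z.2 j))⁻¹) (mA.mul (by fun_prop)))
      (hw0 0) (hwt 0)
      (Φ := fun x => ∫⁻ Y, Φ (insertSpecies 0 x Y) * ∏ j, occWeight (S (Fin.succAbove 0 j))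
        (w (Fin.succAbove 0 j)) (Y j) ∂(configMeasure fun j => addOcc S l (Fin.succAbove 0 j)))
      (Γ := fun x => ∫⁻ Y, Γ (insertSpecies 0 x Y) * ∏ j, occWeight (R (Fin.succAbove 0 j))
        (w (Fin.succAbove 0 j)) (Y j) ∂(configMeasure fun j => addOcc R l (Fin.succAbove 0 j)))
      (Measurable.lintegral_prod_right' (f := fun z : (Fin (addOcc S l 0) → Particle) ×
        Config (fun j => addOcc S l (Fin.succAbove 0 j)) => Φ (insertSpecies 0 z.1 z.2)
          * ∏ j, occWeight (S (Fin.succAbove 0 j)) (w (Fin.succAbove 0 j)) (z.2 j))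
        (mΦ.mul ((measurable_prod_occWeight _ (fun j => hw _) _).comp measurable_snd)))
      (Measurable.lintegral_prod_right' (f := fun z : (Fin (addOcc R l 0) → Particle) ×
        Config (fun j => addOcc R l (Fin.succAbove 0 j)) => Γ (insertSpecies 0 z.1 z.2)
          * ∏ j, occWeight (R (Fin.succAbove 0 j)) (w (Fin.succAbove 0 j)) (z.2 j))
        (mΓ.mul ((measurable_prod_occWeight _ (fun j => hw _) _).comp measurable_snd)))
      (fun σ x => by
        refine lintegral_congr fun Y => ?_
        rw [IsSymmConfig.species (l := addOcc S l) hsΦ 0 σ])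
      (fun σ x => by
        refine lintegral_congr fun Y => ?_
        rw [IsSymmConfig.species (l := addOcc R l) hsΓ 0 σ])
      (c := (∏ j : Fin n, (l (Fin.succAbove 0 j) + 1 : ℝ≥0∞)) * c)
      (mul_ne_zero hprod0 hc0) (ENNReal.mul_ne_top hprodt hc)
      (h := fun z1 => ∫⁻ z2, h (joinSpecies 0 (z1, z2)) ∂((kernelMeasure n).prod
        (configMeasure fun j => l (Fin.succAbove 0 j)))) (by
        filter_upwards [hae] with z1 hz1
        refine ih (fun j => l (Fin.succAbove 0 j)) (fun j => S (Fin.succAbove 0 j))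
          (fun j => R (Fin.succAbove 0 j)) (fun j => hSR _)
          (w := fun j => w (Fin.succAbove 0 j)) (fun j => hw _)
          (fun j => hw0 _) (fun j => hwt _) (mA.comp measurable_prodMk_left)
          (mΦ.comp measurable_prodMk_left) (mΓ.comp measurable_prodMk_left)
          (IsSymmConfig.others (l := addOcc S l) hsΦ 0 _)
          (IsSymmConfig.others (l := addOcc R l) hsΓ 0 _) hc0 hc
          (mhj.comp measurable_prodMk_left) ?_
        filter_upwards [hz1] with z2 hz2
        rw [insertFor_joinSpecies, insertFor_joinSpecies] at hz2
        exact hz2)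
    have e0 : ∫⁻ z, h z ∂((kernelMeasure (n + 1)).prod (configMeasure l))
        = ∫⁻ z1, ∫⁻ z2, h (joinSpecies 0 (z1, z2)) ∂((kernelMeasure n).prod
          (configMeasure fun j => l (Fin.succAbove 0 j)))
          ∂(particleMeasure.prod (Measure.pi fun _ => particleMeasure)) := by
      rw [← mj.lintegral_comp hhm, lintegral_prod _ mhj.aemeasurable]
    have eA : ∫⁻ ξ, A ξ * ∏ i, (w i (ξ i))⁻¹ ∂(kernelMeasure (n + 1))
        = ∫⁻ ξ, (∫⁻ ξr, A (Fin.insertNth (α := fun _ => Particle) 0 ξ ξr)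
        * ∏ j, (w (Fin.succAbove 0 j) (ξr j))⁻¹ ∂(kernelMeasure n)) * (w 0 ξ)⁻¹
          ∂particleMeasure := by
      have hm : Measurable fun ξ : Fin (n + 1) → Particle => A ξ * ∏ i, (w i (ξ i))⁻¹ :=
        hA.mul (by fun_prop)
      rw [lintegral_insertNth 0 hm]
      refine lintegral_congr fun x => ?_
      rw [← lintegral_mul_const]
      · refine lintegral_congr fun Y => ?_
        rw [Fin.prod_univ_succAbove _ 0, Fin.insertNth_apply_same]
        simp only [Fin.insertNth_apply_succAbove]
        ring
      · exact (mA.comp measurable_prodMk_left).mul (by fun_prop)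
    rw [e0, eA, lintegral_prod_occWeight _ 0 S hw hΦ, lintegral_prod_occWeight _ 0 R hw hΓ,
      Fin.prod_univ_succAbove _ 0, mul_assoc (l 0 + 1 : ℝ≥0∞)]
    exact step

theorem occWeight_one (b : Bool) {N : ℕ} (x : Fin N → Particle) :
    occWeight b (fun _ => 1) x = if b then (N : ℝ≥0∞) else 1 := by
  simp [occWeight]

/-- For w = 1 the weights are occupation numbers: species i contributes lᵢ+1 once on the right, on
the side that carries its particle, and this cancels ∏(lᵢ+1). The combinatorial factor is lost, but
the bound is absolute and yields integrability. -/
theorem config_bound_one {n : ℕ} (l : Fin n → ℕ) (S R : Fin n → Bool) (hSR : ∀ i, R i = !S i)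
    {G : (Fin n → Particle) → ℂ} {f : Config (addOcc S l) → ℂ} {g : Config (addOcc R l) → ℂ}
    (hG : Measurable G) (hf : Measurable f) (hg : Measurable g)
    (haf : IsAntisymmConfig f) (hag : IsAntisymmConfig g) :
    (∫⁻ z, ‖G z.1 * (f (insertFor S z.1 z.2) * g (insertFor R z.1 z.2))‖ₑ
        ∂((kernelMeasure n).prod (configMeasure l))) ^ 2
      ≤ sqInt (kernelMeasure n) G * sqInt (configMeasure (addOcc S l)) f
        * sqInt (configMeasure (addOcc R l)) g := by
  have hfm := hf.comp (measurable_insertFor S l)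
  have hgm := hg.comp (measurable_insertFor R l)
  have key := config_bound l S R hSR (w := fun _ _ => 1) (fun _ => measurable_const)
    (fun _ => by simp) (fun _ => by simp) (A := fun ξ => ‖G ξ‖ₑ ^ 2) (Φ := fun Y => ‖f Y‖ₑ ^ 2)
    (Γ := fun Y => ‖g Y‖ₑ ^ 2) (by fun_prop) (by fun_prop) (by fun_prop) haf.enorm_sq hag.enorm_sq
    (c := 1) one_ne_zero ENNReal.one_ne_top
    (h := fun z => ‖G z.1 * (f (insertFor S z.1 z.2) * g (insertFor R z.1 z.2))‖ₑ)
    ((hG.comp measurable_fst).mul (hfm.mul hgm)).enorm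
    (Filter.Eventually.of_forall fun z => by
      rw [enorm_mul, enorm_mul, mul_pow, mul_pow, one_mul, mul_assoc])
  simp only [occWeight_one, inv_one, Finset.prod_const_one, mul_one] at key
  rw [lintegral_mul_const _ (by fun_prop), lintegral_mul_const _ (by fun_prop)] at key
  have e : ((∏ i, if S i then ((l i + (S i).toNat : ℕ) : ℝ≥0∞) else 1)
      * ∏ i, if R i then ((l i + (R i).toNat : ℕ) : ℝ≥0∞) else 1) = ∏ i, (l i + 1 : ℝ≥0∞) := by
    rw [← Finset.prod_mul_distrib]
    refine Finset.prod_congr rfl fun i _ => ?_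
    rw [hSR]
    cases S i <;> simp
  have hP0 : (∏ i, (l i + 1 : ℝ≥0∞)) ≠ 0 := Finset.prod_ne_zero_iff.2 fun i _ => by simp
  have hPt : (∏ i, (l i + 1 : ℝ≥0∞)) ≠ ⊤ := ENNReal.prod_ne_top fun i _ => by simp
  refine (ENNReal.mul_le_mul_iff_right hP0 hPt).1 (key.trans (le_of_eq ?_))
  rw [← e]
  unfold sqInt
  ring

theorem integrable_interaction {n : ℕ} (l : Fin n → ℕ) (S R : Fin n → Bool)
    (hSR : ∀ i, R i = !S i)
    {G : (Fin n → Particle) → ℂ} {f : Config (addOcc S l) → ℂ} {g : Config (addOcc R l) → ℂ}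
    (hG : Measurable G) (hf : Measurable f) (hg : Measurable g)
    (haf : IsAntisymmConfig f) (hag : IsAntisymmConfig g)
    (hGt : sqInt (kernelMeasure n) G < ⊤) (hft : sqInt (configMeasure (addOcc S l)) f < ⊤)
    (hgt : sqInt (configMeasure (addOcc R l)) g < ⊤) :
    Integrable (fun z : (Fin n → Particle) × Config l =>
      G z.1 * (f (insertFor S z.1 z.2) * g (insertFor R z.1 z.2)))
      ((kernelMeasure n).prod (configMeasure l)) := by
  refine ⟨((hG.comp measurable_fst).mul ((hf.comp (measurable_insertFor S l)).mul
    (hg.comp (measurable_insertFor R l)))).aestronglyMeasurable, ?_⟩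
  have := (config_bound_one l S R hSR hG hf hg haf hag).trans_lt
    (ENNReal.mul_lt_top (ENNReal.mul_lt_top hGt hft) hgt)
  rw [HasFiniteIntegral]
  by_contra hne
  rw [not_lt, top_le_iff] at hne
  rw [hne] at this
  simp at this

/-! ### The fermionic bound, one species -/

theorem sq_enorm_integral_le {α : Type*} [MeasurableSpace α] {μ : Measure α} {F : α → ℂ}
    {a b : α → ℝ≥0∞} {c : ℝ≥0∞} (hc0 : c ≠ 0) (hc : c ≠ ⊤) (ha : AEMeasurable a μ)
    (hb : AEMeasurable b μ) (hab : ∀ᵐ x ∂μ, c * ‖F x‖ₑ ^ 2 ≤ a x * b x) :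
    c * ‖∫ x, F x ∂μ‖ₑ ^ 2 ≤ (∫⁻ x, a x ∂μ) * ∫⁻ x, b x ∂μ :=
  le_trans (by gcongr; exact enorm_integral_le_lintegral_enorm _)
    (mul_sq_lintegral_le_of_mul_sq_le hc0 hc ha hb hab)

theorem integrable_mul_cons {N : ℕ} {G : Particle → ℂ} {φ : (Fin (N + 1) → Particle) → ℂ}
    {γ : (Fin N → Particle) → ℂ} (hG : Measurable G) (hφ : Measurable φ) (hγ : Measurable γ)
    (hGt : sqInt particleMeasure G < ⊤)
    (hφt : sqInt (Measure.pi fun _ => particleMeasure) φ < ⊤)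
    (hγt : sqInt (Measure.pi fun _ => particleMeasure) γ < ⊤) :
    Integrable (fun z : Particle × (Fin N → Particle) => G z.1 * (φ (Fin.cons z.1 z.2) * γ z.2))
      (particleMeasure.prod (Measure.pi fun _ => particleMeasure)) := by
  have mc := measurePreserving_cons (μ := particleMeasure) N
  have h1 : MemLp (fun z : Particle × (Fin N → Particle) => G z.1 * γ z.2) 2
      (particleMeasure.prod (Measure.pi fun _ => particleMeasure)) := by
    refine (sqInt_lt_top_iff (by fun_prop)).1 ?_
    unfold sqInt
    simp_rw [enorm_mul, mul_pow]
    rw [lintegral_prod_mul (μ := particleMeasure) (ν := Measure.pi fun _ : Fin N => particleMeasure)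
      (f := fun ξ => ‖G ξ‖ₑ ^ 2) (g := fun x => ‖γ x‖ₑ ^ 2) (by fun_prop) (by fun_prop)]
    exact ENNReal.mul_lt_top hGt hγt
  have h2 : MemLp (fun z : Particle × (Fin N → Particle) => φ (Fin.cons z.1 z.2)) 2
      (particleMeasure.prod (Measure.pi fun _ => particleMeasure)) :=
    ((sqInt_lt_top_iff hφ.aestronglyMeasurable).1 hφt).comp_measurePreserving mc
  refine (h1.integrable_mul h2).congr (Filter.Eventually.of_forall fun z => ?_)
  simp only [Pi.mul_apply]; ring

/-- Contract φ with G first, by `fermi_bound`, then apply Cauchy–Schwarz against γ. The factor N+1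
comes from cancellation, so the modulus must stay outside the integral. -/
theorem species_bound_aux {N : ℕ} {G : Particle → ℂ} {φ : (Fin (N + 1) → Particle) → ℂ}
    {γ : (Fin N → Particle) → ℂ} (hG : Measurable G) (hφ : Measurable φ) (hγ : Measurable γ)
    (hGt : sqInt particleMeasure G < ⊤)
    (hφt : sqInt (Measure.pi fun _ => particleMeasure) φ < ⊤)
    (hγt : sqInt (Measure.pi fun _ => particleMeasure) γ < ⊤) (haφ : IsAntisymm φ) :
    (N + 1 : ℝ≥0∞) * ‖∫ z : Particle × (Fin N → Particle),
        G z.1 * (φ (Fin.cons z.1 z.2) * γ z.2)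
        ∂(particleMeasure.prod (Measure.pi fun _ => particleMeasure))‖ₑ ^ 2
      ≤ sqInt particleMeasure G * sqInt (Measure.pi fun _ => particleMeasure) φ
        * sqInt (Measure.pi fun _ => particleMeasure) γ := by
  rw [integral_prod_symm _ (integrable_mul_cons hG hφ hγ hGt hφt hγt)]
  have e : ∀ x : Fin N → Particle, ∫ ξ, G ξ * (φ (Fin.cons ξ x) * γ x) ∂particleMeasure
      = (∫ ξ, G ξ * φ (Fin.cons ξ x) ∂particleMeasure) * γ x := fun x => by
    rw [← integral_mul_const]; simp_rw [mul_assoc]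
  simp only [e]
  have m1 : Measurable fun x : Fin N → Particle => ∫ ξ, G ξ * φ (Fin.cons ξ x) ∂particleMeasure :=
    measurable_integral_mul_cons hG hφ
  refine (mul_le_mul_right (le_trans (by rw [one_mul]) (sq_enorm_integral_le one_ne_zero
    ENNReal.one_ne_top (a := fun x => ‖∫ ξ, G ξ * φ (Fin.cons ξ x) ∂particleMeasure‖ₑ ^ 2)
    (b := fun x => ‖γ x‖ₑ ^ 2) (m1.enorm.pow_const 2).aemeasurable (by fun_prop)
    (Filter.Eventually.of_forall fun x => by rw [enorm_mul, mul_pow, one_mul]))) _).trans ?_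
  rw [← mul_assoc]
  exact mul_le_mul_left (fermi_bound hG hGt hφ hφt haφ) _

theorem species_bound {N : ℕ} {b b' : Bool} (hb : b' = !b) {G : Particle → ℂ}
    {φ : (Fin (N + b.toNat) → Particle) → ℂ} {γ : (Fin (N + b'.toNat) → Particle) → ℂ}
    (hG : Measurable G) (hφ : Measurable φ) (hγ : Measurable γ)
    (hGt : sqInt particleMeasure G < ⊤)
    (hφt : sqInt (Measure.pi fun _ => particleMeasure) φ < ⊤)
    (hγt : sqInt (Measure.pi fun _ => particleMeasure) γ < ⊤)
    (haφ : IsAntisymm φ) (haγ : IsAntisymm γ) :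
    (N + 1 : ℝ≥0∞) * ‖∫ z : Particle × (Fin N → Particle),
        G z.1 * (φ (addIf b z.1 z.2) * γ (addIf b' z.1 z.2))
        ∂(particleMeasure.prod (Measure.pi fun _ => particleMeasure))‖ₑ ^ 2
      ≤ sqInt particleMeasure G * sqInt (Measure.pi fun _ => particleMeasure) φ
        * sqInt (Measure.pi fun _ => particleMeasure) γ := by
  subst hb
  cases b
  · have := species_bound_aux (φ := γ) (γ := φ) hG hγ hφ hGt hγt hφt haγ
    rw [mul_right_comm] at this
    simp_rw [mul_comm (γ _)] at this
    exact this
  · exact species_bound_aux (φ := φ) (γ := γ) hG hφ hγ hGt hφt hγt haφ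

/-! ### The bound by the energy of all species but one -/

theorem integral_joinSpecies {n : ℕ} (l : Fin (n + 1) → ℕ) (i : Fin (n + 1))
    (F : (Fin (n + 1) → Particle) × Config l → ℂ) :
    ∫ z, F z ∂((kernelMeasure (n + 1)).prod (configMeasure l))
      = ∫ z, F (joinSpecies i z) ∂((particleMeasure.prod (Measure.pi fun _ => particleMeasure)).prod
        ((kernelMeasure n).prod (configMeasure _))) := by
  let e : (Particle × (Fin (l i) → Particle)) ×
      (Fin n → Particle) × Config (fun j => l (i.succAbove j))
      ≃ᵐ (Fin (n + 1) → Particle) × Config l :=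
    { toFun := joinSpecies i
      invFun := fun z => ((z.1 i, z.2 i), (fun j => z.1 (i.succAbove j),
        fun j => z.2 (i.succAbove j)))
      left_inv := fun z => by simp [joinSpecies]
      right_inv := fun z => by
        simp only [joinSpecies, insertSpecies]
        ext1
        · exact Fin.insertNth_self_removeNth i z.1
        · exact Fin.insertNth_self_removeNth i z.2
      measurable_toFun := (measurePreserving_joinSpecies l i).measurable
      measurable_invFun := by
        refine ((by fun_prop : Measurable _).prodMk (by fun_prop : Measurable _)).prodMk
          ((by fun_prop : Measurable _).prodMk (by fun_prop : Measurable _)) }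
  exact ((measurePreserving_joinSpecies l i).integral_comp e.measurableEmbedding F).symm

/-- Species i is integrated with its sign by `species_bound`, which produces lᵢ+1 at no cost in
energy. The modulus is taken only afterwards, and `config_bound` with c = lᵢ+1 treats the other
species, applied to the square integrals over the variables of species i. -/
theorem energy_bound {n : ℕ} (l : Fin (n + 1) → ℕ) (S R : Fin (n + 1) → Bool)
    (hSR : ∀ i, R i = !S i) (i : Fin (n + 1)) {w : Fin n → Particle → ℝ≥0∞}
    (hw : ∀ j, Measurable (w j)) (hw0 : ∀ j, ∀ᵐ ξ ∂particleMeasure, w j ξ ≠ 0)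
    (hwt : ∀ j ξ, w j ξ ≠ ⊤)
    {G : (Fin (n + 1) → Particle) → ℂ} {f : Config (addOcc S l) → ℂ} {g : Config (addOcc R l) → ℂ}
    (hG : Measurable G) (hf : Measurable f) (hg : Measurable g)
    (haf : IsAntisymmConfig f) (hag : IsAntisymmConfig g)
    (hGt : sqInt (kernelMeasure (n + 1)) G < ⊤) (hft : sqInt (configMeasure (addOcc S l)) f < ⊤)
    (hgt : sqInt (configMeasure (addOcc R l)) g < ⊤) :
    (∏ j, (l j + 1 : ℝ≥0∞)) * ‖∫ z : (Fin (n + 1) → Particle) × Config l,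
        G z.1 * (f (insertFor S z.1 z.2) * g (insertFor R z.1 z.2))
        ∂((kernelMeasure (n + 1)).prod (configMeasure l))‖ₑ ^ 2
      ≤ (∫⁻ ξ, ‖G ξ‖ₑ ^ 2 * ∏ j, (w j (ξ (i.succAbove j)))⁻¹ ∂(kernelMeasure (n + 1)))
        * (∫⁻ Y, ‖f Y‖ₑ ^ 2 * ∏ j, occWeight (S (i.succAbove j)) (w j) (Y (i.succAbove j))
            ∂(configMeasure (addOcc S l)))
        * (∫⁻ Y, ‖g Y‖ₑ ^ 2 * ∏ j, occWeight (R (i.succAbove j)) (w j) (Y (i.succAbove j))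
            ∂(configMeasure (addOcc R l))) := by
  have mj := measurePreserving_joinSpecies l i
  have mf := hf.comp (measurable_insertSpecies (addOcc S l) i)
  have mg := hg.comp (measurable_insertSpecies (addOcc R l) i)
  have mG := hG.comp (measurePreserving_insertNth n i).measurable
  have hintg : Integrable (fun z => G (joinSpecies (l := l) i z).1 *
      (f (insertFor S (joinSpecies i z).1 (joinSpecies i z).2)
        * g (insertFor R (joinSpecies i z).1 (joinSpecies i z).2)))
      ((particleMeasure.prod (Measure.pi fun _ => particleMeasure)).prod
        ((kernelMeasure n).prod (configMeasure _))) :=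
    mj.integrable_comp_of_integrable (integrable_interaction l S R hSR hG hf hg haf hag hGt hft hgt)
  have hmeas : Measurable (fun z => G (joinSpecies (l := l) i z).1 *
      (f (insertFor S (joinSpecies i z).1 (joinSpecies i z).2)
        * g (insertFor R (joinSpecies i z).1 (joinSpecies i z).2))) :=
    (hG.comp (measurable_fst.comp mj.measurable)).mul
      ((hf.comp ((measurable_insertFor S l).comp mj.measurable)).mul
        (hg.comp ((measurable_insertFor R l).comp mj.measurable)))
  rw [integral_joinSpecies l i, integral_prod_symm _ hintg]
  -- the three square integrals over the variables of species `i`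
  set A : (Fin n → Particle) → ℝ≥0∞ := fun ξr =>
    ∫⁻ ξ, ‖G (Fin.insertNth (α := fun _ => Particle) i ξ ξr)‖ₑ ^ 2 ∂particleMeasure with hA
  set Φ : Config (fun j => addOcc S l (i.succAbove j)) → ℝ≥0∞ := fun Y =>
    ∫⁻ x, ‖f (insertSpecies i x Y)‖ₑ ^ 2 ∂(Measure.pi fun _ => particleMeasure) with hΦ
  set Γ : Config (fun j => addOcc R l (i.succAbove j)) → ℝ≥0∞ := fun Y =>
    ∫⁻ x, ‖g (insertSpecies i x Y)‖ₑ ^ 2 ∂(Measure.pi fun _ => particleMeasure) with hΓ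
  have hAm : Measurable A := Measurable.lintegral_prod_left' (mG.enorm.pow_const 2)
  have hΦm : Measurable Φ := Measurable.lintegral_prod_left' (mf.enorm.pow_const 2)
  have hΓm : Measurable Γ := Measurable.lintegral_prod_left' (mg.enorm.pow_const 2)
  have hAint : ∀ {W : (Fin n → Particle) → ℝ≥0∞}, Measurable W →
      ∫⁻ ξ, ‖G ξ‖ₑ ^ 2 * W (fun j => ξ (i.succAbove j)) ∂(kernelMeasure (n + 1))
        = ∫⁻ ξr, A ξr * W ξr ∂(kernelMeasure n) := by
    intro W hW
    rw [lintegral_insertNth i (by fun_prop), lintegral_lintegral_swap]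
    · refine lintegral_congr fun ξr => ?_
      simp only [Fin.insertNth_apply_succAbove, hA]
      exact lintegral_mul_const _ ((mG.comp measurable_prodMk_right).enorm.pow_const 2)
    · simp only [Function.uncurry_def, Fin.insertNth_apply_succAbove]
      exact ((mG.enorm.pow_const 2).mul (hW.comp measurable_snd)).aemeasurable
  have hΦint : ∀ {l' : Fin (n + 1) → ℕ} {f : Config l' → ℂ}, Measurable f →
      ∀ {W : Config (fun j => l' (i.succAbove j)) → ℝ≥0∞}, Measurable W →
      ∫⁻ Y, ‖f Y‖ₑ ^ 2 * W (fun j => Y (i.succAbove j)) ∂(configMeasure l')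
        = ∫⁻ Y, (∫⁻ x, ‖f (insertSpecies i x Y)‖ₑ ^ 2 ∂(Measure.pi fun _ => particleMeasure)) * W Y
            ∂(configMeasure fun j => l' (i.succAbove j)) := by
    intro l' f hf W hW
    have mf := hf.comp (measurable_insertSpecies l' i)
    rw [lintegral_insertSpecies l' i (by fun_prop), lintegral_lintegral_swap]
    · refine lintegral_congr fun ξr => ?_
      simp only [insertSpecies_succAbove]
      exact lintegral_mul_const _ ((mf.comp measurable_prodMk_right).enorm.pow_const 2)
    · simp only [Function.uncurry_def, insertSpecies_succAbove]
      exact ((mf.enorm.pow_const 2).mul (hW.comp measurable_snd)).aemeasurable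
  have hAt : ∀ᵐ ξr ∂(kernelMeasure n), A ξr < ⊤ := by
    refine ae_lt_top hAm ?_
    have := hAint (W := fun _ => 1) measurable_const
    simp only [mul_one] at this
    rw [← this]; exact hGt.ne
  have hΦt : ∀ᵐ Y ∂(configMeasure fun j => addOcc S l (i.succAbove j)), Φ Y < ⊤ := by
    refine ae_lt_top hΦm ?_
    have := hΦint hf (W := fun _ => 1) measurable_const
    simp only [mul_one] at this
    rw [← this]; exact hft.ne
  have hΓt : ∀ᵐ Y ∂(configMeasure fun j => addOcc R l (i.succAbove j)), Γ Y < ⊤ := by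
    refine ae_lt_top hΓm ?_
    have := hΦint hg (W := fun _ => 1) measurable_const
    simp only [mul_one] at this
    rw [← this]; exact hgt.ne
  have key := config_bound (fun j => l (i.succAbove j)) (fun j => S (i.succAbove j))
    (fun j => R (i.succAbove j)) (fun j => hSR _) hw hw0 hwt hAm hΦm hΓm
    (fun σ Y => by
      simp only [hΦ]
      refine lintegral_congr fun x => ?_
      exact IsSymmConfig.others (l := addOcc S l) haf.enorm_sq i x σ Y)
    (fun σ Y => by
      simp only [hΓ]
      refine lintegral_congr fun x => ?_
      exact IsSymmConfig.others (l := addOcc R l) hag.enorm_sq i x σ Y)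
    (c := (l i + 1 : ℝ≥0∞)) (by simp) (by simp)
    (h := fun z2 => ‖∫ z1, G (joinSpecies (l := l) i (z1, z2)).1 *
      (f (insertFor S (joinSpecies i (z1, z2)).1 (joinSpecies i (z1, z2)).2)
        * g (insertFor R (joinSpecies i (z1, z2)).1 (joinSpecies i (z1, z2)).2))
        ∂(particleMeasure.prod (Measure.pi fun _ => particleMeasure))‖ₑ)
    (hmeas.stronglyMeasurable.integral_prod_left').measurable.enorm (by
      have q1 := (Measure.quasiMeasurePreserving_fst (μ := kernelMeasure n)
        (ν := configMeasure fun j => l (i.succAbove j))).ae hAt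
      have q2 := (quasiMeasurePreserving_insertFor (fun j => S (i.succAbove j))
        (fun j => l (i.succAbove j))).ae hΦt
      have q3 := (quasiMeasurePreserving_insertFor (fun j => R (i.succAbove j))
        (fun j => l (i.succAbove j))).ae hΓt
      filter_upwards [q1, q2, q3] with z2 h1 h2 h3
      simp_rw [insertFor_joinSpecies]
      exact species_bound (N := l i) (hSR i)
        (G := fun ξ => G (Fin.insertNth (α := fun _ => Particle) i ξ z2.1))
        (φ := fun x => f (insertSpecies (l := addOcc S l) i x
          (insertFor (fun j => S (i.succAbove j)) z2.1 z2.2)))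
        (γ := fun x => g (insertSpecies (l := addOcc R l) i x
          (insertFor (fun j => R (i.succAbove j)) z2.1 z2.2)))
        (mG.comp measurable_prodMk_right)
        (mf.comp measurable_prodMk_right) (mg.comp measurable_prodMk_right) h1 h2 h3
        (IsAntisymmConfig.species (l := addOcc S l) haf i _)
        (IsAntisymmConfig.species (l := addOcc R l) hag i _))
  rw [hAint (W := fun ξr => ∏ j, (w j (ξr j))⁻¹) (by fun_prop),
    hΦint hf (W := fun Y => ∏ j, occWeight (S (i.succAbove j)) (w j) (Y j))
      (measurable_prod_occWeight _ hw _),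
    hΦint hg (W := fun Y => ∏ j, occWeight (R (i.succAbove j)) (w j) (Y j))
      (measurable_prod_occWeight _ hw _)]
  refine le_trans ?_ key
  rw [Fin.prod_univ_succAbove _ i, mul_comm (l i + 1 : ℝ≥0∞)]
  gcongr
  exact enorm_integral_le_lintegral_enorm _

/-! ### The bound by the modes -/

theorem sqInt_prod_lt_top {n : ℕ} {u : Fin n → Particle → ℂ} (hu : ∀ i, Measurable (u i))
    (hut : ∀ i, sqInt particleMeasure (u i) < ⊤) :
    sqInt (kernelMeasure n) (fun ξ => ∏ i, u i (ξ i)) < ⊤ := by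
  have hm : Measurable fun ξ : Fin n → Particle => ∏ i, u i (ξ i) := by fun_prop
  rw [sqInt_lt_top_iff hm.aestronglyMeasurable, memLp_two_iff_integrable_sq_norm
    hm.aestronglyMeasurable]
  simp_rw [norm_prod, ← Finset.prod_pow]
  refine Integrable.fintype_prod (f := fun i ξ => ‖u i ξ‖ ^ 2) fun i => ?_
  rw [← memLp_two_iff_integrable_sq_norm (hu i).aestronglyMeasurable,
    ← sqInt_lt_top_iff (hu i).aestronglyMeasurable]
  exact hut i

/-- One species is removed by contracting f with u₀: `fermi_bound` gives (N+1)‖f'‖² ≤ ‖u₀‖²‖f‖² for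
the contraction f', which keeps its antisymmetry in the other species. The bound for those species
is used at fixed remaining variables x and integrated by Cauchy–Schwarz in x. -/
theorem mode_bound_step {n N : ℕ} {l : Fin n → ℕ} {S R : Fin n → Bool} {u₀ : Particle → ℂ}
    {u : Fin n → Particle → ℂ} (hu₀ : Measurable u₀) (hu₀t : sqInt particleMeasure u₀ < ⊤)
    (IH : ∀ {f : Config (addOcc S l) → ℂ} {g : Config (addOcc R l) → ℂ}, Measurable f →
      Measurable g → IsAntisymmConfig f → IsAntisymmConfig g →
      sqInt (configMeasure (addOcc S l)) f < ⊤ → sqInt (configMeasure (addOcc R l)) g < ⊤ →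
      (∏ i, (l i + 1 : ℝ≥0∞)) * ‖∫ z : (Fin n → Particle) × Config l,
        (∏ i, u i (z.1 i)) * (f (insertFor S z.1 z.2) * g (insertFor R z.1 z.2))
        ∂((kernelMeasure n).prod (configMeasure l))‖ₑ ^ 2
      ≤ (∏ i, sqInt particleMeasure (u i)) * sqInt (configMeasure (addOcc S l)) f
        * sqInt (configMeasure (addOcc R l)) g)
    {f : (Fin (N + 1) → Particle) → Config (addOcc S l) → ℂ}
    {g : (Fin N → Particle) → Config (addOcc R l) → ℂ}
    (hf : Measurable (Function.uncurry f)) (hg : Measurable (Function.uncurry g))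
    (haf : ∀ x, IsAntisymmConfig (f x)) (hag : ∀ x, IsAntisymmConfig (g x))
    (haf' : ∀ Y, IsAntisymm fun x => f x Y)
    (hft : ∫⁻ x, ∫⁻ Y, ‖f x Y‖ₑ ^ 2 ∂(configMeasure _) ∂(Measure.pi fun _ => particleMeasure) < ⊤)
    (hgt : ∫⁻ x, ∫⁻ Y, ‖g x Y‖ₑ ^ 2 ∂(configMeasure _) ∂(Measure.pi fun _ => particleMeasure) < ⊤)
    (hintg : Integrable (fun z : (Particle × (Fin N → Particle)) × (Fin n → Particle) × Config l =>
      (u₀ z.1.1 * ∏ i, u i (z.2.1 i)) * (f (Fin.cons z.1.1 z.1.2) (insertFor S z.2.1 z.2.2)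
        * g z.1.2 (insertFor R z.2.1 z.2.2)))
      ((particleMeasure.prod (Measure.pi fun _ => particleMeasure)).prod
        ((kernelMeasure n).prod (configMeasure l)))) :
    ((N + 1 : ℝ≥0∞) * ∏ i, (l i + 1 : ℝ≥0∞)) *
      ‖∫ z : (Particle × (Fin N → Particle)) × (Fin n → Particle) × Config l,
      (u₀ z.1.1 * ∏ i, u i (z.2.1 i)) * (f (Fin.cons z.1.1 z.1.2) (insertFor S z.2.1 z.2.2)
        * g z.1.2 (insertFor R z.2.1 z.2.2))
      ∂((particleMeasure.prod (Measure.pi fun _ => particleMeasure)).prod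
        ((kernelMeasure n).prod (configMeasure l)))‖ₑ ^ 2
      ≤ (sqInt particleMeasure u₀ * ∏ i, sqInt particleMeasure (u i))
        * (∫⁻ x, ∫⁻ Y, ‖f x Y‖ₑ ^ 2 ∂(configMeasure _) ∂(Measure.pi fun _ => particleMeasure))
        * ∫⁻ x, ∫⁻ Y, ‖g x Y‖ₑ ^ 2 ∂(configMeasure _) ∂(Measure.pi fun _ => particleMeasure) := by
  set f' : (Fin N → Particle) → Config (addOcc S l) → ℂ := fun x Y =>
    ∫ ξ, u₀ ξ * f (Fin.cons ξ x) Y ∂particleMeasure with hf'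
  have mc := (measurePreserving_cons (μ := particleMeasure) N).measurable
  have mf' : Measurable (Function.uncurry f') := by
    have h : Measurable fun w : ((Fin N → Particle) × Config (addOcc S l)) × Particle =>
        u₀ w.2 * Function.uncurry f (Fin.cons w.2 w.1.1, w.1.2) :=
      (hu₀.comp measurable_snd).mul (hf.comp ((mc.comp (measurable_snd.prodMk
        (measurable_fst.comp measurable_fst))).prodMk (measurable_snd.comp measurable_fst)))
    exact (h.stronglyMeasurable.integral_prod_right' (ν := particleMeasure)).measurable
  have haf'' : ∀ x, IsAntisymmConfig (f' x) := by
    intro x σ Y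
    simp only [hf']
    rw [← integral_const_mul]
    refine integral_congr_ae (Filter.Eventually.of_forall fun ξ => ?_)
    simp only
    rw [haf]; ring
  have hsw : ∀ {M : ℕ} {L : Fin n → ℕ} {k : (Fin M → Particle) → Config L → ℂ},
      Measurable (Function.uncurry k) →
      ∫⁻ x, ∫⁻ Y, ‖k x Y‖ₑ ^ 2 ∂(configMeasure _) ∂(Measure.pi fun _ => particleMeasure)
        = ∫⁻ Y, ∫⁻ x, ‖k x Y‖ₑ ^ 2 ∂(Measure.pi fun _ => particleMeasure) ∂(configMeasure _) :=
    fun hk => lintegral_lintegral_swap (hk.enorm.pow_const 2).aemeasurable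
  have hfermi : (N + 1 : ℝ≥0∞) * ∫⁻ x, ∫⁻ Y, ‖f' x Y‖ₑ ^ 2 ∂(configMeasure _)
        ∂(Measure.pi fun _ => particleMeasure)
      ≤ sqInt particleMeasure u₀ * ∫⁻ x, ∫⁻ Y, ‖f x Y‖ₑ ^ 2 ∂(configMeasure _)
        ∂(Measure.pi fun _ => particleMeasure) := by
    rw [hsw mf', hsw hf]
    have m1 : Measurable fun Y => ∫⁻ x, ‖f' x Y‖ₑ ^ 2 ∂(Measure.pi fun _ => particleMeasure) :=
      Measurable.lintegral_prod_left' (mf'.enorm.pow_const 2)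
    have m2 : Measurable fun Y => ∫⁻ x, ‖f x Y‖ₑ ^ 2 ∂(Measure.pi fun _ => particleMeasure) :=
      Measurable.lintegral_prod_left' (hf.enorm.pow_const 2)
    rw [← lintegral_const_mul _ m1, ← lintegral_const_mul _ m2]
    have hfin : ∀ᵐ Y ∂(configMeasure (addOcc S l)),
        ∫⁻ x, ‖f x Y‖ₑ ^ 2 ∂(Measure.pi fun _ => particleMeasure) < ⊤ :=
      ae_lt_top m2 (by rw [← hsw hf]; exact hft.ne)
    refine lintegral_mono_ae ?_
    filter_upwards [hfin] with Y hY
    have mY : Measurable fun x => f x Y := hf.comp measurable_prodMk_right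
    exact fermi_bound (f := fun x => f x Y) hu₀ hu₀t mY hY (haf' Y)
  have hf't : ∫⁻ x, ∫⁻ Y, ‖f' x Y‖ₑ ^ 2 ∂(configMeasure _)
      ∂(Measure.pi fun _ => particleMeasure) < ⊤ := by
    refine lt_of_le_of_lt ?_ (hfermi.trans_lt (ENNReal.mul_lt_top hu₀t hft))
    exact le_mul_of_one_le_left' le_add_self
  have mF : Measurable fun x => ∫⁻ Y, ‖f' x Y‖ₑ ^ 2 ∂(configMeasure (addOcc S l)) :=
    Measurable.lintegral_prod_right' (mf'.enorm.pow_const 2)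
  have mGa : Measurable fun x => ∫⁻ Y, ‖g x Y‖ₑ ^ 2 ∂(configMeasure (addOcc R l)) :=
    Measurable.lintegral_prod_right' (hg.enorm.pow_const 2)
  have hpa := measurePreserving_prodAssoc particleMeasure
    (Measure.pi fun _ : Fin N => particleMeasure) ((kernelMeasure n).prod (configMeasure l))
  have hint2 : Integrable (fun z : Particle × (Fin N → Particle) × (Fin n → Particle) × Config l =>
      (u₀ z.1 * ∏ i, u i (z.2.2.1 i)) * (f (Fin.cons z.1 z.2.1) (insertFor S z.2.2.1 z.2.2.2)
        * g z.2.1 (insertFor R z.2.2.1 z.2.2.2)))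
      (particleMeasure.prod ((Measure.pi fun _ => particleMeasure).prod
        ((kernelMeasure n).prod (configMeasure l)))) := by
    rw [← hpa.integrable_comp_emb MeasurableEquiv.prodAssoc.measurableEmbedding]
    exact hintg
  have hval : ∀ y : (Fin N → Particle) × (Fin n → Particle) × Config l,
      ∫ ξ, (u₀ ξ * ∏ i, u i (y.2.1 i)) * (f (Fin.cons ξ y.1) (insertFor S y.2.1 y.2.2)
        * g y.1 (insertFor R y.2.1 y.2.2)) ∂particleMeasure
      = (∏ i, u i (y.2.1 i)) * (f' y.1 (insertFor S y.2.1 y.2.2)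
        * g y.1 (insertFor R y.2.1 y.2.2)) := by
    intro y
    simp only [hf']
    rw [← integral_mul_const, ← integral_const_mul]
    refine integral_congr_ae (Filter.Eventually.of_forall fun ξ => ?_)
    simp only
    ring
  have hint3 : Integrable (fun y : (Fin N → Particle) × (Fin n → Particle) × Config l =>
      (∏ i, u i (y.2.1 i)) * (f' y.1 (insertFor S y.2.1 y.2.2)
        * g y.1 (insertFor R y.2.1 y.2.2))) ((Measure.pi fun _ => particleMeasure).prod
        ((kernelMeasure n).prod (configMeasure l))) := by
    refine hint2.integral_prod_right.congr (Filter.Eventually.of_forall fun y => ?_)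
    exact hval y
  have hval2 : ∫ z : (Particle × (Fin N → Particle)) × (Fin n → Particle) × Config l,
      (u₀ z.1.1 * ∏ i, u i (z.2.1 i)) * (f (Fin.cons z.1.1 z.1.2) (insertFor S z.2.1 z.2.2)
        * g z.1.2 (insertFor R z.2.1 z.2.2))
      ∂((particleMeasure.prod (Measure.pi fun _ => particleMeasure)).prod
        ((kernelMeasure n).prod (configMeasure l)))
      = ∫ x, ∫ z2 : (Fin n → Particle) × Config l,
        (∏ i, u i (z2.1 i)) * (f' x (insertFor S z2.1 z2.2) * g x (insertFor R z2.1 z2.2))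
        ∂((kernelMeasure n).prod (configMeasure l)) ∂(Measure.pi fun _ => particleMeasure) := by
    rw [← integral_prod _ hint3]
    simp_rw [← hval]
    rw [← integral_prod_symm _ hint2,
      ← hpa.integral_comp MeasurableEquiv.prodAssoc.measurableEmbedding]
    rfl
  rw [hval2]
  have hP0 : (∏ i, (l i + 1 : ℝ≥0∞)) ≠ 0 := Finset.prod_ne_zero_iff.2 fun i _ => by simp
  have hPt : (∏ i, (l i + 1 : ℝ≥0∞)) ≠ ⊤ := ENNReal.prod_ne_top fun i _ => by simp
  have key := sq_enorm_integral_le (μ := Measure.pi fun _ : Fin N => particleMeasure)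
    (F := fun x => ∫ z2 : (Fin n → Particle) × Config l,
        (∏ i, u i (z2.1 i)) * (f' x (insertFor S z2.1 z2.2) * g x (insertFor R z2.1 z2.2))
        ∂((kernelMeasure n).prod (configMeasure l)))
    (a := fun x => (∏ i, sqInt particleMeasure (u i)) *
      ∫⁻ Y, ‖f' x Y‖ₑ ^ 2 ∂(configMeasure (addOcc S l)))
    (b := fun x => ∫⁻ Y, ‖g x Y‖ₑ ^ 2 ∂(configMeasure (addOcc R l))) hP0 hPt
    (mF.const_mul _).aemeasurable mGa.aemeasurable (by
      filter_upwards [ae_lt_top mF hf't.ne, ae_lt_top mGa hgt.ne] with x h1 h2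
      exact IH (mf'.comp measurable_prodMk_left) (hg.comp measurable_prodMk_left) (haf'' x) (hag x)
        h1 h2)
  rw [lintegral_const_mul _ mF] at key
  rw [mul_assoc]
  refine (mul_le_mul_right key _).trans ?_
  calc _ = (∏ i, sqInt particleMeasure (u i)) * ((N + 1 : ℝ≥0∞) *
          ∫⁻ x, ∫⁻ Y, ‖f' x Y‖ₑ ^ 2 ∂(configMeasure _) ∂(Measure.pi fun _ => particleMeasure))
          * ∫⁻ x, ∫⁻ Y, ‖g x Y‖ₑ ^ 2 ∂(configMeasure _) ∂(Measure.pi fun _ => particleMeasure) := by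
        ring
    _ ≤ (∏ i, sqInt particleMeasure (u i)) * (sqInt particleMeasure u₀ *
          ∫⁻ x, ∫⁻ Y, ‖f x Y‖ₑ ^ 2 ∂(configMeasure _) ∂(Measure.pi fun _ => particleMeasure))
          * ∫⁻ x, ∫⁻ Y, ‖g x Y‖ₑ ^ 2 ∂(configMeasure _) ∂(Measure.pi fun _ => particleMeasure) := by
        gcongr
    _ = _ := by ring

theorem mode_bound_step_addIf {n N : ℕ} {l : Fin n → ℕ} {S R : Fin n → Bool} {u₀ : Particle → ℂ}
    {b b' : Bool} (hb : b' = !b)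
    {u : Fin n → Particle → ℂ} (hu₀ : Measurable u₀) (hu₀t : sqInt particleMeasure u₀ < ⊤)
    (IH : ∀ {f : Config (addOcc S l) → ℂ} {g : Config (addOcc R l) → ℂ}, Measurable f →
      Measurable g → IsAntisymmConfig f → IsAntisymmConfig g →
      sqInt (configMeasure (addOcc S l)) f < ⊤ → sqInt (configMeasure (addOcc R l)) g < ⊤ →
      (∏ i, (l i + 1 : ℝ≥0∞)) * ‖∫ z : (Fin n → Particle) × Config l,
        (∏ i, u i (z.1 i)) * (f (insertFor S z.1 z.2) * g (insertFor R z.1 z.2))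
        ∂((kernelMeasure n).prod (configMeasure l))‖ₑ ^ 2
      ≤ (∏ i, sqInt particleMeasure (u i)) * sqInt (configMeasure (addOcc S l)) f
        * sqInt (configMeasure (addOcc R l)) g)
    {f : (Fin (N + b.toNat) → Particle) → Config (addOcc S l) → ℂ}
    {g : (Fin (N + b'.toNat) → Particle) → Config (addOcc R l) → ℂ}
    (hf : Measurable (Function.uncurry f)) (hg : Measurable (Function.uncurry g))
    (haf : ∀ x, IsAntisymmConfig (f x)) (hag : ∀ x, IsAntisymmConfig (g x))
    (haf' : ∀ Y, IsAntisymm fun x => f x Y) (hag' : ∀ Y, IsAntisymm fun x => g x Y)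
    (hft : ∫⁻ x, ∫⁻ Y, ‖f x Y‖ₑ ^ 2 ∂(configMeasure _) ∂(Measure.pi fun _ => particleMeasure) < ⊤)
    (hgt : ∫⁻ x, ∫⁻ Y, ‖g x Y‖ₑ ^ 2 ∂(configMeasure _) ∂(Measure.pi fun _ => particleMeasure) < ⊤)
    (hintg : Integrable (fun z : (Particle × (Fin N → Particle)) × (Fin n → Particle) × Config l =>
      (u₀ z.1.1 * ∏ i, u i (z.2.1 i)) * (f (addIf b z.1.1 z.1.2) (insertFor S z.2.1 z.2.2)
        * g (addIf b' z.1.1 z.1.2) (insertFor R z.2.1 z.2.2)))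
      ((particleMeasure.prod (Measure.pi fun _ => particleMeasure)).prod
        ((kernelMeasure n).prod (configMeasure l)))) :
    ((N + 1 : ℝ≥0∞) * ∏ i, (l i + 1 : ℝ≥0∞)) *
      ‖∫ z : (Particle × (Fin N → Particle)) × (Fin n → Particle) × Config l,
      (u₀ z.1.1 * ∏ i, u i (z.2.1 i)) * (f (addIf b z.1.1 z.1.2) (insertFor S z.2.1 z.2.2)
        * g (addIf b' z.1.1 z.1.2) (insertFor R z.2.1 z.2.2))
      ∂((particleMeasure.prod (Measure.pi fun _ => particleMeasure)).prod
        ((kernelMeasure n).prod (configMeasure l)))‖ₑ ^ 2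
      ≤ (sqInt particleMeasure u₀ * ∏ i, sqInt particleMeasure (u i))
        * (∫⁻ x, ∫⁻ Y, ‖f x Y‖ₑ ^ 2 ∂(configMeasure _) ∂(Measure.pi fun _ => particleMeasure))
        * ∫⁻ x, ∫⁻ Y, ‖g x Y‖ₑ ^ 2 ∂(configMeasure _) ∂(Measure.pi fun _ => particleMeasure) := by
  subst hb
  cases b
  · have := mode_bound_step (S := R) (R := S) (f := g) (g := f) hu₀ hu₀t
      (fun {f g} h1 h2 h3 h4 h5 h6 => by
        have := IH h2 h1 h4 h3 h6 h5
        rw [mul_right_comm] at this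
        simp_rw [mul_comm (f _)]
        exact this)
      hg hf hag haf hag' hgt hft (by
        refine hintg.congr (Filter.Eventually.of_forall fun z => ?_)
        exact congrArg _ (mul_comm _ _))
    simp_rw [mul_comm (g _ _)] at this
    exact this.trans (le_of_eq (mul_right_comm _ _ _))
  · exact mode_bound_step (S := S) (R := R) (f := f) (g := g) hu₀ hu₀t IH
      hf hg haf hag haf' hft hgt hintg

/-- Product kernels: each species contributes the norm of its mode. -/
theorem mode_bound {n : ℕ} (l : Fin n → ℕ) (S R : Fin n → Bool) (hSR : ∀ i, R i = !S i)
    {u : Fin n → Particle → ℂ} (hu : ∀ i, Measurable (u i))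
    (hut : ∀ i, sqInt particleMeasure (u i) < ⊤)
    {f : Config (addOcc S l) → ℂ} {g : Config (addOcc R l) → ℂ} (hf : Measurable f)
    (hg : Measurable g) (haf : IsAntisymmConfig f) (hag : IsAntisymmConfig g)
    (hft : sqInt (configMeasure (addOcc S l)) f < ⊤)
    (hgt : sqInt (configMeasure (addOcc R l)) g < ⊤) :
    (∏ i, (l i + 1 : ℝ≥0∞)) * ‖∫ z : (Fin n → Particle) × Config l,
        (∏ i, u i (z.1 i)) * (f (insertFor S z.1 z.2) * g (insertFor R z.1 z.2))
        ∂((kernelMeasure n).prod (configMeasure l))‖ₑ ^ 2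
      ≤ (∏ i, sqInt particleMeasure (u i)) * sqInt (configMeasure (addOcc S l)) f
        * sqInt (configMeasure (addOcc R l)) g := by
  induction n with
  | zero =>
    have h := config_bound_one l S R hSR (G := fun ξ => ∏ i, u i (ξ i)) (by fun_prop) hf hg haf hag
    have hk : sqInt (kernelMeasure 0) (fun ξ : Fin 0 → Particle => ∏ i, u i (ξ i)) = 1 := by
      simp [sqInt, kernelMeasure]
    rw [hk] at h
    simp only [Finset.univ_eq_empty, Finset.prod_empty, one_mul] at h ⊢
    exact le_trans (by gcongr; exact enorm_integral_le_lintegral_enorm _) h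
  | succ n ih =>
    have mj := measurePreserving_joinSpecies l 0
    have hintg := mj.integrable_comp_of_integrable (integrable_interaction l S R hSR
      (G := fun ξ => ∏ i, u i (ξ i)) (by fun_prop) hf hg haf hag (sqInt_prod_lt_top hu hut) hft hgt)
    rw [integral_joinSpecies l 0]
    have hfun : ∀ z : (Particle × (Fin (l 0) → Particle)) × (Fin n → Particle) ×
        Config (fun j => l (Fin.succAbove 0 j)), (∏ i, u i ((joinSpecies (l := l) 0 z).1 i)) *
        (f (insertFor S (joinSpecies 0 z).1 (joinSpecies 0 z).2)
          * g (insertFor R (joinSpecies 0 z).1 (joinSpecies 0 z).2))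
        = (u 0 z.1.1 * ∏ j, u (Fin.succAbove 0 j) (z.2.1 j)) *
        (f (insertSpecies (l := addOcc S l) 0 (addIf (S 0) z.1.1 z.1.2)
            (insertFor (fun j => S (Fin.succAbove 0 j)) z.2.1 z.2.2))
          * g (insertSpecies (l := addOcc R l) 0 (addIf (R 0) z.1.1 z.1.2)
            (insertFor (fun j => R (Fin.succAbove 0 j)) z.2.1 z.2.2))) := by
      intro z
      rw [insertFor_joinSpecies, insertFor_joinSpecies, Fin.prod_univ_succAbove _ 0]
      simp only [joinSpecies, Fin.insertNth_apply_same, Fin.insertNth_apply_succAbove]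
    simp_rw [Function.comp_def, hfun] at hintg
    simp_rw [hfun]
    have mf := hf.comp (measurable_insertSpecies (addOcc S l) 0)
    have mg := hg.comp (measurable_insertSpecies (addOcc R l) 0)
    have af := fun x => IsAntisymmConfig.others (l := addOcc S l) haf 0 x
    have ag := fun x => IsAntisymmConfig.others (l := addOcc R l) hag 0 x
    have af' := fun Y => IsAntisymmConfig.species (l := addOcc S l) haf 0 Y
    have ag' := fun Y => IsAntisymmConfig.species (l := addOcc R l) hag 0 Y
    have eF := lintegral_insertSpecies (addOcc S l) 0 (hf.enorm.pow_const 2)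
    have eG := lintegral_insertSpecies (addOcc R l) 0 (hg.enorm.pow_const 2)
    unfold sqInt at hft hgt
    rw [eF] at hft
    rw [eG] at hgt
    rw [Fin.prod_univ_succAbove _ 0, Fin.prod_univ_succAbove _ 0,
      show sqInt (configMeasure (addOcc S l)) f = _ from eF,
      show sqInt (configMeasure (addOcc R l)) g = _ from eG]
    exact mode_bound_step_addIf (N := l 0) (hSR 0)
      (f := fun x Y => f (insertSpecies (l := addOcc S l) 0 x Y))
      (g := fun x Y => g (insertSpecies (l := addOcc R l) 0 x Y)) (hu 0) (hut 0)
      (fun {f g} h1 h2 h3 h4 h5 h6 => ih (fun j => l (Fin.succAbove 0 j)) _ _ (fun j => hSR _)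
        (u := fun j => u (Fin.succAbove 0 j)) (fun j => hu _) (fun j => hut _) h1 h2 h3 h4 h5 h6)
      mf mg af ag af' ag' hft hgt hintg

/-! ### Hermite functions -/

open Polynomial in
/-- The polynomial factor of the normalized Hermite function of index `a`. -/
noncomputable def hermPoly : ℕ → ℝ[X]
  | 0 => C (Real.pi ^ (-(1 / 4) : ℝ))
  | a + 1 => C (√(2 * (a + 1)))⁻¹ * (2 * X * hermPoly a - derivative (hermPoly a))

/-- `q(x) exp(-x²/2)`. -/
noncomputable def gaussPoly (q : Polynomial ℝ) (x : ℝ) : ℝ := q.eval x * Real.exp (-(x ^ 2) / 2)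

/-- The eigenvalue `2 * a + 1` of the harmonic oscillator. -/
noncomputable def oscEig (a : ℕ) : ℝ := 2 * a + 1

theorem one_le_oscEig (a : ℕ) : 1 ≤ oscEig a := by
  unfold oscEig; have : (0 : ℝ) ≤ a := a.cast_nonneg; linarith

theorem oscEig_pos (a : ℕ) : 0 < oscEig a := one_pos.trans_le (one_le_oscEig a)

/-- The normalized Hermite function of index `a`. -/
noncomputable def hermFun (a : ℕ) : ℝ → ℝ := gaussPoly (hermPoly a)

section Poly
open Polynomial

/-- The commutator of d/dX with the raising operator 2X - d/dX is 2, so the lowering relation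
propagates along the recursion that defines `hermPoly`. -/
theorem derivative_hermPoly_succ (a : ℕ) :
    derivative (hermPoly (a + 1)) = C (√(2 * (a + 1))) * hermPoly a := by
  have hc : ∀ b : ℕ, (0 : ℝ) < √(2 * ((b : ℝ) + 1)) := fun b => Real.sqrt_pos.2 (by positivity)
  have hsq : ∀ b : ℕ, √(2 * ((b : ℝ) + 1)) * √(2 * ((b : ℝ) + 1)) = 2 * (b + 1) := fun b =>
    Real.mul_self_sqrt (by positivity)
  have hinv : ∀ b : ℕ, (√(2 * ((b : ℝ) + 1)))⁻¹ * (2 * (b + 1)) = √(2 * ((b : ℝ) + 1)) := fun b => by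
    rw [inv_mul_eq_iff_eq_mul₀ (hc b).ne', hsq]
  have key : ∀ (a : ℕ), 2 * derivative (X * hermPoly a) - derivative (derivative
      (hermPoly a)) = C (2 * ((a : ℝ) + 1)) * hermPoly a →
      derivative (hermPoly (a + 1)) = C (√(2 * (a + 1))) * hermPoly a := by
    intro a h
    rw [hermPoly, derivative_C_mul, derivative_sub, mul_assoc,
      show (2 : ℝ[X]) = C 2 from rfl, derivative_C_mul, show (C 2 : ℝ[X]) = 2 from rfl, h,
      ← mul_assoc, ← C_mul, hinv]
  induction a with
  | zero =>
    refine key 0 ?_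
    simp only [hermPoly, derivative_mul, derivative_X, derivative_C, map_zero, Nat.cast_zero,
      zero_add, mul_one, mul_zero, add_zero, one_mul, sub_zero]
    rfl
  | succ a ih =>
    refine key (a + 1) ?_
    have h2 : 2 * X * hermPoly a - derivative (hermPoly a)
        = C (√(2 * (a + 1))) * hermPoly (a + 1) := by
      rw [hermPoly, ← mul_assoc, ← C_mul, mul_inv_cancel₀ (hc a).ne', C_1, one_mul]
    rw [derivative_mul, derivative_X, ih, derivative_C_mul]
    have : 2 * (1 * hermPoly (a + 1) + X * (C (√(2 * (a + 1))) * hermPoly a)) -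
        C (√(2 * (a + 1))) * derivative (hermPoly a)
        = 2 * hermPoly (a + 1) + C (√(2 * (a + 1))) *
          (2 * X * hermPoly a - derivative (hermPoly a)) := by ring
    rw [this, h2, ← mul_assoc, ← C_mul, hsq, show (2 : ℝ[X]) = C 2 from rfl, ← add_mul, ← C_add]
    congr 2
    push_cast; ring

theorem X_mul_hermPoly (a : ℕ) : 2 * X * hermPoly a
    = C (√(2 * (a + 1))) * hermPoly (a + 1) + derivative (hermPoly a) := by
  have hc : (0 : ℝ) < √(2 * ((a : ℝ) + 1)) := Real.sqrt_pos.2 (by positivity)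
  rw [hermPoly, ← mul_assoc, ← C_mul, mul_inv_cancel₀ hc.ne', C_1, one_mul]
  ring

theorem hermPoly_ode (a : ℕ) :
    derivative (derivative (hermPoly a)) = 2 * X * derivative (hermPoly a) - C (2 * (a : ℝ)) * hermPoly a := by
  have h := congrArg derivative (X_mul_hermPoly a)
  rw [derivative_add, derivative_C_mul, derivative_hermPoly_succ, ← mul_assoc, ← C_mul,
    Real.mul_self_sqrt (by positivity), derivative_mul, derivative_mul, derivative_X] at h
  simp only [derivative_ofNat, zero_mul, mul_one, zero_add] at h
  have e : (C (2 * ((a : ℝ) + 1)) : ℝ[X]) = C (2 * (a : ℝ)) + 2 := by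
    rw [mul_add, C_add]; simp [C_ofNat]
  rw [e] at h
  linear_combination -h

theorem hasDerivAt_gaussPoly (q : ℝ[X]) (x : ℝ) :
    HasDerivAt (gaussPoly q) (gaussPoly (derivative q - X * q) x) x := by
  have h1 := q.hasDerivAt x
  have h2 : HasDerivAt (fun x : ℝ => Real.exp (-(x ^ 2) / 2))
      (Real.exp (-(x ^ 2) / 2) * (-(2 * x) / 2)) x := by
    have := ((hasDerivAt_pow 2 x).neg.div_const 2).exp
    simpa using this
  have := h1.mul h2
  refine HasDerivAt.congr_deriv (f := gaussPoly q) this ?_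
  simp only [gaussPoly, eval_sub, eval_mul, eval_X]
  ring

theorem gaussPoly_mul (q r : ℝ[X]) (x : ℝ) :
    gaussPoly q x * gaussPoly r x = (q * r).eval x * Real.exp (-(x ^ 2)) := by
  have : Real.exp (-(x ^ 2)) = Real.exp (-(x ^ 2) / 2) * Real.exp (-(x ^ 2) / 2) := by
    rw [← Real.exp_add]; ring_nf
  rw [this]
  simp [gaussPoly]
  ring

theorem continuous_gaussPoly (q : ℝ[X]) : Continuous (gaussPoly q) := by
  unfold gaussPoly; fun_prop

theorem integrable_eval_mul_exp (q : ℝ[X]) {b : ℝ} (hb : 0 < b) :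
    Integrable fun x : ℝ => q.eval x * Real.exp (-b * x ^ 2) := by
  induction q using Polynomial.induction_on' with
  | add p q hp hq =>
    simp only [eval_add, add_mul]
    exact hp.add hq
  | monomial n c =>
    have := (integrable_rpow_mul_exp_neg_mul_sq hb (s := n)
      (by have : (0 : ℝ) ≤ n := n.cast_nonneg; linarith)).const_mul c
    refine this.congr (Filter.Eventually.of_forall fun x => ?_)
    simp [mul_assoc]

theorem integrable_gaussPoly_mul (q r : ℝ[X]) :
    Integrable fun x => gaussPoly q x * gaussPoly r x := by
  simp_rw [gaussPoly_mul]
  simpa using integrable_eval_mul_exp (q * r) one_pos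

theorem integral_gaussPoly_by_parts (q r : ℝ[X]) :
    ∫ x, gaussPoly (derivative q - X * q) x * gaussPoly r x
      = - ∫ x, gaussPoly q x * gaussPoly (derivative r - X * r) x := by
  have h := integral_eq_zero_of_hasDerivAt_of_integrable
    (f := fun x => gaussPoly q x * gaussPoly r x)
    (fun x => (hasDerivAt_gaussPoly q x).mul (hasDerivAt_gaussPoly r x))
    ((integrable_gaussPoly_mul _ _).add (integrable_gaussPoly_mul _ _)) (integrable_gaussPoly_mul _ _)
  rw [integral_add (integrable_gaussPoly_mul _ _) (integrable_gaussPoly_mul _ _)] at h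
  linarith

/-- For the weight exp(-x²), the raising operator 2X - d/dX is adjoint to d/dX. Orthonormality
follows by lowering both indices together. -/
theorem integral_hermPoly_succ_mul (a : ℕ) (r : ℝ[X]) :
    √(2 * ((a : ℝ) + 1)) * ∫ x, gaussPoly (hermPoly (a + 1)) x * gaussPoly r x
      = ∫ x, gaussPoly (hermPoly a) x * gaussPoly (derivative r) x := by
  have h1 : ∀ x, √(2 * ((a : ℝ) + 1)) * (gaussPoly (hermPoly (a + 1)) x * gaussPoly r x)
      = -(gaussPoly (derivative (hermPoly a) - X * hermPoly a) x * gaussPoly r x)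
        + gaussPoly (hermPoly a) x * gaussPoly (X * r) x := by
    intro x
    have := congrArg (fun q => eval x q) (X_mul_hermPoly a)
    simp only [eval_mul, eval_add, eval_C, eval_X, eval_ofNat] at this
    simp only [gaussPoly, eval_sub, eval_mul, eval_X]
    linear_combination (-(eval x r * Real.exp (-(x ^ 2) / 2) * Real.exp (-(x ^ 2) / 2))) * this
  have h2 : ∀ x, gaussPoly (hermPoly a) x * gaussPoly (derivative r) x
      = gaussPoly (hermPoly a) x * gaussPoly (derivative r - X * r) x
        + gaussPoly (hermPoly a) x * gaussPoly (X * r) x := by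
    intro x
    simp only [gaussPoly, eval_sub, eval_mul, eval_X]
    ring
  rw [← integral_const_mul]
  simp_rw [h1, h2]
  rw [integral_add (by exact (integrable_gaussPoly_mul _ _).neg) (integrable_gaussPoly_mul _ _),
    integral_add (integrable_gaussPoly_mul _ _) (integrable_gaussPoly_mul _ _), integral_neg,
    integral_gaussPoly_by_parts, neg_neg]

theorem integral_hermFun_mul (a b : ℕ) :
    ∫ x, hermFun a x * hermFun b x = if a = b then 1 else 0 := by
  have h0 : ∀ b : ℕ, ∫ x, hermFun (b + 1) x * hermFun 0 x = 0 := by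
    intro b
    have h := integral_hermPoly_succ_mul b (hermPoly 0)
    have hd : derivative (hermPoly 0) = 0 := by simp [hermPoly]
    rw [hd] at h
    simp only [gaussPoly, eval_zero, zero_mul, mul_zero, integral_zero] at h
    exact (mul_eq_zero.1 h).resolve_left (Real.sqrt_pos.2 (by positivity)).ne'
  induction a generalizing b with
  | zero =>
    cases b with
    | zero =>
      simp only [hermFun, gaussPoly_mul, if_true]
      simp only [hermPoly, ← C_mul, eval_C]
      rw [integral_const_mul]
      have := integral_gaussian 1
      simp only [neg_mul, one_mul, div_one] at this
      rw [this, ← Real.rpow_add Real.pi_pos, Real.sqrt_eq_rpow, ← Real.rpow_add Real.pi_pos]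
      norm_num
    | succ b =>
      simp_rw [mul_comm (hermFun 0 _)]
      simp [h0]
  | succ a ih =>
    cases b with
    | zero => simp [h0]
    | succ b =>
      have h := integral_hermPoly_succ_mul a (hermPoly (b + 1))
      rw [derivative_hermPoly_succ] at h
      have e : ∀ x, gaussPoly (hermPoly a) x * gaussPoly (C (√(2 * (b + 1))) * hermPoly b) x
          = √(2 * ((b : ℝ) + 1)) * (hermFun a x * hermFun b x) := by
        intro x; simp [gaussPoly, hermFun]; ring
      simp_rw [e] at h
      rw [integral_const_mul, ih] at h
      have hp := (Real.sqrt_pos.2 (by positivity : (0 : ℝ) < 2 * ((a : ℝ) + 1))).ne'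
      change √(2 * ((a : ℝ) + 1)) * ∫ x, hermFun (a + 1) x * hermFun (b + 1) x = _ at h
      by_cases hab : a = b
      · subst hab
        simp only [if_true, mul_one] at h ⊢
        exact mul_left_cancel₀ hp (by rw [h, mul_one])
      · simp only [hab, if_false, mul_zero] at h
        simp only [Nat.add_right_cancel_iff, hab, if_false]
        exact (mul_eq_zero.1 h).resolve_left hp

/-- The factor exp(-x²/2) conjugates d/dx into q ↦ q' - Xq; this is the eigenvalue equation h'' =
(x² - (2a+1)) h on polynomial factors. -/
theorem hermPoly_second (a : ℕ) :
    derivative (derivative (hermPoly a) - X * hermPoly a)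
      - X * (derivative (hermPoly a) - X * hermPoly a)
      = X ^ 2 * hermPoly a - C (oscEig a) * hermPoly a := by
  rw [derivative_sub, derivative_mul, derivative_X, hermPoly_ode]
  have e : (C (oscEig a) : ℝ[X]) = C (2 * (a : ℝ)) + 1 := by simp [oscEig]
  rw [e]
  ring

/-- The derivative of the Hermite function. -/
noncomputable def hermFun' (a : ℕ) : ℝ → ℝ :=
  gaussPoly (derivative (hermPoly a) - X * hermPoly a)

theorem hasDerivAt_hermFun (a : ℕ) (x : ℝ) : HasDerivAt (hermFun a) (hermFun' a x) x :=
  hasDerivAt_gaussPoly _ x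

theorem hasDerivAt_hermFun' (a : ℕ) (x : ℝ) :
    HasDerivAt (hermFun' a) (x ^ 2 * hermFun a x - oscEig a * hermFun a x) x := by
  have := hasDerivAt_gaussPoly (derivative (hermPoly a) - X * hermPoly a) x
  rw [hermPoly_second] at this
  refine HasDerivAt.congr_deriv (f := hermFun' a) this ?_
  simp only [hermFun, gaussPoly, eval_sub, eval_mul, eval_X, eval_pow, eval_C]
  ring

/-! ### Pointwise bounds -/

/-- Agmon's inequality: the square is the integral of twice function times derivative from -∞ to x,
to which Cauchy–Schwarz applies. -/
theorem gaussPoly_sq_le (q : ℝ[X]) (x : ℝ) :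
    gaussPoly q x ^ 2 ≤ 2 * (√(∫ y, gaussPoly q y ^ 2)
      * √(∫ y, gaussPoly (derivative q - X * q) y ^ 2)) := by
  set q' := derivative q - X * q
  have hd : ∀ y, HasDerivAt (fun y => gaussPoly q y * gaussPoly q y)
      (gaussPoly q' y * gaussPoly q y + gaussPoly q y * gaussPoly q' y) y :=
    fun y => (hasDerivAt_gaussPoly q y).mul (hasDerivAt_gaussPoly q y)
  have hi' := (integrable_gaussPoly_mul q' q).add (integrable_gaussPoly_mul q q')
  have ht := tendsto_zero_of_hasDerivAt_of_integrableOn_Iic (a := 0) (fun y _ => hd y)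
    hi'.integrableOn (integrable_gaussPoly_mul q q).integrableOn
  have hx := integral_Iic_of_hasDerivAt_of_tendsto' (a := x) (fun y _ => hd y) hi'.integrableOn ht
  have hm : ∀ r : ℝ[X], MemLp (gaussPoly r) 2 := fun r => by
    rw [memLp_two_iff_integrable_sq (continuous_gaussPoly r).aestronglyMeasurable]
    simp_rw [pow_two]; exact integrable_gaussPoly_mul r r
  have hcs : ∫ y, ‖gaussPoly q y‖ * ‖gaussPoly q' y‖
      ≤ √(∫ y, gaussPoly q y ^ 2) * √(∫ y, gaussPoly q' y ^ 2) := by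
    have := integral_mul_norm_le_Lp_mul_Lq (μ := volume) (p := 2) (q := 2)
      ⟨by norm_num, by norm_num, by norm_num⟩ (f := gaussPoly q) (g := gaussPoly q')
      (by simpa using hm q) (by simpa using hm q')
    simpa [Real.sqrt_eq_rpow] using this
  calc gaussPoly q x ^ 2 = ∫ y in Set.Iic x,
        (gaussPoly q' y * gaussPoly q y + gaussPoly q y * gaussPoly q' y) := by
        rw [hx]; ring
    _ ≤ ∫ y in Set.Iic x, 2 * (‖gaussPoly q y‖ * ‖gaussPoly q' y‖) := by
        refine integral_mono hi'.integrableOn ?_ fun y => ?_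
        · exact (((integrable_gaussPoly_mul q q').norm.const_mul 2).congr
            (Filter.Eventually.of_forall fun y => by simp)).integrableOn
        · simp only
          have := le_abs_self (gaussPoly q y * gaussPoly q' y)
          rw [abs_mul] at this
          simp only [Real.norm_eq_abs]
          linarith
    _ ≤ ∫ y, 2 * (‖gaussPoly q y‖ * ‖gaussPoly q' y‖) := by
        refine setIntegral_le_integral ?_ (Filter.Eventually.of_forall fun y => by positivity)
        exact ((integrable_gaussPoly_mul q q').norm.const_mul 2).congr
            (Filter.Eventually.of_forall fun y => by simp)
    _ ≤ _ := by
        rw [integral_const_mul]; linarith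

theorem gaussPoly_sum (s : Finset ℕ) (c : ℕ → ℝ) (x : ℝ) :
    gaussPoly (∑ a ∈ s, C (c a) * hermPoly a) x = ∑ a ∈ s, c a * hermFun a x := by
  simp [gaussPoly, hermFun, eval_finsetSum, Finset.sum_mul, mul_assoc]

theorem integral_sum_hermFun_mul_sum (s : Finset ℕ) (c d : ℕ → ℝ) :
    ∫ x, (∑ a ∈ s, c a * hermFun a x) * (∑ a ∈ s, d a * hermFun a x) = ∑ a ∈ s, c a * d a := by
  simp_rw [Finset.sum_mul_sum]
  have hi : ∀ a b, Integrable fun x => c a * hermFun a x * (d b * hermFun b x) := fun a b => by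
    refine ((integrable_gaussPoly_mul (hermPoly a) (hermPoly b)).const_mul (c a * d b)).congr
      (Filter.Eventually.of_forall fun x => ?_)
    simp only [hermFun]; ring
  rw [integral_finsetSum _ fun a _ => integrable_finsetSum _ fun b _ => hi a b]
  refine Finset.sum_congr rfl fun a ha => ?_
  rw [integral_finsetSum _ fun b _ => hi a b]
  have e : ∀ b, ∫ x, c a * hermFun a x * (d b * hermFun b x) = if a = b then c a * d b else 0 := by
    intro b
    have : ∀ x, c a * hermFun a x * (d b * hermFun b x) = (c a * d b) * (hermFun a x * hermFun b x) :=
      fun x => by ring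
    simp_rw [this]
    rw [integral_const_mul, integral_hermFun_mul]
    simp
  simp [e, ha]

theorem gaussPoly_X_mul (q : ℝ[X]) (x : ℝ) : gaussPoly (X * q) x = x * gaussPoly q x := by
  simp only [gaussPoly, eval_mul, eval_X]; ring

/-- By parts, ‖f'‖² = ⟨f, hf⟩ - ‖xf‖² for the combination f, and the last term is dropped. -/
theorem integral_deriv_sq_le (s : Finset ℕ) (c : ℕ → ℝ) :
    let q : ℝ[X] := ∑ a ∈ s, C (c a) * hermPoly a
    ∫ x, gaussPoly (derivative q - X * q) x ^ 2 ≤ ∑ a ∈ s, oscEig a * c a ^ 2 := by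
  intro q
  set q' := derivative q - X * q with hq'
  have h1 := integral_gaussPoly_by_parts q q'
  have hq'' : derivative q' - X * q' = X ^ 2 * q - ∑ a ∈ s, C (oscEig a * c a) * hermPoly a := by
    have : ∀ a ∈ s, C (c a) * (derivative (derivative (hermPoly a) - X * hermPoly a)
      - X * (derivative (hermPoly a) - X * hermPoly a))
      = C (c a) * (X ^ 2 * hermPoly a - C (oscEig a) * hermPoly a) := fun a _ => by
        rw [hermPoly_second]
    have h2 := Finset.sum_congr rfl this
    have e1 : derivative q' - X * q' = ∑ a ∈ s, C (c a) * (derivative (derivative (hermPoly a)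
        - X * hermPoly a) - X * (derivative (hermPoly a) - X * hermPoly a)) := by
      simp only [hq', q, derivative_sum, Finset.mul_sum, ← Finset.sum_sub_distrib, derivative_C_mul]
      refine Finset.sum_congr rfl fun a _ => ?_
      simp only [derivative_sub, derivative_mul, derivative_C, derivative_X]
      ring
    rw [e1, h2]
    simp only [q, Finset.mul_sum, ← Finset.sum_sub_distrib]
    refine Finset.sum_congr rfl fun a _ => ?_
    rw [C_mul]; ring
  have e2 : ∀ x, gaussPoly q x * gaussPoly (derivative q' - X * q') x
      = (x * gaussPoly q x) ^ 2 - (∑ a ∈ s, c a * hermFun a x)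
        * (∑ a ∈ s, (oscEig a * c a) * hermFun a x) := by
    intro x
    rw [hq'', ← gaussPoly_sum, ← gaussPoly_sum]
    simp only [gaussPoly, eval_sub, eval_mul, eval_pow, eval_X, q]
    ring
  have i1 : Integrable fun x => (x * gaussPoly q x) ^ 2 := by
    refine (integrable_gaussPoly_mul (X * q) (X * q)).congr
      (Filter.Eventually.of_forall fun x => ?_)
    change gaussPoly (X * q) x * gaussPoly (X * q) x = (x * gaussPoly q x) ^ 2
    rw [gaussPoly_X_mul, pow_two]
  have i2 : Integrable fun x => (∑ a ∈ s, c a * hermFun a x)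
        * (∑ a ∈ s, (oscEig a * c a) * hermFun a x) := by
    simp_rw [← gaussPoly_sum]; exact integrable_gaussPoly_mul _ _
  simp_rw [e2] at h1
  rw [integral_sub i1 i2, integral_sum_hermFun_mul_sum] at h1
  change ∫ x, gaussPoly q' x * gaussPoly q' x = _ at h1
  simp_rw [← pow_two (gaussPoly q' _)] at h1
  rw [h1]
  have : 0 ≤ ∫ x, (x * gaussPoly q x) ^ 2 := integral_nonneg fun x => by positivity
  have e3 : ∑ a ∈ s, c a * (oscEig a * c a) = ∑ a ∈ s, oscEig a * c a ^ 2 :=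
    Finset.sum_congr rfl fun a _ => by ring
  linarith

/-- Test Agmon's inequality on the reproducing kernel y ↦ ∑ hₐ(x)hₐ(y). Its value at x and its
squared norm are both S, the sum to be bounded, and its derivative has squared norm at most 2N·S.
Hence S² ≤ 2√(2N) S. -/
theorem sum_hermFun_sq_le (N : ℕ) (x : ℝ) :
    ∑ a ∈ Finset.range N, hermFun a x ^ 2 ≤ 2 * √(2 * N) := by
  set s := Finset.range N
  set S := ∑ a ∈ s, hermFun a x ^ 2 with hS
  have hS0 : 0 ≤ S := Finset.sum_nonneg fun a _ => by positivity
  set c : ℕ → ℝ := fun a => hermFun a x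
  have h1 := gaussPoly_sq_le (∑ a ∈ s, C (c a) * hermPoly a) x
  have h2 := integral_deriv_sq_le s c
  simp only at h2
  have h3 : ∫ y, gaussPoly (∑ a ∈ s, C (c a) * hermPoly a) y ^ 2 = S := by
    simp_rw [gaussPoly_sum, pow_two]
    rw [integral_sum_hermFun_mul_sum]
    simp [hS, c, pow_two]
  have h4 : gaussPoly (∑ a ∈ s, C (c a) * hermPoly a) x = S := by
    rw [gaussPoly_sum]; simp [hS, c, pow_two]
  have h5 : ∑ a ∈ s, oscEig a * c a ^ 2 ≤ (2 * N) * S := by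
    rw [hS, Finset.mul_sum]
    refine Finset.sum_le_sum fun a ha => ?_
    have : (a : ℝ) + 1 ≤ N := by exact_mod_cast Finset.mem_range.1 ha
    have : oscEig a ≤ 2 * N := by unfold oscEig; linarith
    exact mul_le_mul_of_nonneg_right this (by positivity)
  rw [h3, h4] at h1
  have h6 : S ^ 2 ≤ 2 * √(2 * N) * S := by
    refine h1.trans ?_
    have := Real.sqrt_le_sqrt (h2.trans h5)
    rw [Real.sqrt_mul (by positivity)] at this
    calc _ ≤ 2 * (√S * (√(2 * N) * √S)) := by gcongr
      _ = 2 * √(2 * N) * (√S * √S) := by ring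
      _ = _ := by rw [Real.mul_self_sqrt hS0]
  rcases hS0.eq_or_lt with h | h
  · rw [← h]; positivity
  · nlinarith

/-- Summation by parts: a decreasing nonnegative weight preserves an inequality between partial
sums. The induction keeps the boundary term d N (t N - s N). -/
theorem sum_mul_sub_le_of_antitone {d s t : ℕ → ℝ} (hd : Antitone d) (hd0 : ∀ a, 0 ≤ d a)
    (h0 : s 0 = t 0) (hst : ∀ a, s a ≤ t a) (N : ℕ) :
    ∑ a ∈ Finset.range N, d a * (s (a + 1) - s a)
      ≤ ∑ a ∈ Finset.range N, d a * (t (a + 1) - t a) := by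
  have : ∀ N, d N * (t N - s N) ≤ ∑ a ∈ Finset.range N, d a * (t (a + 1) - t a)
      - ∑ a ∈ Finset.range N, d a * (s (a + 1) - s a) := by
    intro N
    induction N with
    | zero => simp [h0]
    | succ N ih =>
      rw [Finset.sum_range_succ, Finset.sum_range_succ]
      have h1 := hd (Nat.le_succ N)
      have h2 : d (N + 1) * (t (N + 1) - s (N + 1)) ≤ d N * (t (N + 1) - s (N + 1)) :=
        mul_le_mul_of_nonneg_right h1 (sub_nonneg.2 (hst _))
      nlinarith
  have h1 := this N
  have h2 := mul_nonneg (hd0 N) (sub_nonneg.2 (hst N))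
  linarith

theorem sum_weighted_hermFun_sq_le (N : ℕ) (x : ℝ) :
    ∑ a ∈ Finset.range N, oscEig a ^ (-(1 / 4) : ℝ) * hermFun a x ^ 2
      ≤ 8 * (N : ℝ) ^ (1 / 4 : ℝ) := by
  have hd : Antitone fun a : ℕ => oscEig a ^ (-(1 / 4) : ℝ) := by
    intro a b hab
    refine Real.rpow_le_rpow_of_nonpos (oscEig_pos a) ?_ (by norm_num)
    unfold oscEig
    have : (a : ℝ) ≤ b := by exact_mod_cast hab
    linarith
  have h := sum_mul_sub_le_of_antitone hd (fun a => Real.rpow_nonneg (oscEig_pos a).le _)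
    (s := fun N => ∑ a ∈ Finset.range N, hermFun a x ^ 2) (t := fun N => 2 * √(2 * N))
    (by simp) (fun N => sum_hermFun_sq_le N x) N
  simp only [Finset.sum_range_succ, add_sub_cancel_left] at h
  refine h.trans ?_
  -- With p and r the fourth roots of a+1 and a, the difference of square roots is p² - r² = (p -
  -- r)(p + r), the weight is at most p⁻¹, and (p + r)p⁻¹ ≤ 2; the bound 8(p - r) then telescopes.
  have hstep : ∀ a : ℕ, oscEig a ^ (-(1 / 4) : ℝ) * (2 * √(2 * ((a + 1 : ℕ) : ℝ)) - 2 * √(2 * (a : ℝ)))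
      ≤ 8 * ((a + 1 : ℕ) : ℝ) ^ (1 / 4 : ℝ) - 8 * (a : ℝ) ^ (1 / 4 : ℝ) := by
    intro a
    set p : ℝ := ((a + 1 : ℕ) : ℝ) ^ (1 / 4 : ℝ) with hp
    set r : ℝ := (a : ℝ) ^ (1 / 4 : ℝ) with hr
    have ha0 : (0 : ℝ) ≤ a := a.cast_nonneg
    have ha1 : (0 : ℝ) < ((a + 1 : ℕ) : ℝ) := by positivity
    have hp2 : √(((a + 1 : ℕ) : ℝ)) = p * p := by
      rw [hp, ← Real.rpow_add ha1, Real.sqrt_eq_rpow]; norm_num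
    have hr2 : √(a : ℝ) = r * r := by
      rw [hr, ← Real.mul_rpow ha0 ha0, Real.sqrt_eq_rpow, ← pow_two, ← Real.rpow_natCast,
        ← Real.rpow_mul ha0]; norm_num
    have hr0 : 0 ≤ r := by positivity
    have hpr : r ≤ p := Real.rpow_le_rpow ha0 (by push_cast; linarith) (by norm_num)
    have hp0 : 0 < p := by positivity
    have hd1 : oscEig a ^ (-(1 / 4) : ℝ) ≤ p⁻¹ := by
      rw [Real.rpow_neg (oscEig_pos a).le]
      gcongr
      rw [hp]
      refine Real.rpow_le_rpow ha1.le ?_ (by norm_num)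
      unfold oscEig; push_cast; linarith
    rw [Real.sqrt_mul (by norm_num), Real.sqrt_mul (by norm_num), hp2, hr2]
    have h2 : √2 ≤ 2 := by rw [Real.sqrt_le_left (by norm_num)]; norm_num
    calc _ ≤ p⁻¹ * (2 * (√2 * (p * p)) - 2 * (√2 * (r * r))) := by
          refine mul_le_mul_of_nonneg_right hd1 ?_
          have : r * r ≤ p * p := mul_self_le_mul_self hr0 hpr
          have := mul_le_mul_of_nonneg_left this (Real.sqrt_nonneg 2)
          linarith
      _ = √2 * (2 * (p - r) * ((p + r) * p⁻¹)) := by ring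
      _ ≤ 2 * (2 * (p - r) * 2) := by
          have h3 : (p + r) * p⁻¹ ≤ 2 := by
            rw [← div_eq_mul_inv, div_le_iff₀ hp0]; linarith
          have h4 : 0 ≤ 2 * (p - r) := by linarith
          have h5 : 0 ≤ (p + r) * p⁻¹ := by positivity
          gcongr
      _ = _ := by ring
  refine (Finset.sum_le_sum fun a _ => hstep a).trans ?_
  rw [Finset.sum_range_sub (fun a : ℕ => 8 * (a : ℝ) ^ (1 / 4 : ℝ))]
  simp

end Poly

/-! ### Complete orthonormal systems of real functions -/

/-- A complete orthonormal system of real functions in `L²(μ)`. -/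
structure IsModeSystem {X ι : Type*} [MeasurableSpace X] (μ : Measure X) (u : ι → X → ℝ) : Prop where
  measurable : ∀ a, Measurable (u a)
  memLp : ∀ a, MemLp (u a) 2 μ
  integral_mul_self : ∀ a, ∫ x, u a x * u a x ∂μ = 1
  integral_mul : ∀ a b, a ≠ b → ∫ x, u a x * u b x ∂μ = 0
  complete : ∀ G : X → ℂ, MemLp G 2 μ → (∀ a, ∫ x, (u a x : ℂ) * G x ∂μ = 0) → G =ᵐ[μ] 0

/-- The form `∫ w |f|²` is bounded, on finite combinations `f` of the `u a`, by the diagonal form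
with coefficients `r a`. -/
def WeightedBound {X ι : Type*} [MeasurableSpace X] (μ : Measure X) (u : ι → X → ℝ)
    (w : X → ℝ≥0∞) (r : ι → ℝ≥0∞) : Prop :=
  ∀ (s : Finset ι) (c : ι → ℂ),
    ∫⁻ x, w x * ‖∑ a ∈ s, c a * (u a x : ℂ)‖ₑ ^ 2 ∂μ ≤ ∑ a ∈ s, r a * ‖c a‖ₑ ^ 2

section Modes

variable {X Y ι κ : Type*} [MeasurableSpace X] [MeasurableSpace Y] {μ : Measure X} {ν : Measure Y}
  {u : ι → X → ℝ} {v : κ → Y → ℝ}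

theorem IsModeSystem.integrable_mul (hu : IsModeSystem μ u) (a b : ι) :
    Integrable (fun x => u a x * u b x) μ :=
  (hu.memLp a).integrable_mul (hu.memLp b)

theorem IsModeSystem.lintegral_sum (hu : IsModeSystem μ u) (s : Finset ι) (c : ι → ℂ) :
    ∫⁻ x, ‖∑ a ∈ s, c a * (u a x : ℂ)‖ₑ ^ 2 ∂μ = ∑ a ∈ s, ‖c a‖ₑ ^ 2 := by
  classical
  have hexp : ∀ x, ((‖∑ a ∈ s, c a * (u a x : ℂ)‖ ^ 2 : ℝ) : ℂ)
      = ∑ a ∈ s, ∑ b ∈ s, (conj (c a) * c b) * ((u a x * u b x : ℝ) : ℂ) := by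
    intro x
    have := Complex.conj_mul' (∑ a ∈ s, c a * (u a x : ℂ))
    push_cast
    rw [← this, map_sum, Finset.sum_mul_sum]
    refine Finset.sum_congr rfl fun a _ => Finset.sum_congr rfl fun b _ => ?_
    simp only [map_mul, Complex.conj_ofReal]
    ring
  have hi : ∀ a b, Integrable (fun x => (conj (c a) * c b) * ((u a x * u b x : ℝ) : ℂ)) μ :=
    fun a b => ((hu.integrable_mul a b).ofReal).const_mul _
  have hintg : Integrable (fun x => ((‖∑ a ∈ s, c a * (u a x : ℂ)‖ ^ 2 : ℝ) : ℂ)) μ := by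
    simp_rw [hexp]
    exact integrable_finsetSum _ fun a _ => integrable_finsetSum _ fun b _ => hi a b
  have hval : ∫ x, ((‖∑ a ∈ s, c a * (u a x : ℂ)‖ ^ 2 : ℝ) : ℂ) ∂μ
      = ((∑ a ∈ s, ‖c a‖ ^ 2 : ℝ) : ℂ) := by
    simp_rw [hexp]
    rw [integral_finsetSum _ fun a _ => integrable_finsetSum _ fun b _ => hi a b]
    rw [Complex.ofReal_sum]
    refine Finset.sum_congr rfl fun a ha => ?_
    rw [integral_finsetSum _ fun b _ => hi a b, Finset.sum_eq_single a]
    · rw [integral_const_mul, integral_complex_ofReal, hu.integral_mul_self a]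
      simp [Complex.conj_mul']
    · intro b _ hb
      rw [integral_const_mul, integral_complex_ofReal, hu.integral_mul a b hb.symm]
      simp
    · exact fun h => absurd ha h
  rw [integral_complex_ofReal, Complex.ofReal_inj] at hval
  have hre : Integrable (fun x => ‖∑ a ∈ s, c a * (u a x : ℂ)‖ ^ 2) μ := by
    exact hintg.re
  have h := ofReal_integral_eq_lintegral_ofReal hre (Filter.Eventually.of_forall fun x => by positivity)
  rw [hval, ENNReal.ofReal_sum_of_nonneg fun _ _ => by positivity] at h
  simpa [ENNReal.ofReal_pow, ofReal_norm] using h.symm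

theorem IsModeSystem.weightedBound_one (hu : IsModeSystem μ u) :
    WeightedBound μ u (fun _ => 1) (fun _ => 1) := fun s c => by
  simpa using (hu.lintegral_sum s c).le

theorem WeightedBound.mono {w w' : X → ℝ≥0∞} {r : ι → ℝ≥0∞} (h : WeightedBound μ u w r)
    (hw : ∀ᵐ x ∂μ, w' x ≤ w x) : WeightedBound μ u w' r := fun s c =>
  (lintegral_mono_ae (by filter_upwards [hw] with x hx; gcongr)).trans (h s c)

theorem WeightedBound.const_mul {w : X → ℝ≥0∞} {r : ι → ℝ≥0∞} (h : WeightedBound μ u w r)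
    {K : ℝ≥0∞} (hK : K ≠ ⊤) : WeightedBound μ u (fun x => K * w x) (fun a => K * r a) := fun s c => by
  simp_rw [mul_assoc]
  rw [lintegral_const_mul' _ _ hK, ← Finset.mul_sum]
  gcongr
  exact h s c

/-- Form inequalities tensorize: use the first at fixed y, with coefficients ∑_b c(a,b) v_b(y), then
the second for each a. -/
theorem WeightedBound.prod [SigmaFinite μ] [SigmaFinite ν] (hu : ∀ a, Measurable (u a))
    (hv : ∀ b, Measurable (v b)) {w : X → ℝ≥0∞} {w' : Y → ℝ≥0∞} (hw : Measurable w)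
    (hw' : Measurable w') {r : ι → ℝ≥0∞} {r' : κ → ℝ≥0∞} (h : WeightedBound μ u w r)
    (h' : WeightedBound ν v w' r') :
    WeightedBound (μ.prod ν) (fun (α : ι × κ) z => u α.1 z.1 * v α.2 z.2)
      (fun z => w z.1 * w' z.2) (fun α => r α.1 * r' α.2) := by
  classical
  have key : ∀ (s : Finset ι) (t : Finset κ) (c : ι × κ → ℂ),
      ∫⁻ z, w z.1 * w' z.2 * ‖∑ α ∈ s ×ˢ t, c α * ((u α.1 z.1 * v α.2 z.2 : ℝ) : ℂ)‖ₑ ^ 2 ∂(μ.prod ν)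
        ≤ ∑ α ∈ s ×ˢ t, r α.1 * r' α.2 * ‖c α‖ₑ ^ 2 := by
    intro s t c
    rw [lintegral_prod_symm _ (by fun_prop)]
    calc _ = ∫⁻ y, w' y * ∫⁻ x, w x * ‖∑ a ∈ s, (∑ b ∈ t, c (a, b) * (v b y : ℂ))
            * (u a x : ℂ)‖ₑ ^ 2 ∂μ ∂ν := by
          refine lintegral_congr fun y => ?_
          rw [← lintegral_const_mul _ (by fun_prop)]
          refine lintegral_congr fun x => ?_
          simp only
          rw [Finset.sum_product, mul_comm (w x), mul_assoc]
          congr 5 with a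
          rw [Finset.sum_mul]
          refine Finset.sum_congr rfl fun b _ => ?_
          push_cast; ring
      _ ≤ ∫⁻ y, w' y * ∑ a ∈ s, r a * ‖∑ b ∈ t, c (a, b) * (v b y : ℂ)‖ₑ ^ 2 ∂ν :=
          lintegral_mono fun y => by gcongr; exact h s _
      _ = ∑ a ∈ s, r a * ∫⁻ y, w' y * ‖∑ b ∈ t, c (a, b) * (v b y : ℂ)‖ₑ ^ 2 ∂ν := by
          simp_rw [Finset.mul_sum]
          rw [lintegral_finsetSum _ fun a _ => by fun_prop]
          refine Finset.sum_congr rfl fun a _ => ?_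
          rw [← lintegral_const_mul _ (by fun_prop)]
          refine lintegral_congr fun y => by ring
      _ ≤ ∑ a ∈ s, r a * ∑ b ∈ t, r' b * ‖c (a, b)‖ₑ ^ 2 := by
          gcongr with a _; exact h' t _
      _ = _ := by
          rw [Finset.sum_product]
          simp_rw [Finset.mul_sum, mul_assoc]
  -- A finite set of pairs is enlarged to a rectangle, with coefficient zero on the added pairs.
  intro S c
  have h1 := key (S.image Prod.fst) (S.image Prod.snd) (fun α => if α ∈ S then c α else 0)
  have hS : S ⊆ S.image Prod.fst ×ˢ S.image Prod.snd := fun α hα =>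
    Finset.mem_product.2 ⟨Finset.mem_image_of_mem _ hα, Finset.mem_image_of_mem _ hα⟩
  have e1 : ∀ z : X × Y, ∑ α ∈ S.image Prod.fst ×ˢ S.image Prod.snd,
      (if α ∈ S then c α else 0) * ((u α.1 z.1 * v α.2 z.2 : ℝ) : ℂ)
      = ∑ α ∈ S, c α * ((u α.1 z.1 * v α.2 z.2 : ℝ) : ℂ) := fun z => by
    rw [← Finset.sum_subset hS fun α _ hα => by simp [hα]]
    exact Finset.sum_congr rfl fun α hα => by simp [hα]
  have e2 : ∑ α ∈ S.image Prod.fst ×ˢ S.image Prod.snd,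
      r α.1 * r' α.2 * ‖(if α ∈ S then c α else 0)‖ₑ ^ 2 = ∑ α ∈ S, r α.1 * r' α.2 * ‖c α‖ₑ ^ 2 := by
    rw [← Finset.sum_subset hS fun α _ hα => by simp [hα]]
    exact Finset.sum_congr rfl fun α hα => by simp [hα]
  simp_rw [e1] at h1
  exact h1.trans e2.le

theorem WeightedBound.comp {w : X → ℝ≥0∞} {r : ι → ℝ≥0∞} (h : WeightedBound μ u w r)
    {f : Y → X} (hu : ∀ a, Measurable (u a)) (hw : Measurable w)
    (hf : MeasurePreserving f ν μ) (e : κ ≃ ι) :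
    WeightedBound ν (fun b y => u (e b) (f y)) (fun y => w (f y)) (fun b => r (e b)) := fun s c => by
  have h1 := h (s.map e.toEmbedding) (fun a => c (e.symm a))
  rw [← hf.lintegral_comp (by fun_prop)] at h1
  simpa using h1

theorem IsModeSystem.comp {f : Y ≃ᵐ X} (hu : IsModeSystem μ u)
    (hf : MeasurePreserving f ν μ) (e : κ ≃ ι) :
    IsModeSystem ν (fun b y => u (e b) (f y)) where
  measurable b := (hu.measurable _).comp f.measurable
  memLp b := (hu.memLp _).comp_measurePreserving hf
  integral_mul_self b := by
    rw [hf.integral_comp' (g := fun x => u (e b) x * u (e b) x), hu.integral_mul_self]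
  integral_mul b b' hb := by
    rw [hf.integral_comp' (g := fun x => u (e b) x * u (e b') x), hu.integral_mul]
    simpa using hb
  complete G hG h0 := by
    have hf' := hf.symm f
    have h1 := hu.complete (fun x => G (f.symm x)) (hG.comp_measurePreserving hf') fun a => by
      have := h0 (e.symm a)
      rw [← hf.integral_comp' (g := fun x => (u a x : ℂ) * G (f.symm x))]
      simpa using this
    have h2 := hf.quasiMeasurePreserving.ae h1
    filter_upwards [h2] with y hy
    simpa using hy

theorem IsModeSystem.memLp_mul [SigmaFinite μ] [SigmaFinite ν]
    (hu : IsModeSystem μ u) (hv : IsModeSystem ν v) (a : ι) (b : κ) :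
    MemLp (fun z : X × Y => u a z.1 * v b z.2) 2 (μ.prod ν) := by
  rw [memLp_two_iff_integrable_sq (by
    exact (((hu.measurable _).comp measurable_fst).mul
      ((hv.measurable _).comp measurable_snd)).aestronglyMeasurable)]
  simp_rw [mul_pow]
  exact (hu.memLp a).integrable_sq.mul_prod (hv.memLp b).integrable_sq

theorem IsModeSystem.ae_memLp_section [SigmaFinite μ] [SigmaFinite ν] {G : X × Y → ℂ}
    (hG : MemLp G 2 (μ.prod ν)) : ∀ᵐ y ∂ν, MemLp (fun x => G (x, y)) 2 μ := by
  have hGi : Integrable (fun z => ‖G z‖ ^ 2) (μ.prod ν) := hG.integrable_norm_pow (by norm_num)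
  filter_upwards [hGi.prod_left_ae, hG.1.prod_swap.prodMk_left] with y hy hm
  exact (memLp_two_iff_integrable_sq_norm hm).2 hy

/-- For each a, the function y ↦ ∫ uₐ G(·, y) is in L² and orthogonal to every v_b, hence zero
almost everywhere. As ι is countable, one null set serves all a, and completeness of u finishes on
almost every fibre. -/
theorem IsModeSystem.prod_complete [SigmaFinite μ] [SigmaFinite ν] [Countable ι]
    (hu : IsModeSystem μ u) (hv : IsModeSystem ν v) (G : X × Y → ℂ) (hG : MemLp G 2 (μ.prod ν))
    (h0 : ∀ α : ι × κ, ∫ z, ((u α.1 z.1 * v α.2 z.2 : ℝ) : ℂ) * G z ∂(μ.prod ν) = 0) :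
    G =ᵐ[μ.prod ν] 0 := by
  have hGi : Integrable (fun z => ‖G z‖ ^ 2) (μ.prod ν) := hG.integrable_norm_pow (by norm_num)
  have hGm := hG.1
  have hy1 := IsModeSystem.ae_memLp_section hG
  have hprod : ∀ a b, Integrable (fun z : X × Y => ((u a z.1 * v b z.2 : ℝ) : ℂ) * G z)
      (μ.prod ν) := fun a b => (hu.memLp_mul hv a b).ofReal.integrable_mul hG
  have hga : ∀ a, ∀ᵐ y ∂ν, ∫ x, (u a x : ℂ) * G (x, y) ∂μ = 0 := fun a => by
    have hm : AEStronglyMeasurable (fun y => ∫ x, (u a x : ℂ) * G (x, y) ∂μ) ν := by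
      have : AEStronglyMeasurable (fun z : Y × X => (u a z.2 : ℂ) * G (z.2, z.1)) (ν.prod μ) := by
        refine AEStronglyMeasurable.mul ?_ hGm.prod_swap
        exact (Complex.measurable_ofReal.comp ((hu.measurable a).comp measurable_snd)).aestronglyMeasurable
      exact this.integral_prod_right'
    refine hv.complete _ ?_ fun b => ?_
    · rw [memLp_two_iff_integrable_sq_norm hm]
      have hb : Integrable (fun y => ∫ x, ‖G (x, y)‖ ^ 2 ∂μ) ν := hGi.integral_prod_right
      refine hb.mono' (hm.norm.pow 2) ?_
      filter_upwards [hy1] with y hy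
      have hcs := integral_mul_norm_le_Lp_mul_Lq (μ := μ) (p := 2) (q := 2)
        ⟨by norm_num, by norm_num, by norm_num⟩ (f := fun x => (u a x : ℂ)) (g := fun x => G (x, y))
        (by rw [ENNReal.ofReal_ofNat]; exact (hu.memLp a).ofReal) (by simpa using hy)
      have h1 : ∫ x, ‖(u a x : ℂ)‖ ^ (2 : ℝ) ∂μ = 1 := by
        rw [← hu.integral_mul_self a]
        congr 1 with x
        simp [pow_two]
      rw [h1, Real.one_rpow, one_mul] at hcs
      have h2 : ‖∫ x, (u a x : ℂ) * G (x, y) ∂μ‖ ≤ ∫ x, ‖(u a x : ℂ)‖ * ‖G (x, y)‖ ∂μ := by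
        refine (norm_integral_le_integral_norm _).trans_eq ?_
        simp
      have h3 : 0 ≤ ∫ x, ‖G (x, y)‖ ^ 2 ∂μ := integral_nonneg fun x => by positivity
      rw [Real.norm_of_nonneg (by positivity)]
      calc _ ≤ ((∫ x, ‖G (x, y)‖ ^ (2 : ℝ) ∂μ) ^ (1 / (2 : ℝ))) ^ 2 := by
            gcongr; exact h2.trans hcs
        _ = _ := by
            rw [← Real.sqrt_eq_rpow]
            simp only [Real.rpow_two]
            exact Real.sq_sqrt h3
    · have := h0 (a, b)
      rw [integral_prod_symm _ (hprod a b)] at this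
      rw [← this]
      refine integral_congr_ae (Filter.Eventually.of_forall fun y => ?_)
      simp only
      rw [← integral_const_mul]
      congr 1 with x
      push_cast; ring
  have hall : ∀ᵐ y ∂ν, ∀ a, ∫ x, (u a x : ℂ) * G (x, y) ∂μ = 0 := ae_all_iff.2 hga
  have hfin : ∀ᵐ y ∂ν, ∫⁻ x, ‖G (x, y)‖ₑ ∂μ = 0 := by
    filter_upwards [hall, hy1] with y h1 h2
    have := hu.complete _ h2 h1
    rw [lintegral_eq_zero_iff' h2.1.enorm]
    filter_upwards [this] with x hx
    simp [hx]
  have h2 : ∫⁻ z, ‖G z‖ₑ ∂(μ.prod ν) = 0 := by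
    rw [lintegral_prod_symm _ hGm.enorm, lintegral_congr_ae hfin, lintegral_zero]
  rw [lintegral_eq_zero_iff' hGm.enorm] at h2
  filter_upwards [h2] with z hz
  simpa using hz

theorem IsModeSystem.prod [SigmaFinite μ] [SigmaFinite ν] [Countable ι]
    (hu : IsModeSystem μ u) (hv : IsModeSystem ν v) :
    IsModeSystem (μ.prod ν) (fun (α : ι × κ) z => u α.1 z.1 * v α.2 z.2) where
  measurable α := ((hu.measurable _).comp measurable_fst).mul ((hv.measurable _).comp measurable_snd)
  memLp α := hu.memLp_mul hv α.1 α.2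
  integral_mul_self α := by
    have := integral_prod_mul (μ := μ) (ν := ν) (fun x => u α.1 x * u α.1 x)
      (fun y => v α.2 y * v α.2 y)
    rw [hu.integral_mul_self, hv.integral_mul_self, mul_one] at this
    rw [← this]
    congr 1 with z
    ring
  integral_mul α β hαβ := by
    have := integral_prod_mul (μ := μ) (ν := ν) (fun x => u α.1 x * u β.1 x)
      (fun y => v α.2 y * v β.2 y)
    have h0 : (∫ x, u α.1 x * u β.1 x ∂μ) * (∫ y, v α.2 y * v β.2 y ∂ν) = 0 := by
      by_cases h1 : α.1 = β.1
      · have h2 : α.2 ≠ β.2 := fun h2 => hαβ (Prod.ext h1 h2)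
        rw [hv.integral_mul _ _ h2, mul_zero]
      · rw [hu.integral_mul _ _ h1, zero_mul]
    rw [h0] at this
    rw [← this]
    congr 1 with z
    ring
  complete := hu.prod_complete hv

theorem measurePreserving_consEquiv {n : ℕ} (μ : Fin (n + 1) → Measure X) [∀ i, SigmaFinite (μ i)] :
    MeasurePreserving (MeasurableEquiv.piFinSuccAbove (fun _ => X) 0) (Measure.pi μ)
      ((μ 0).prod (Measure.pi fun i : Fin n => μ i.succ)) := by
  simpa using measurePreserving_piFinSuccAbove μ 0

theorem IsModeSystem.pi [Countable ι] {n : ℕ} (μ : Fin n → Measure X) [∀ i, SigmaFinite (μ i)]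
    {u : Fin n → ι → X → ℝ} (hu : ∀ i, IsModeSystem (μ i) (u i)) :
    IsModeSystem (Measure.pi μ) (fun (α : Fin n → ι) x => ∏ i, u i (α i) (x i)) := by
  induction n with
  | zero =>
    rw [Measure.pi_of_empty]
    refine ⟨fun a => by simp, fun a => by simp, fun a => by simp, fun a b h =>
      absurd (Subsingleton.elim a b) h, fun G hG h0 => ?_⟩
    have := h0 (fun i => i.elim0)
    simp only [Finset.univ_eq_empty, Finset.prod_empty, Complex.ofReal_one, one_mul,
      integral_dirac] at this
    rw [Filter.EventuallyEq, ae_dirac_eq]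
    simpa using this
  | succ n ih =>
    have h := ((hu 0).prod (ih (fun i => μ i.succ) fun i => hu i.succ)).comp
      (measurePreserving_consEquiv μ) (Fin.consEquiv fun _ => ι).symm
    convert h using 3
    rw [Fin.prod_univ_succ]
    rfl

theorem WeightedBound.pi {n : ℕ} (μ : Fin n → Measure X) [∀ i, SigmaFinite (μ i)]
    {u : Fin n → ι → X → ℝ} (hu : ∀ i a, Measurable (u i a)) {w : Fin n → X → ℝ≥0∞}
    (hw : ∀ i, Measurable (w i)) {r : Fin n → ι → ℝ≥0∞}
    (h : ∀ i, WeightedBound (μ i) (u i) (w i) (r i)) :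
    WeightedBound (Measure.pi μ) (fun (α : Fin n → ι) x => ∏ i, u i (α i) (x i))
      (fun x => ∏ i, w i (x i)) (fun α => ∏ i, r i (α i)) := by
  induction n with
  | zero =>
    rw [Measure.pi_of_empty]
    intro s c
    rcases s.eq_empty_or_nonempty with rfl | hs
    · simp
    · have : s = {fun i => i.elim0} := by
        ext a
        simp only [Finset.mem_singleton]
        obtain ⟨b, hb⟩ := hs
        refine ⟨fun _ => Subsingleton.elim _ _, fun _ => ?_⟩
        rwa [Subsingleton.elim a b]
      subst this
      simp
  | succ n ih =>
    have h := ((h 0).prod (hu 0) (fun b => by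
      exact Finset.measurable_prod _ fun i _ => (hu i.succ (b i)).comp (measurable_pi_apply i)) (hw 0)
      (by exact Finset.measurable_prod _ fun i _ => (hw i.succ).comp (measurable_pi_apply i))
      (ih (fun i => μ i.succ) (fun i => hu i.succ) (fun i => hw i.succ) fun i => h i.succ)).comp
      (fun b => by
        refine ((hu 0 _).comp measurable_fst).mul ?_
        exact Finset.measurable_prod _ fun i _ => (hu i.succ _).comp
          ((measurable_pi_apply i).comp measurable_snd))
      (by
        refine ((hw 0).comp measurable_fst).mul ?_
        exact Finset.measurable_prod _ fun i _ => (hw i.succ).comp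
          ((measurable_pi_apply i).comp measurable_snd))
      (measurePreserving_consEquiv μ) (Fin.consEquiv fun _ => ι).symm
    convert h using 2
    · funext x
      rw [Fin.prod_univ_succ]
      rfl
    · rw [Fin.prod_univ_succ]
      rfl
    · rw [Fin.prod_univ_succ]
      rfl

end Modes

/-! ### Completeness of the Hermite functions -/

section Completeness
open Polynomial

theorem memLp_gaussPoly (q : ℝ[X]) : MemLp (gaussPoly q) 2 := by
  rw [memLp_two_iff_integrable_sq (continuous_gaussPoly q).aestronglyMeasurable]
  simp_rw [pow_two]
  exact integrable_gaussPoly_mul q q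

/-- The span contains 1 and, by the recursion `X_mul_hermPoly` with the lowering relation, is stable
under multiplication by X. -/
theorem span_hermPoly : Submodule.span ℝ (Set.range hermPoly) = ⊤ := by
  set S := Submodule.span ℝ (Set.range hermPoly)
  have hS : ∀ a, hermPoly a ∈ S := fun a => Submodule.subset_span ⟨a, rfl⟩
  have hC : ∀ (c : ℝ) {q : ℝ[X]}, q ∈ S → C c * q ∈ S := fun c q hq => by
    rw [← smul_eq_C_mul]; exact S.smul_mem c hq
  have hX : ∀ q ∈ S, X * q ∈ S := by
    intro q hq
    induction hq using Submodule.span_induction with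
    | mem q hq =>
      obtain ⟨a, rfl⟩ := hq
      have hd : derivative (hermPoly a) ∈ S := by
        cases a with
        | zero => simp [hermPoly]
        | succ a => rw [derivative_hermPoly_succ]; exact hC _ (hS a)
      have h2 : X * hermPoly a = C (1 / 2) * (2 * X * hermPoly a) := by
        rw [← mul_assoc, ← mul_assoc, show (2 : ℝ[X]) = C 2 from rfl, ← C_mul]
        norm_num
      rw [h2, X_mul_hermPoly]
      exact hC _ (S.add_mem (hC _ (hS _)) hd)
    | zero => simp
    | add p q _ _ hp hq => rw [mul_add]; exact S.add_mem hp hq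
    | smul c q _ hq => rw [mul_smul_comm]; exact S.smul_mem c hq
  have h1 : (1 : ℝ[X]) ∈ S := by
    have : (1 : ℝ[X]) = C (Real.pi ^ (-(1 / 4) : ℝ))⁻¹ * hermPoly 0 := by
      rw [hermPoly, ← C_mul, inv_mul_cancel₀ (Real.rpow_pos_of_pos Real.pi_pos _).ne', C_1]
    rw [this]
    exact hC _ (hS 0)
  have hpow : ∀ k : ℕ, (X ^ k : ℝ[X]) ∈ S := by
    intro k
    induction k with
    | zero => simpa using h1
    | succ k ih => rw [pow_succ']; exact hX _ ih
  rw [eq_top_iff]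
  intro q _
  rw [q.as_sum_range_C_mul_X_pow]
  exact S.sum_mem fun k _ => hC _ (hpow k)

theorem integrable_gaussPoly_mul_of_memLp {G : ℝ → ℂ} (hG : MemLp G 2) (q : ℝ[X]) :
    Integrable fun x => (gaussPoly q x : ℂ) * G x :=
  (memLp_gaussPoly q).ofReal.integrable_mul hG

theorem integral_gaussPoly_mul_eq_zero {G : ℝ → ℂ} (hG : MemLp G 2)
    (h : ∀ a, ∫ x, (hermFun a x : ℂ) * G x = 0) (q : ℝ[X]) :
    ∫ x, (gaussPoly q x : ℂ) * G x = 0 := by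
  have hq : q ∈ Submodule.span ℝ (Set.range hermPoly) := by rw [span_hermPoly]; trivial
  induction hq using Submodule.span_induction with
  | mem q hq => obtain ⟨a, rfl⟩ := hq; exact h a
  | zero => simp [gaussPoly]
  | add p q _ _ hp hq =>
    have : ∀ x, (gaussPoly (p + q) x : ℂ) * G x
        = (gaussPoly p x : ℂ) * G x + (gaussPoly q x : ℂ) * G x := fun x => by
      simp only [gaussPoly, eval_add]; push_cast; ring
    simp_rw [this]
    rw [integral_add (integrable_gaussPoly_mul_of_memLp hG p) (integrable_gaussPoly_mul_of_memLp hG q),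
      hp, hq, add_zero]
  | smul c q _ hq =>
    have : ∀ x, (gaussPoly (c • q) x : ℂ) * G x = (c : ℂ) * ((gaussPoly q x : ℂ) * G x) := fun x => by
      simp only [gaussPoly, eval_smul, smul_eq_mul]; push_cast; ring
    simp_rw [this]
    rw [integral_const_mul, hq, mul_zero]

/-- Expand the exponential: every term is a polynomial times the Gaussian, to which G is orthogonal.
The series is dominated because |tx| ≤ t² + x²/4, which leaves exp(-x²/4), an L² function, to be
paired with G. -/
theorem integral_cexp_mul_gauss_eq_zero {G : ℝ → ℂ} (hG : MemLp G 2)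
    (h : ∀ a, ∫ x, (hermFun a x : ℂ) * G x = 0) (t : ℝ) :
    ∫ x, Complex.exp (((t * x : ℝ) : ℂ) * Complex.I) * ((Real.exp (-(x ^ 2) / 2) : ℂ) * G x) = 0 := by
  set F : ℕ → ℝ → ℂ := fun k x => ((t : ℂ) * Complex.I) ^ k / (k.factorial : ℂ) *
    ((gaussPoly (X ^ k) x : ℂ) * G x) with hF
  set bound : ℕ → ℝ → ℝ := fun k x => |t * x| ^ k / (k.factorial : ℝ) *
    (Real.exp (-(x ^ 2) / 2) * ‖G x‖) with hbound
  have hFn : ∀ k x, F k x = (((t * x : ℝ) : ℂ) * Complex.I) ^ k / (k.factorial : ℂ) *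
      ((Real.exp (-(x ^ 2) / 2) : ℂ) * G x) := fun k x => by
    simp only [hF, gaussPoly, eval_pow, eval_X]
    push_cast
    ring
  have hexp : ∀ y : ℝ, HasSum (fun k : ℕ => y ^ k / (k.factorial : ℝ)) (Real.exp y) := fun y => by
    rw [Real.exp_eq_exp_ℝ]; exact NormedSpace.expSeries_div_hasSum_exp y
  have hcexp : ∀ y : ℂ, HasSum (fun k : ℕ => y ^ k / (k.factorial : ℂ)) (Complex.exp y) := fun y => by
    rw [Complex.exp_eq_exp_ℂ]; exact NormedSpace.expSeries_div_hasSum_exp y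
  have hbs : ∀ x, HasSum (fun k => bound k x) (Real.exp |t * x| * (Real.exp (-(x ^ 2) / 2) * ‖G x‖)) :=
    fun x => (hexp _).mul_right _
  have hs := hasSum_integral_of_dominated_convergence (μ := volume) (F := F)
    (f := fun x => Complex.exp (((t * x : ℝ) : ℂ) * Complex.I) *
      ((Real.exp (-(x ^ 2) / 2) : ℂ) * G x)) bound
    (fun k => ((integrable_gaussPoly_mul_of_memLp hG (X ^ k)).const_mul _).aestronglyMeasurable)
    (fun k => Filter.Eventually.of_forall fun x => by
      rw [hFn]
      simp only [hbound, norm_mul, norm_div, norm_pow, Complex.norm_real, Complex.norm_I, mul_one,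
        Complex.norm_natCast, Real.norm_eq_abs, Real.abs_exp, abs_mul]
      exact le_rfl)
    (Filter.Eventually.of_forall fun x => (hbs x).summable)
    (by
      simp_rw [fun x => (hbs x).tsum_eq]
      have h1 : MemLp (fun x : ℝ => Real.exp (-(x ^ 2) / 4)) 2 := by
        rw [memLp_two_iff_integrable_sq (by fun_prop)]
        refine (integrable_exp_neg_mul_sq (b := 1 / 2) (by norm_num)).congr
          (Filter.Eventually.of_forall fun x => ?_)
        simp only [← Real.exp_nat_mul]
        congr 1; push_cast; ring
      have h2 : Integrable fun x => Real.exp (t ^ 2) * (Real.exp (-(x ^ 2) / 4) * ‖G x‖) :=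
        (h1.integrable_mul hG.norm).const_mul _
      refine h2.mono' ?_ (Filter.Eventually.of_forall fun x => ?_)
      · refine AEStronglyMeasurable.mul (by fun_prop) (AEStronglyMeasurable.mul (by fun_prop) hG.1.norm)
      · have h3 : |t * x| ≤ t ^ 2 + x ^ 2 / 4 := by
          rw [abs_le]; constructor <;> nlinarith [sq_nonneg (t - x / 2), sq_nonneg (t + x / 2)]
        have h4 : Real.exp |t * x| * Real.exp (-(x ^ 2) / 2)
            ≤ Real.exp (t ^ 2) * Real.exp (-(x ^ 2) / 4) := by
          rw [← Real.exp_add, ← Real.exp_add]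
          exact Real.exp_le_exp.2 (by linarith)
        rw [Real.norm_of_nonneg (by positivity), ← mul_assoc, ← mul_assoc]
        exact mul_le_mul_of_nonneg_right h4 (norm_nonneg _))
    (Filter.Eventually.of_forall fun x => by
      simp_rw [hFn]
      exact (hcexp _).mul_right _)
  refine hs.unique ?_
  have h0 : ∀ k, ∫ x, F k x = 0 := fun k => by
    simp only [hF]
    rw [integral_const_mul, integral_gaussPoly_mul_eq_zero hG h, mul_zero]
  simp_rw [h0]
  exact hasSum_zero

-- Every test function φ is the Fourier transform of a Schwartz function, and the multiplication
-- formula transfers the transform to f: ∫ φ f = ∫ (𝓕⁻φ)(𝓕 f) = 0.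
open FourierTransform SchwartzMap in
theorem ae_eq_zero_of_fourier_eq_zero {f : ℝ → ℂ} (hf : Integrable f)
    (h : ∀ w, 𝓕 f w = 0) : f =ᵐ[volume] 0 := by
  refine ae_eq_zero_of_integral_contDiff_smul_eq_zero hf.locallyIntegrable fun g hg hgc => ?_
  have hg₁ : HasCompactSupport (Complex.ofRealCLM ∘ g) := hgc.comp_left rfl
  have hg₂ : ContDiff ℝ ∞ (Complex.ofRealCLM ∘ g) := by fun_prop
  set φ : 𝓢(ℝ, ℂ) := hg₁.toSchwartzMap hg₂
  have hφ : 𝓕 (𝓕⁻ φ) = φ := fourier_fourierInv_eq φ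
  have h1 := VectorFourier.integral_fourierIntegral_smul_eq_flip (L := innerₗ ℝ) (μ := volume)
    (ν := volume) Real.continuous_fourierChar continuous_inner hf (𝓕⁻ φ).integrable
  have e1 : ∀ x, (VectorFourier.fourierIntegral Real.fourierChar volume (innerₗ ℝ) f x) = 0 := h
  have e2 : ∀ x, VectorFourier.fourierIntegral Real.fourierChar volume (innerₗ ℝ).flip
      (fun x => (𝓕⁻ φ) x) x = φ x := fun x => by
    rw [flip_innerₗ]
    conv_rhs => rw [← hφ]
    rfl
  simp_rw [e1, zero_smul, integral_zero] at h1
  rw [eq_comm] at h1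
  rw [← h1]
  refine integral_congr_ae (Filter.Eventually.of_forall fun x => ?_)
  simp only
  rw [e2]
  simp [φ, mul_comm]

theorem isModeSystem_hermFun : IsModeSystem volume hermFun where
  measurable a := (continuous_gaussPoly _).measurable
  memLp a := memLp_gaussPoly _
  integral_mul_self a := by rw [integral_hermFun_mul, if_pos rfl]
  integral_mul a b hab := by rw [integral_hermFun_mul, if_neg hab]
  complete G hG h := by
    have h1 : Integrable fun x => (Real.exp (-(x ^ 2) / 2) : ℂ) * G x := by
      refine (integrable_gaussPoly_mul_of_memLp hG 1).congr (Filter.Eventually.of_forall fun x => ?_)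
      simp [gaussPoly]
    have h2 := ae_eq_zero_of_fourier_eq_zero h1 fun w => by
      rw [Real.fourier_real_eq_integral_exp_smul]
      have := integral_cexp_mul_gauss_eq_zero hG h (-2 * Real.pi * w)
      rw [← this]
      congr 1 with x
      simp only [smul_eq_mul]
      congr 4
      ring
    filter_upwards [h2] with x hx
    simpa using hx

end Completeness

/-! ### A Hardy inequality for Hermite expansions -/

theorem oscEig_rpow_pos (a : ℕ) (q : ℝ) : 0 < oscEig a ^ q := Real.rpow_pos_of_pos (oscEig_pos a) q

/-- Cauchy–Schwarz with weights λ^{1/8} and λ^{-1/8}. The condition on s says λ < r⁻², so s lies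
among the first ⌊r⁻²⌋ indices, where `sum_weighted_hermFun_sq_le` gives 8 r^{-1/2}. -/
theorem norm_sum_hermFun_sq_le {r : ℝ} (hr : 0 < r) (s : Finset ℕ)
    (hs : ∀ a ∈ s, r < oscEig a ^ (-(1 / 2) : ℝ)) (c : ℕ → ℂ) (x : ℝ) :
    ‖∑ a ∈ s, c a * (hermFun a x : ℂ)‖ ^ 2
      ≤ 8 * r ^ (-(1 / 2) : ℝ) * ∑ a ∈ s, oscEig a ^ (1 / 4 : ℝ) * ‖c a‖ ^ 2 := by
  have h1 : ‖∑ a ∈ s, c a * (hermFun a x : ℂ)‖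
      ≤ ∑ a ∈ s, (oscEig a ^ (1 / 8 : ℝ) * ‖c a‖) * (oscEig a ^ (-(1 / 8) : ℝ) * |hermFun a x|) := by
    refine (norm_sum_le _ _).trans (Finset.sum_le_sum fun a _ => le_of_eq ?_)
    have : oscEig a ^ (1 / 8 : ℝ) * oscEig a ^ (-(1 / 8) : ℝ) = 1 := by
      rw [← Real.rpow_add (oscEig_pos a)]; norm_num
    simp only [norm_mul, Complex.norm_real, Real.norm_eq_abs]
    linear_combination (-(‖c a‖ * |hermFun a x|)) * this
  have hsq : ∀ (a : ℕ) (q : ℝ), (oscEig a ^ q) ^ 2 = oscEig a ^ (2 * q) := fun a q => by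
    rw [← Real.rpow_natCast, ← Real.rpow_mul (oscEig_pos a).le]; congr 1; push_cast; ring
  have h2 := Finset.sum_mul_sq_le_sq_mul_sq s (fun a => oscEig a ^ (1 / 8 : ℝ) * ‖c a‖)
    (fun a => oscEig a ^ (-(1 / 8) : ℝ) * |hermFun a x|)
  simp only [mul_pow, hsq, sq_abs] at h2
  norm_num at h2
  set N := ⌊r ^ (-2 : ℝ)⌋₊
  have hsub : s ⊆ Finset.range N := by
    intro a ha
    have h3 := hs a ha
    have h4 : oscEig a < r ^ (-2 : ℝ) := by
      have := Real.rpow_lt_rpow_of_neg hr h3 (by norm_num : (-2 : ℝ) < 0)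
      rw [← Real.rpow_mul (oscEig_pos a).le] at this
      rwa [show (-(1 / 2) : ℝ) * -2 = 1 by norm_num, Real.rpow_one] at this
    rw [Finset.mem_range]
    refine Nat.lt_of_succ_le (Nat.le_floor ?_)
    unfold oscEig at h4
    have : (0 : ℝ) ≤ a := a.cast_nonneg
    push_cast
    linarith
  have h5 : ∑ a ∈ s, oscEig a ^ (-(1 / 4) : ℝ) * hermFun a x ^ 2 ≤ 8 * r ^ (-(1 / 2) : ℝ) := by
    refine (Finset.sum_le_sum_of_subset_of_nonneg hsub fun a _ _ =>
      mul_nonneg (oscEig_rpow_pos a _).le (sq_nonneg _)).trans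
      ((sum_weighted_hermFun_sq_le N x).trans ?_)
    have h6 : (N : ℝ) ≤ r ^ (-2 : ℝ) := Nat.floor_le (by positivity)
    have h7 := Real.rpow_le_rpow (by positivity) h6 (by norm_num : (0 : ℝ) ≤ 1 / 4)
    rw [← Real.rpow_mul hr.le] at h7
    norm_num at h7 ⊢
    linarith
  calc _ ≤ (∑ a ∈ s, (oscEig a ^ (1 / 8 : ℝ) * ‖c a‖) * (oscEig a ^ (-(1 / 8) : ℝ)
            * |hermFun a x|)) ^ 2 := by gcongr
    _ ≤ _ := h2
    _ ≤ (∑ a ∈ s, oscEig a ^ (1 / 4 : ℝ) * ‖c a‖ ^ 2) * (8 * r ^ (-(1 / 2) : ℝ)) := by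
        refine mul_le_mul_of_nonneg_left ?_ (Finset.sum_nonneg fun a _ =>
          mul_nonneg (oscEig_rpow_pos a _).le (sq_nonneg _))
        refine le_trans (le_of_eq ?_) h5
        norm_num
    _ = _ := by ring

/-- Modes with λ < r⁻² are bounded uniformly and integrated over an interval of length 2r; the
others are bounded by their full L² norm. The constant 32 is 8 · 2 times the 2 from |A+B|² ≤ 2|A|² +
2|B|². -/
theorem lintegral_ball_sum_hermFun_le {r : ℝ} (hr : 0 < r) (s : Finset ℕ) (c : ℕ → ℂ) :
    ∫⁻ x in {x | |x| < r}, ‖∑ a ∈ s, c a * (hermFun a x : ℂ)‖ₑ ^ 2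
      ≤ ∑ a ∈ s, ‖c a‖ₑ ^ 2 * (if r < oscEig a ^ (-(1 / 2) : ℝ) then
          32 * ENNReal.ofReal (oscEig a ^ (1 / 4 : ℝ)) * ENNReal.ofReal (r ^ (1 / 2 : ℝ)) else 2) := by
  classical
  set P : ℕ → Prop := fun a => r < oscEig a ^ (-(1 / 2) : ℝ)
  set sl := s.filter P
  set sh := s.filter fun a => ¬ P a
  have hm : ∀ t : Finset ℕ, Measurable fun x : ℝ => ∑ a ∈ t, c a * (hermFun a x : ℂ) := fun t =>
    Finset.measurable_sum _ fun a _ => measurable_const.mul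
      (Complex.measurable_ofReal.comp (isModeSystem_hermFun.measurable a))
  have hsplit : ∀ x, ‖∑ a ∈ s, c a * (hermFun a x : ℂ)‖ₑ ^ 2
      ≤ 2 * ‖∑ a ∈ sl, c a * (hermFun a x : ℂ)‖ₑ ^ 2 + 2 * ‖∑ a ∈ sh, c a * (hermFun a x : ℂ)‖ₑ ^ 2 := by
    intro x
    rw [← Finset.sum_filter_add_sum_filter_not s P]
    set A := ∑ a ∈ s.filter P, c a * (hermFun a x : ℂ)
    set B := ∑ a ∈ s.filter (fun a => ¬ P a), c a * (hermFun a x : ℂ)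
    have h : ‖A + B‖ ^ 2 ≤ 2 * ‖A‖ ^ 2 + 2 * ‖B‖ ^ 2 := by
      have := norm_add_le A B
      nlinarith [norm_nonneg (A + B), sq_nonneg (‖A‖ - ‖B‖), norm_nonneg A, norm_nonneg B]
    have h' := ENNReal.ofReal_le_ofReal h
    rw [ENNReal.ofReal_add (by positivity) (by positivity), ENNReal.ofReal_mul (by norm_num),
      ENNReal.ofReal_mul (by norm_num)] at h'
    simpa [ENNReal.ofReal_pow, ofReal_norm] using h'
  have hlow : ∫⁻ x in {x | |x| < r}, ‖∑ a ∈ sl, c a * (hermFun a x : ℂ)‖ₑ ^ 2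
      ≤ ∑ a ∈ sl, ‖c a‖ₑ ^ 2 * (16 * ENNReal.ofReal (oscEig a ^ (1 / 4 : ℝ))
        * ENNReal.ofReal (r ^ (1 / 2 : ℝ))) := by
    have hvol : volume {x : ℝ | |x| < r} = ENNReal.ofReal (2 * r) := by
      have : {x : ℝ | |x| < r} = Metric.ball 0 r := by ext x; simp
      rw [this, Real.volume_ball]
    set K := 8 * r ^ (-(1 / 2) : ℝ) * ∑ a ∈ sl, oscEig a ^ (1 / 4 : ℝ) * ‖c a‖ ^ 2
    calc _ ≤ ∫⁻ x in {x | |x| < r}, ENNReal.ofReal K := by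
          refine lintegral_mono fun x => ?_
          have := ENNReal.ofReal_le_ofReal (norm_sum_hermFun_sq_le hr sl
            (fun a ha => (Finset.mem_filter.1 ha).2) c x)
          rwa [ENNReal.ofReal_pow (norm_nonneg _), ofReal_norm] at this
      _ = ENNReal.ofReal K * ENNReal.ofReal (2 * r) := by rw [setLIntegral_const, hvol]
      _ = ENNReal.ofReal (∑ a ∈ sl, ‖c a‖ ^ 2 * (16 * oscEig a ^ (1 / 4 : ℝ) * r ^ (1 / 2 : ℝ))) := by
          have hk : 0 ≤ K := mul_nonneg (by positivity) (Finset.sum_nonneg fun a _ =>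
            mul_nonneg (oscEig_rpow_pos a _).le (sq_nonneg _))
          rw [← ENNReal.ofReal_mul hk]
          congr 1
          have hrr : r ^ (-(1 / 2) : ℝ) * r = r ^ (1 / 2 : ℝ) := by
            conv_lhs => rw [← Real.rpow_add_one hr.ne']
            norm_num
          simp only [K]
          rw [mul_assoc, mul_comm _ (2 * r), ← mul_assoc,
            show 8 * r ^ (-(1 / 2) : ℝ) * (2 * r) = 16 * (r ^ (-(1 / 2) : ℝ) * r) by ring, hrr,
            Finset.mul_sum]
          exact Finset.sum_congr rfl fun a _ => by ring
      _ = _ := by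
          rw [ENNReal.ofReal_sum_of_nonneg fun a _ => by
            have := (oscEig_rpow_pos a (1 / 4)).le; positivity]
          refine Finset.sum_congr rfl fun a _ => ?_
          have := (oscEig_rpow_pos a (1 / 4)).le
          rw [ENNReal.ofReal_mul (by positivity), ENNReal.ofReal_mul (by positivity),
            ENNReal.ofReal_mul (by positivity), ENNReal.ofReal_pow (norm_nonneg _), ofReal_norm,
            ENNReal.ofReal_ofNat]
  have hhigh : ∫⁻ x in {x | |x| < r}, ‖∑ a ∈ sh, c a * (hermFun a x : ℂ)‖ₑ ^ 2
      ≤ ∑ a ∈ sh, ‖c a‖ₑ ^ 2 :=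
    (setLIntegral_le_lintegral _ _).trans (isModeSystem_hermFun.lintegral_sum sh c).le
  calc _ ≤ ∫⁻ x in {x | |x| < r}, (2 * ‖∑ a ∈ sl, c a * (hermFun a x : ℂ)‖ₑ ^ 2
          + 2 * ‖∑ a ∈ sh, c a * (hermFun a x : ℂ)‖ₑ ^ 2) := lintegral_mono hsplit
    _ = 2 * (∫⁻ x in {x | |x| < r}, ‖∑ a ∈ sl, c a * (hermFun a x : ℂ)‖ₑ ^ 2)
          + 2 * ∫⁻ x in {x | |x| < r}, ‖∑ a ∈ sh, c a * (hermFun a x : ℂ)‖ₑ ^ 2 := by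
        rw [lintegral_add_left (((hm sl).enorm.pow_const 2).const_mul 2),
          lintegral_const_mul _ ((hm sl).enorm.pow_const 2),
          lintegral_const_mul _ ((hm sh).enorm.pow_const 2)]
    _ ≤ 2 * _ + 2 * _ := add_le_add (mul_le_mul_right hlow 2) (mul_le_mul_right hhigh 2)
    _ = _ := by
        rw [← Finset.sum_filter_add_sum_filter_not s P, Finset.mul_sum, Finset.mul_sum]
        congr 1
        · refine Finset.sum_congr rfl fun a ha => ?_
          rw [if_pos (Finset.mem_filter.1 ha).2,
            show (32 : ℝ≥0∞) = 2 * 16 by norm_num]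
          ring
        · refine Finset.sum_congr rfl fun a ha => ?_
          rw [if_neg (Finset.mem_filter.1 ha).2, mul_comm]

theorem lintegral_Ioi_rpow {R : ℝ} (hR : 0 < R) :
    ∫⁻ r in Set.Ioi R, ENNReal.ofReal (r ^ (-(4 / 3) : ℝ)) = ENNReal.ofReal (3 * R ^ (-(1 / 3) : ℝ)) := by
  rw [← ofReal_integral_eq_lintegral_ofReal (integrableOn_Ioi_rpow_of_lt (by norm_num) hR)
    ((ae_restrict_iff' measurableSet_Ioi).2 (Filter.Eventually.of_forall fun r hr =>
      Real.rpow_nonneg (hR.le.trans (le_of_lt hr)) _)),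
    integral_Ioi_rpow_of_lt (by norm_num) hR]
  congr 1
  rw [show (-(4 / 3) : ℝ) + 1 = -(1 / 3) by norm_num]
  ring

theorem lintegral_Ioc_rpow {R : ℝ} (hR : 0 < R) :
    ∫⁻ r in Set.Ioc 0 R, ENNReal.ofReal (r ^ (-(5 / 6) : ℝ)) = ENNReal.ofReal (6 * R ^ (1 / 6 : ℝ)) := by
  rw [← ofReal_integral_eq_lintegral_ofReal
    ((intervalIntegrable_iff_integrableOn_Ioc_of_le hR.le).1
      (intervalIntegral.intervalIntegrable_rpow' (by norm_num)))
    ((ae_restrict_iff' measurableSet_Ioc).2 (Filter.Eventually.of_forall fun r hr =>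
      Real.rpow_nonneg hr.1.le _)), ← intervalIntegral.integral_of_le hR.le,
    integral_rpow (Or.inl (by norm_num))]
  congr 1
  rw [show (-(5 / 6) : ℝ) + 1 = 1 / 6 by norm_num, Real.zero_rpow (by norm_num)]
  ring

/-- Write 3|x|^{-1/3} as the integral of r^{-4/3} over r > |x| and exchange integrals: what appears
is the mass of the function in the ball of radius r. With R = λ^{-1/2}, the range below R
contributes 32 λ^{1/4} · 6R^{1/6} = 192 λ^{1/6} and the range above it 2 · 3R^{-1/3} = 6 λ^{1/6};
finally 198 = 3 · 66. -/
theorem weightedBound_hermFun :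
    WeightedBound volume hermFun (fun x => ENNReal.ofReal (|x| ^ (-(1 / 3) : ℝ)))
      (fun a => 66 * ENNReal.ofReal (oscEig a ^ (1 / 6 : ℝ))) := by
  intro s c
  set f : ℝ → ℝ≥0∞ := fun x => ‖∑ a ∈ s, c a * (hermFun a x : ℂ)‖ₑ ^ 2 with hf
  have hfm : Measurable f := (Finset.measurable_sum _ fun a _ => measurable_const.mul
      (Complex.measurable_ofReal.comp (isModeSystem_hermFun.measurable a))).enorm.pow_const 2
  set k : ℝ → ℝ → ℝ≥0∞ := fun x r =>
    if |x| < r then ENNReal.ofReal (r ^ (-(4 / 3) : ℝ)) * f x else 0 with hk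
  have hkm : Measurable (Function.uncurry k) := by
    refine Measurable.ite (measurableSet_lt (by fun_prop) (by fun_prop)) ?_ measurable_const
    exact (by fun_prop : Measurable fun z : ℝ × ℝ => ENNReal.ofReal (z.2 ^ (-(4 / 3) : ℝ))).mul
      (hfm.comp measurable_fst)
  have h1 : 3 * ∫⁻ x, ENNReal.ofReal (|x| ^ (-(1 / 3) : ℝ)) * f x ≤ ∫⁻ x, ∫⁻ r, k x r := by
    rw [← lintegral_const_mul _ (by fun_prop)]
    refine lintegral_mono_ae ?_
    have h0 : ∀ᵐ x : ℝ, x ≠ 0 := by simp [ae_iff]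
    filter_upwards [h0] with x hx
    have : ∀ r, k x r = (Set.Ioi |x|).indicator
        (fun r => ENNReal.ofReal (r ^ (-(4 / 3) : ℝ)) * f x) r := fun r => by
      simp [hk, Set.indicator]
    simp_rw [this]
    rw [lintegral_indicator measurableSet_Ioi, lintegral_mul_const _ (by fun_prop),
      lintegral_Ioi_rpow (abs_pos.2 hx), ENNReal.ofReal_mul (by norm_num), ENNReal.ofReal_ofNat,
      mul_assoc]
  have h2 : ∀ r, ∫⁻ x, k x r ≤ ∑ a ∈ s, ‖c a‖ₑ ^ 2 *
      (32 * ENNReal.ofReal (oscEig a ^ (1 / 4 : ℝ)) * (Set.Ioc 0 (oscEig a ^ (-(1 / 2) : ℝ))).indicator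
          (fun r => ENNReal.ofReal (r ^ (-(5 / 6) : ℝ))) r
        + 2 * (Set.Ici (oscEig a ^ (-(1 / 2) : ℝ))).indicator
          (fun r => ENNReal.ofReal (r ^ (-(4 / 3) : ℝ))) r) := by
    intro r
    rcases le_or_gt r 0 with hr | hr
    · have : ∀ x, k x r = 0 := fun x => by
        simp only [hk]; rw [if_neg (not_lt.2 (hr.trans (abs_nonneg x)))]
      simp [this]
    have e : ∀ x, k x r = {x : ℝ | |x| < r}.indicator
        (fun x => ENNReal.ofReal (r ^ (-(4 / 3) : ℝ)) * f x) x := fun x => by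
      simp [hk, Set.indicator]
    simp_rw [e]
    rw [lintegral_indicator (measurableSet_lt (by fun_prop) measurable_const),
      lintegral_const_mul _ hfm]
    refine (mul_le_mul_right (lintegral_ball_sum_hermFun_le hr s c) _).trans ?_
    rw [Finset.mul_sum]
    refine Finset.sum_le_sum fun a _ => ?_
    rw [mul_left_comm]
    gcongr
    split_ifs with h
    · rw [Set.indicator_of_mem (show r ∈ Set.Ioc 0 _ from ⟨hr, h.le⟩),
        Set.indicator_of_notMem (by simpa using h), mul_zero, add_zero, mul_left_comm,
        ← ENNReal.ofReal_mul (by positivity), ← Real.rpow_add hr]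
      norm_num
    · rw [Set.indicator_of_mem (show r ∈ Set.Ici _ from not_lt.1 h), mul_comm]
      exact le_add_self
  have h3 : ∫⁻ r, ∫⁻ x, k x r ≤ ∑ a ∈ s, ‖c a‖ₑ ^ 2 *
      (198 * ENNReal.ofReal (oscEig a ^ (1 / 6 : ℝ))) := by
    refine (lintegral_mono h2).trans ?_
    have mI : ∀ (q R : ℝ), Measurable ((Set.Ioc 0 R).indicator fun r : ℝ => ENNReal.ofReal (r ^ q)) :=
      fun q R => (by fun_prop : Measurable fun r : ℝ => ENNReal.ofReal (r ^ q)).indicator measurableSet_Ioc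
    have mJ : ∀ (q R : ℝ), Measurable ((Set.Ici R).indicator fun r : ℝ => ENNReal.ofReal (r ^ q)) :=
      fun q R => (by fun_prop : Measurable fun r : ℝ => ENNReal.ofReal (r ^ q)).indicator measurableSet_Ici
    rw [lintegral_finsetSum _ fun a _ => by
      exact (((mI _ _).const_mul _).add ((mJ _ _).const_mul _)).const_mul _]
    refine Finset.sum_le_sum fun a _ => ?_
    rw [lintegral_const_mul _ (by exact ((mI _ _).const_mul _).add ((mJ _ _).const_mul _))]
    gcongr
    have hR : 0 < oscEig a ^ (-(1 / 2) : ℝ) := oscEig_rpow_pos a _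
    rw [lintegral_add_left ((mI _ _).const_mul _), lintegral_const_mul _ (mI _ _),
      lintegral_const_mul _ (mJ _ _), lintegral_indicator measurableSet_Ioc,
      lintegral_indicator measurableSet_Ici, setLIntegral_congr Ioi_ae_eq_Ici.symm,
      lintegral_Ioi_rpow hR, lintegral_Ioc_rpow hR, ← Real.rpow_mul (oscEig_pos a).le,
      ← Real.rpow_mul (oscEig_pos a).le]
    have e32 : (32 : ℝ≥0∞) = ENNReal.ofReal 32 := by norm_num
    have e2 : (2 : ℝ≥0∞) = ENNReal.ofReal 2 := by norm_num
    have e198 : (198 : ℝ≥0∞) = ENNReal.ofReal 198 := by norm_num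
    have p1 := (oscEig_rpow_pos a (1 / 4)).le
    have p2 := (oscEig_rpow_pos a (-(1 / 2) * (1 / 6))).le
    have p3 := (oscEig_rpow_pos a (-(1 / 2) * -(1 / 3))).le
    rw [e32, e2, e198, ← ENNReal.ofReal_mul (by positivity), ← ENNReal.ofReal_mul (by positivity),
      ← ENNReal.ofReal_mul (by positivity), ← ENNReal.ofReal_mul (by positivity),
      ← ENNReal.ofReal_add (by positivity) (by positivity)]
    refine ENNReal.ofReal_le_ofReal (le_of_eq ?_)
    have q1 : oscEig a ^ (1 / 4 : ℝ) * oscEig a ^ (-(1 / 2) * (1 / 6) : ℝ) = oscEig a ^ (1 / 6 : ℝ) := by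
      rw [← Real.rpow_add (oscEig_pos a)]; norm_num
    have q2 : oscEig a ^ (-(1 / 2) * -(1 / 3) : ℝ) = oscEig a ^ (1 / 6 : ℝ) := by norm_num
    rw [q2, ← q1]
    ring
  rw [lintegral_lintegral_swap hkm.aemeasurable] at h1
  have h4 := h1.trans h3
  have h5 : ∑ a ∈ s, ‖c a‖ₑ ^ 2 * (198 * ENNReal.ofReal (oscEig a ^ (1 / 6 : ℝ)))
      = 3 * ∑ a ∈ s, 66 * ENNReal.ofReal (oscEig a ^ (1 / 6 : ℝ)) * ‖c a‖ₑ ^ 2 := by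
    rw [Finset.mul_sum]
    refine Finset.sum_congr rfl fun a _ => ?_
    rw [show (198 : ℝ≥0∞) = 3 * 66 by norm_num]
    ring
  rw [h5] at h4
  exact (ENNReal.mul_le_mul_iff_right (by norm_num) (by norm_num)).1 h4

/-! ### Hermite modes of particles and kernels -/

/-- Labels of the Hermite modes of one particle. -/
abbrev Mode : Type := (Fin 3 → ℕ) × Fin 2

/-- The Hermite modes of one particle. -/
noncomputable def particleMode (a : Mode) (ξ : Particle) : ℝ :=
  (∏ j, hermFun (a.1 j) (ξ.1 j)) * if ξ.2 = a.2 then 1 else 0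

/-- The product of the eigenvalues of the three oscillators in a mode. -/
noncomputable def modeEig (a : Mode) : ℝ := ∏ j, oscEig (a.1 j)

/-- The Hermite modes of kernels. -/
noncomputable def kernelMode {n : ℕ} (α : Fin n → Mode) (ξ : Fin n → Particle) : ℝ :=
  ∏ i, particleMode (α i) (ξ i)

theorem one_le_modeEig (a : Mode) : 1 ≤ modeEig a := by
  unfold modeEig
  exact Finset.one_le_prod fun j _ => one_le_oscEig _

theorem modeEig_pos (a : Mode) : 0 < modeEig a := one_pos.trans_le (one_le_modeEig a)

theorem isModeSystem_spin :
    IsModeSystem (Measure.count : Measure (Fin 2)) fun τ σ => if σ = τ then (1 : ℝ) else 0 where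
  measurable _ := measurable_of_finite _
  memLp _ := MemLp.of_discrete
  integral_mul_self a := by
    rw [integral_count]; fin_cases a <;> simp
  integral_mul a b hab := by
    rw [integral_count]
    refine Finset.sum_eq_zero fun x _ => ?_
    by_cases hx : x = a
    · subst hx; rw [if_neg hab, mul_zero]
    · rw [if_neg hx, zero_mul]
  complete G _ h := by
    refine Filter.Eventually.of_forall fun x => ?_
    have := h x
    rw [integral_count] at this
    rw [Finset.sum_eq_single x (fun y _ hy => by simp [hy]) (fun h => absurd (Finset.mem_univ _) h)] at this
    simpa using this

theorem isModeSystem_particleMode : IsModeSystem particleMeasure particleMode :=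
  (IsModeSystem.pi (fun _ : Fin 3 => (volume : Measure ℝ)) (u := fun _ => hermFun)
    fun _ => isModeSystem_hermFun).prod isModeSystem_spin

theorem isModeSystem_kernelMode (n : ℕ) : IsModeSystem (kernelMeasure n) (kernelMode (n := n)) :=
  IsModeSystem.pi (fun _ => particleMeasure) (u := fun _ => particleMode)
    fun _ => isModeSystem_particleMode

/-! ### Form bounds for the inverse dispersion relation. -/

theorem measurable_omega (m : ℝ) : Measurable (omega m) := by
  unfold omega; fun_prop

theorem ae_particle_ne_zero (j : Fin 3) : ∀ᵐ ξ ∂particleMeasure, ξ.1 j ≠ 0 := by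
  have h1 : ∀ᵐ k : Fin 3 → ℝ, k j ≠ 0 :=
    (Measure.quasiMeasurePreserving_eval (μ := fun _ : Fin 3 => (volume : Measure ℝ)) j).ae
      (by simp [ae_iff] : ∀ᵐ x : ℝ, x ≠ 0)
  exact (Measure.quasiMeasurePreserving_fst (μ := (volume : Measure (Fin 3 → ℝ)))
    (ν := (Measure.count : Measure (Fin 2)))).ae h1

theorem abs_le_omega (m : ℝ) (ξ : Particle) (j : Fin 3) : |ξ.1 j| ≤ omega m ξ := by
  unfold omega
  rw [← Real.sqrt_sq_eq_abs]
  refine Real.sqrt_le_sqrt ?_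
  have := Finset.single_le_sum (f := fun j => ξ.1 j ^ 2) (fun i _ => sq_nonneg _) (Finset.mem_univ j)
  have h2 := sq_nonneg m
  linarith

theorem mass_le_omega (m : ℝ) (ξ : Particle) : m ≤ omega m ξ := by
  unfold omega
  refine Real.le_sqrt_of_sq_le ?_
  have : 0 ≤ ∑ j, ξ.1 j ^ 2 := Finset.sum_nonneg fun j _ => sq_nonneg _
  linarith

theorem omega_nonneg (m : ℝ) (ξ : Particle) : 0 ≤ omega m ξ := Real.sqrt_nonneg _

theorem ae_omega_pos (m : ℝ) : ∀ᵐ ξ ∂particleMeasure, 0 < omega m ξ := by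
  filter_upwards [ae_particle_ne_zero 0] with ξ hξ
  exact (abs_pos.2 hξ).trans_le (abs_le_omega m ξ 0)

/-- The exponent of the oscillators that controls `ω⁻¹`. -/
noncomputable def massExponent (m : ℝ) : ℝ := if 0 < m then 0 else 1 / 6

/-- Since ω ≥ |kⱼ| for all three j, ω⁻¹ ≤ ∏ⱼ|kⱼ|^{-1/3}, a product weight to which the
one-dimensional bound tensorizes. -/
theorem weightedBound_massless (m : ℝ) :
    WeightedBound particleMeasure particleMode (fun ξ => (ENNReal.ofReal (omega m ξ))⁻¹)
      (fun a => 66 ^ 3 * ENNReal.ofReal (modeEig a ^ (1 / 6 : ℝ))) := by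
  have hm1 : Measurable fun x : ℝ => ENNReal.ofReal (|x| ^ (-(1 / 3) : ℝ)) := by fun_prop
  have h := (WeightedBound.pi (fun _ : Fin 3 => (volume : Measure ℝ)) (u := fun _ => hermFun)
    (fun _ => isModeSystem_hermFun.measurable) (fun _ => hm1)
    fun _ => weightedBound_hermFun).prod
    (fun a => (IsModeSystem.pi (fun _ : Fin 3 => (volume : Measure ℝ)) (u := fun _ => hermFun)
      fun _ => isModeSystem_hermFun).measurable a) isModeSystem_spin.measurable
    (by exact Finset.measurable_prod _ fun i _ => hm1.comp (measurable_pi_apply i)) measurable_const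
    isModeSystem_spin.weightedBound_one
  have h2 := h.mono (w' := fun ξ => (ENNReal.ofReal (omega m ξ))⁻¹) (by
    filter_upwards [ae_particle_ne_zero 0, ae_particle_ne_zero 1, ae_particle_ne_zero 2, ae_omega_pos m]
      with ξ h0 h1 h2 hω
    have hpos : ∀ j, 0 < |ξ.1 j| := fun j => by
      fin_cases j
      · exact abs_pos.2 h0
      · exact abs_pos.2 h1
      · exact abs_pos.2 h2
    simp only [mul_one]
    rw [← ENNReal.ofReal_prod_of_nonneg fun j _ => by positivity, ← ENNReal.ofReal_inv_of_pos hω]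
    refine ENNReal.ofReal_le_ofReal ?_
    have e : (omega m ξ)⁻¹ = ∏ _j : Fin 3, omega m ξ ^ (-(1 / 3) : ℝ) := by
      rw [Finset.prod_const, ← Real.rpow_natCast, ← Real.rpow_mul hω.le]
      simp [Real.rpow_neg_one]
    rw [e]
    exact Finset.prod_le_prod (fun j _ => by positivity) fun j _ =>
      Real.rpow_le_rpow_of_nonpos (hpos j) (abs_le_omega m ξ j) (by norm_num))
  refine fun s c => (h2 s c).trans_eq (Finset.sum_congr rfl fun a _ => ?_)
  congr 1
  beta_reduce
  rw [mul_one, Finset.prod_mul_distrib, Finset.prod_const, modeEig,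
    ← ENNReal.ofReal_prod_of_nonneg fun j _ => (oscEig_rpow_pos _ _).le,
    Real.finsetProd_rpow _ _ fun j _ => (oscEig_pos _).le]
  simp

theorem weightedBound_massive {m : ℝ} (hm : 0 < m) :
    WeightedBound particleMeasure particleMode (fun ξ => (ENNReal.ofReal (omega m ξ))⁻¹)
      (fun _ => ENNReal.ofReal m⁻¹) := by
  have h := isModeSystem_particleMode.weightedBound_one.const_mul
    (K := ENNReal.ofReal m⁻¹) ENNReal.ofReal_ne_top
  simp only [mul_one] at h
  refine h.mono (Filter.Eventually.of_forall fun ξ => ?_)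
  rw [ENNReal.ofReal_inv_of_pos hm]
  exact ENNReal.inv_le_inv.2 (ENNReal.ofReal_le_ofReal (mass_le_omega m ξ))

theorem exists_weightedBound_omega (m : ℝ) : ∃ K : ℝ, 0 < K ∧
    WeightedBound particleMeasure particleMode (fun ξ => (ENNReal.ofReal (omega m ξ))⁻¹)
      (fun a => ENNReal.ofReal (K * modeEig a ^ massExponent m)) := by
  by_cases hm : 0 < m
  · refine ⟨m⁻¹, by positivity, ?_⟩
    simpa [massExponent, hm] using weightedBound_massive hm
  · refine ⟨66 ^ 3, by norm_num, ?_⟩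
    have := weightedBound_massless m
    simp only [massExponent, if_neg hm]
    refine fun s c => (this s c).trans_eq (Finset.sum_congr rfl fun a _ => ?_)
    beta_reduce
    rw [ENNReal.ofReal_mul (by norm_num), ENNReal.ofReal_pow (by norm_num), ENNReal.ofReal_ofNat]

/-! ### Summability of the inverse eigenvalues -/

/-- A finite set of tuples lies in a box, over which the sum of products factorizes. -/
theorem sum_prod_le_prod {ι κ : Type*} [Fintype ι] [DecidableEq ι] {f : κ → ℝ} (hf : ∀ a, 0 ≤ f a)
    {D : ℝ} (hD : ∀ s : Finset κ, ∑ a ∈ s, f a ≤ D) (b : Finset (ι → κ)) :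
    ∑ β ∈ b, ∏ i, f (β i) ≤ D ^ Fintype.card ι := by
  classical
  have hsub : b ⊆ Fintype.piFinset fun i => b.image (· i) := fun β hβ =>
    Fintype.mem_piFinset.2 fun i => Finset.mem_image_of_mem (· i) hβ
  calc _ ≤ ∑ β ∈ Fintype.piFinset fun i => b.image (· i), ∏ i, f (β i) :=
        Finset.sum_le_sum_of_subset_of_nonneg hsub fun β _ _ => Finset.prod_nonneg fun i _ => hf _
    _ = ∏ i, ∑ a ∈ b.image (· i), f a := (Finset.prod_univ_sum _ fun _ a => f a).symm
    _ ≤ ∏ _i : ι, D := Finset.prod_le_prod (fun i _ => Finset.sum_nonneg fun a _ => hf a) fun i _ => hD _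
    _ = _ := by simp

theorem exists_sum_oscEig_le {s : ℝ} (hs : 1 / 2 < s) :
    ∃ D : ℝ, ∀ b : Finset ℕ, ∑ a ∈ b, oscEig a ^ (-(2 * s)) ≤ D := by
  have h : Summable fun a : ℕ => oscEig a ^ (-(2 * s)) := by
    have h1 : Summable fun a : ℕ => ((a + 1 : ℕ) : ℝ) ^ (-(2 * s)) :=
      (summable_nat_add_iff 1).2 (Real.summable_nat_rpow.2 (by linarith))
    refine Summable.of_nonneg_of_le (fun a => (oscEig_rpow_pos a _).le) (fun a => ?_) h1
    refine Real.rpow_le_rpow_of_nonpos (by positivity) ?_ (by linarith)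
    unfold oscEig
    have : (0 : ℝ) ≤ a := a.cast_nonneg
    push_cast
    linarith
  exact ⟨_, fun b => h.sum_le_tsum b fun a _ => (oscEig_rpow_pos a _).le⟩

theorem exists_sum_modeEig_le {s : ℝ} (hs : 1 / 2 < s) :
    ∃ D : ℝ, ∀ b : Finset Mode, ∑ a ∈ b, modeEig a ^ (-(2 * s)) ≤ D := by
  classical
  obtain ⟨D, hD⟩ := exists_sum_oscEig_le hs
  refine ⟨D ^ 3 * 2, fun b => ?_⟩
  have hsub : b ⊆ b.image Prod.fst ×ˢ Finset.univ := fun α hα =>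
    Finset.mem_product.2 ⟨Finset.mem_image_of_mem _ hα, Finset.mem_univ _⟩
  have h1 := sum_prod_le_prod (ι := Fin 3) (fun a => (oscEig_rpow_pos a (-(2 * s))).le) hD (b.image Prod.fst)
  calc _ ≤ ∑ a ∈ b.image Prod.fst ×ˢ (Finset.univ : Finset (Fin 2)), modeEig a ^ (-(2 * s)) :=
        Finset.sum_le_sum_of_subset_of_nonneg hsub fun β _ _ => Real.rpow_nonneg (modeEig_pos β).le _
    _ = (∑ a ∈ b.image Prod.fst, ∏ j, oscEig (a j) ^ (-(2 * s))) * 2 := by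
        rw [Finset.sum_product, Finset.sum_mul]
        refine Finset.sum_congr rfl fun a _ => ?_
        simp only [modeEig, Finset.sum_const, Finset.card_univ, Fintype.card_fin, nsmul_eq_mul]
        rw [Real.finsetProd_rpow _ _ fun j _ => (oscEig_pos _).le]
        push_cast; ring
    _ ≤ _ := by
        simp only [Fintype.card_fin] at h1
        linarith

theorem exists_sum_prod_modeEig_le {s : ℝ} (hs : 1 / 2 < s) (n : ℕ) :
    ∃ D : ℝ, 0 < D ∧ ∀ b : Finset (Fin n → Mode), ∑ β ∈ b, ∏ j, modeEig (β j) ^ (-(2 * s)) ≤ D := by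
  obtain ⟨D, hD⟩ := exists_sum_modeEig_le hs
  refine ⟨D ^ n + 1, ?_, fun b => ?_⟩
  · have : 0 ≤ D := by simpa using hD ∅
    positivity
  · have := sum_prod_le_prod (ι := Fin n) (fun a => (Real.rpow_nonneg (modeEig_pos a).le (-(2 * s)))) hD b
    simp only [Fintype.card_fin] at this
    linarith

/-! ### An interpolation inequality for finite sums -/

/-- An elementary substitute for complex interpolation. The bound for all multipliers γ is dual to ∑
x² ≤ B² for x = |τ|/(μN). Then |τ| = |τ|^θ |τ|^{1-θ} ≤ (AN)^θ (xμN)^{1-θ}. After inserting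
R^{-θ}R^θ, Cauchy–Schwarz leaves the sum of x^{2(1-θ)} R^{-2θ}, which Hölder's inequality bounds by
(D^θ B^{1-θ})². -/
theorem norm_sum_le_interpolation {κ : Type*} (b : Finset κ) (τ : κ → ℂ) (N μ R : κ → ℝ)
    {A B D θ : ℝ} (hN : ∀ β, 0 ≤ N β) (hμ : ∀ β, 0 < μ β) (hR : ∀ β, 0 < R β) (hA : 0 ≤ A)
    (hB : 0 < B) (hD : 0 < D) (hθ₀ : 0 ≤ θ) (hθ₁ : θ ≤ 1)
    (hτ : ∀ β ∈ b, ‖τ β‖ ≤ A * N β)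
    (hγ : ∀ γ : κ → ℂ, ‖∑ β ∈ b, γ β * τ β‖ ≤ B * √(∑ β ∈ b, (‖γ β‖ * (μ β * N β)) ^ 2))
    (hRD : ∑ β ∈ b, (R β ^ 2)⁻¹ ≤ D ^ 2) :
    ‖∑ β ∈ b, τ β‖ ≤ D ^ θ * A ^ θ * B ^ (1 - θ)
      * √(∑ β ∈ b, (N β * (R β ^ θ * μ β ^ (1 - θ))) ^ 2) := by
  set x : κ → ℝ := fun β => ‖τ β‖ / (μ β * N β) with hx
  have hx0 : ∀ β, 0 ≤ x β := fun β => div_nonneg (norm_nonneg _) (mul_nonneg (hμ β).le (hN β))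
  have hτx : ∀ β ∈ b, ‖τ β‖ = x β * (μ β * N β) := fun β hβ => by
    -- If N β = 0 then τ β = 0 by the first bound, so the convention for division by zero in x is
    -- harmless.
    rcases (hN β).eq_or_lt with h | h
    · have := hτ β hβ
      rw [← h, mul_zero] at this
      rw [← h, mul_zero, mul_zero]
      exact le_antisymm this (norm_nonneg _)
    · simp only [hx]
      rw [div_mul_cancel₀ _ (mul_pos (hμ β) h).ne']
  have hsum : ∑ β ∈ b, x β ^ 2 ≤ B ^ 2 := by
    -- The extremal multiplier: it makes both sides of the bound expressions in ∑ x².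
    have h := hγ fun β => conj (τ β) / ((μ β * N β : ℝ) : ℂ) ^ 2
    have e1 : ∑ β ∈ b, conj (τ β) / ((μ β * N β : ℝ) : ℂ) ^ 2 * τ β
        = ((∑ β ∈ b, x β ^ 2 : ℝ) : ℂ) := by
      push_cast
      refine Finset.sum_congr rfl fun β _ => ?_
      rw [div_mul_eq_mul_div, Complex.conj_mul']
      simp only [hx]
      push_cast
      rw [div_pow]
    have e2 : ∀ β ∈ b, (‖conj (τ β) / ((μ β * N β : ℝ) : ℂ) ^ 2‖ * (μ β * N β)) ^ 2 = x β ^ 2 := by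
      intro β hβ
      have hp := mul_nonneg (hμ β).le (hN β)
      rw [norm_div, norm_pow, Complex.norm_real, Real.norm_of_nonneg hp, RCLike.norm_conj]
      rcases hp.eq_or_lt with h | h
      · simp [hx, ← h]
      · simp only [hx]
        congr 1
        field_simp
    rw [e1, Finset.sum_congr rfl e2] at h
    set Q := ∑ β ∈ b, x β ^ 2
    have hQ : 0 ≤ Q := Finset.sum_nonneg fun β _ => sq_nonneg _
    rw [Complex.norm_real, Real.norm_of_nonneg hQ] at h
    rcases hQ.eq_or_lt with h0 | h0
    · rw [← h0]; positivity
    · have h1 : √Q ≤ B := by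
        have h2 := Real.mul_self_sqrt hQ
        have h3 := Real.sqrt_pos.2 h0
        nlinarith
      calc Q = √Q ^ 2 := (Real.sq_sqrt hQ).symm
        _ ≤ _ := by gcongr
  have hpt : ∀ β ∈ b, ‖τ β‖ ≤ A ^ θ * ((x β ^ (1 - θ) * (R β)⁻¹ ^ θ) *
      (N β * (R β ^ θ * μ β ^ (1 - θ)))) := by
    intro β hβ
    have e1 : ‖τ β‖ = ‖τ β‖ ^ θ * ‖τ β‖ ^ (1 - θ) := by
      rw [← Real.rpow_add_of_nonneg (norm_nonneg _) hθ₀ (by linarith)]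
      simp
    have e2 : N β = N β ^ θ * N β ^ (1 - θ) := by
      rw [← Real.rpow_add_of_nonneg (hN β) hθ₀ (by linarith)]
      simp
    have e3 : (R β)⁻¹ ^ θ * R β ^ θ = 1 := by
      rw [← Real.mul_rpow (inv_nonneg.2 (hR β).le) (hR β).le, inv_mul_cancel₀ (hR β).ne', Real.one_rpow]
    calc ‖τ β‖ = ‖τ β‖ ^ θ * ‖τ β‖ ^ (1 - θ) := e1
      _ ≤ (A * N β) ^ θ * (x β * (μ β * N β)) ^ (1 - θ) := by
          have := mul_nonneg hA (hN β)
          have h1 := Real.rpow_le_rpow (norm_nonneg _) (hτ β hβ) hθ₀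
          rw [← hτx β hβ]
          exact mul_le_mul_of_nonneg_right h1 (by positivity)
      _ = A ^ θ * (x β ^ (1 - θ) * ((R β)⁻¹ ^ θ * R β ^ θ) * ((N β ^ θ * N β ^ (1 - θ)) * μ β ^ (1 - θ))) := by
          rw [Real.mul_rpow hA (hN β), Real.mul_rpow (hx0 β) (mul_nonneg (hμ β).le (hN β)),
            Real.mul_rpow (hμ β).le (hN β), e3]
          ring
      _ = _ := by rw [← e2]; ring
  clear_value x
  have hH : ∑ β ∈ b, (x β ^ (1 - θ) * (R β)⁻¹ ^ θ) ^ 2 ≤ (D ^ θ * B ^ (1 - θ)) ^ 2 := by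
    have h1 : ∀ β ∈ b, (x β ^ (1 - θ) * (R β)⁻¹ ^ θ) ^ 2
        ≤ (D ^ θ * B ^ (1 - θ)) ^ 2 * (θ * ((R β ^ 2)⁻¹ / D ^ 2) + (1 - θ) * (x β ^ 2 / B ^ 2)) := by
      intro β _
      -- Hölder's inequality by weighted arithmetic and geometric means, after normalizing the two
      -- sums by D² and B²; this also covers θ = 0 and θ = 1.
      have h2 := Real.geom_mean_le_arith_mean2_weighted hθ₀ (sub_nonneg.2 hθ₁)
        (div_nonneg (inv_nonneg.2 (sq_nonneg (R β))) (sq_nonneg D))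
        (div_nonneg (sq_nonneg (x β)) (sq_nonneg B)) (by ring)
      refine le_trans (le_of_eq ?_) (mul_le_mul_of_nonneg_left h2 (sq_nonneg _))
      have hsq : ∀ {y : ℝ} (q : ℝ), 0 ≤ y → (y ^ q) ^ 2 = (y ^ 2) ^ q := fun {y} q hy => by
        rw [← Real.rpow_natCast, ← Real.rpow_natCast, ← Real.rpow_mul hy, ← Real.rpow_mul hy, mul_comm]
      rw [Real.div_rpow (by positivity) (by positivity), Real.div_rpow (by positivity) (by positivity),
        mul_pow, mul_pow, hsq _ (hx0 β), hsq _ (inv_nonneg.2 (hR β).le), hsq _ hD.le, hsq _ hB.le, inv_pow]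
      have p1 : (0 : ℝ) < (D ^ 2) ^ θ := by positivity
      have p2 : (0 : ℝ) < (B ^ 2) ^ (1 - θ) := by positivity
      field_simp
    refine (Finset.sum_le_sum h1).trans ?_
    rw [← Finset.mul_sum]
    refine mul_le_of_le_one_right (sq_nonneg _) ?_
    rw [Finset.sum_add_distrib, ← Finset.mul_sum, ← Finset.mul_sum, ← Finset.sum_div, ← Finset.sum_div]
    have q1 : (∑ β ∈ b, (R β ^ 2)⁻¹) / D ^ 2 ≤ 1 := (div_le_one (by positivity)).2 hRD
    have q2 : (∑ β ∈ b, x β ^ 2) / B ^ 2 ≤ 1 := (div_le_one (by positivity)).2 hsum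
    nlinarith
  calc ‖∑ β ∈ b, τ β‖ ≤ ∑ β ∈ b, A ^ θ * ((x β ^ (1 - θ) * (R β)⁻¹ ^ θ) *
        (N β * (R β ^ θ * μ β ^ (1 - θ)))) := (norm_sum_le _ _).trans (Finset.sum_le_sum hpt)
    _ = A ^ θ * ∑ β ∈ b, (x β ^ (1 - θ) * (R β)⁻¹ ^ θ) * (N β * (R β ^ θ * μ β ^ (1 - θ))) := by
        rw [Finset.mul_sum]
    _ ≤ A ^ θ * (√(∑ β ∈ b, (x β ^ (1 - θ) * (R β)⁻¹ ^ θ) ^ 2)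
          * √(∑ β ∈ b, (N β * (R β ^ θ * μ β ^ (1 - θ))) ^ 2)) := by
        gcongr
        exact Real.sum_mul_le_sqrt_mul_sqrt _ _ _
    _ ≤ A ^ θ * ((D ^ θ * B ^ (1 - θ)) * √(∑ β ∈ b, (N β * (R β ^ θ * μ β ^ (1 - θ))) ^ 2)) := by
        gcongr
        exact Real.sqrt_le_iff.2 ⟨by positivity, hH⟩
    _ = _ := by ring

/-! ### Expansions in a complete orthonormal system -/

section Expansion

variable {X ι : Type*} [MeasurableSpace X] {μ : Measure X} {u : ι → X → ℝ}

/-- The modes as vectors of `L²`. -/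
noncomputable def IsModeSystem.toLp (hu : IsModeSystem μ u) (a : ι) : Lp ℂ 2 μ :=
  MemLp.toLp (fun x => (u a x : ℂ)) (hu.memLp a).ofReal

theorem IsModeSystem.coeFn_toLp (hu : IsModeSystem μ u) (a : ι) :
    hu.toLp a =ᵐ[μ] fun x => (u a x : ℂ) := MemLp.coeFn_toLp _

theorem IsModeSystem.inner_toLp (hu : IsModeSystem μ u) (a : ι) (G : Lp ℂ 2 μ) :
    inner ℂ (hu.toLp a) G = ∫ x, (u a x : ℂ) * G x ∂μ := by
  rw [L2.inner_def]
  refine integral_congr_ae ?_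
  filter_upwards [hu.coeFn_toLp a] with x hx
  rw [hx, RCLike.inner_apply, Complex.conj_ofReal, mul_comm]

theorem IsModeSystem.orthonormal (hu : IsModeSystem μ u) : Orthonormal ℂ hu.toLp := by
  have h : ∀ a b, inner ℂ (hu.toLp a) (hu.toLp b) = ((∫ x, u a x * u b x ∂μ : ℝ) : ℂ) := fun a b => by
    rw [hu.inner_toLp, ← integral_complex_ofReal]
    refine integral_congr_ae ?_
    filter_upwards [hu.coeFn_toLp b] with x hx
    rw [hx]; push_cast; rfl
  classical
  rw [orthonormal_iff_ite]
  intro a b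
  rw [h]
  split_ifs with hab
  · rw [hab, hu.integral_mul_self]; simp
  · rw [hu.integral_mul _ _ hab]; simp

theorem IsModeSystem.hasSum (hu : IsModeSystem μ u) (G : Lp ℂ 2 μ) :
    HasSum (fun a => (∫ x, (u a x : ℂ) * G x ∂μ) • hu.toLp a) G := by
  have hbot : (Submodule.span ℂ (Set.range hu.toLp))ᗮ = ⊥ := by
    rw [Submodule.eq_bot_iff]
    intro F hF
    rw [Submodule.mem_orthogonal] at hF
    have h0 : ∀ a, ∫ x, (u a x : ℂ) * F x ∂μ = 0 := fun a => by
      rw [← hu.inner_toLp]; exact hF _ (Submodule.subset_span ⟨a, rfl⟩)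
    exact Lp.ext ((hu.complete _ (Lp.memLp F) h0).trans (Lp.coeFn_zero ℂ 2 μ).symm)
  have h := (HilbertBasis.mkOfOrthogonalEqBot hu.orthonormal hbot).hasSum_repr G
  simpa [HilbertBasis.repr_apply_apply, hu.inner_toLp] using h

theorem IsModeSystem.sum_norm_sq_le (hu : IsModeSystem μ u) (G : Lp ℂ 2 μ) (s : Finset ι) :
    ∑ a ∈ s, ‖∫ x, (u a x : ℂ) * G x ∂μ‖ ^ 2 ≤ ‖G‖ ^ 2 := by
  simpa [hu.inner_toLp] using hu.orthonormal.sum_inner_products_le G (s := s)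

/-- The norm of `L²`, for functions. -/
noncomputable def l2Norm {X : Type*} [MeasurableSpace X] (μ : Measure X) (f : X → ℂ) : ℝ :=
  √(sqInt μ f).toReal

theorem l2Norm_nonneg (f : X → ℂ) : 0 ≤ l2Norm μ f := Real.sqrt_nonneg _

theorem l2Norm_eq_norm (G : Lp ℂ 2 μ) : l2Norm μ G = ‖G‖ := by
  rw [l2Norm, sqInt_eq_ofReal (Lp.memLp G), ENNReal.toReal_ofReal (integral_nonneg fun x => by positivity)]
  rw [eq_comm, ← Real.sqrt_sq (norm_nonneg G)]
  congr 1
  have h1 := L2.inner_def (𝕜 := ℂ) G G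
  have h2 := inner_self_eq_norm_sq_to_K (𝕜 := ℂ) G
  rw [h1] at h2
  have h3 : ∫ x, inner ℂ (G x) (G x) ∂μ = ((∫ x, ‖G x‖ ^ 2 ∂μ : ℝ) : ℂ) := by
    rw [← integral_complex_ofReal]
    congr 1 with x
    rw [inner_self_eq_norm_sq_to_K]
    push_cast; rfl
  rw [h3] at h2
  exact (Complex.ofReal_injective (h2.trans (Complex.ofReal_pow _ _).symm)).symm

theorem l2Norm_congr {f g : X → ℂ} (h : f =ᵐ[μ] g) : l2Norm μ f = l2Norm μ g := by
  unfold l2Norm sqInt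
  rw [lintegral_congr_ae (by filter_upwards [h] with x hx; rw [hx])]

theorem IsModeSystem.exists_approx (hu : IsModeSystem μ u) (G : Lp ℂ 2 μ) {ε : ℝ} (hε : 0 < ε) :
    ∃ s : Finset ι, l2Norm μ (fun x => G x - ∑ a ∈ s, (∫ x, (u a x : ℂ) * G x ∂μ) * (u a x : ℂ)) < ε := by
  have h := (Metric.tendsto_nhds.1 (hu.hasSum G)) ε hε
  simp only [SummationFilter.unconditional_filter] at h
  obtain ⟨s, hs⟩ := h.exists
  refine ⟨s, ?_⟩
  rw [dist_comm, dist_eq_norm, ← l2Norm_eq_norm] at hs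
  refine lt_of_eq_of_lt (l2Norm_congr ?_) hs
  have h2 : ∀ᵐ x ∂μ, ∀ a ∈ s, ((∫ x, (u a x : ℂ) * G x ∂μ) • hu.toLp a : Lp ℂ 2 μ) x
      = (∫ x, (u a x : ℂ) * G x ∂μ) * (u a x : ℂ) := by
    rw [Finset.eventually_all]
    intro a _
    filter_upwards [Lp.coeFn_smul (∫ x, (u a x : ℂ) * G x ∂μ) (hu.toLp a), hu.coeFn_toLp a] with x h1 h2
    rw [h1, Pi.smul_apply, h2, smul_eq_mul]
  filter_upwards [h2, Lp.coeFn_sub G (∑ a ∈ s, (∫ x, (u a x : ℂ) * G x ∂μ) • hu.toLp a),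
    Lp.coeFn_finsetSum s fun a => (∫ x, (u a x : ℂ) * G x ∂μ) • hu.toLp a] with x h3 h4 h5
  rw [h4, Pi.sub_apply, h5, Finset.sum_apply, Finset.sum_congr rfl h3]

theorem sqrt_toReal_mul_le {a b : ℝ≥0∞} {x : ℂ} (h : a * ‖x‖ₑ ^ 2 ≤ b) (hb : b ≠ ⊤) :
    √a.toReal * ‖x‖ ≤ √b.toReal := by
  have h1 := ENNReal.toReal_mono hb h
  rw [ENNReal.toReal_mul, ENNReal.toReal_pow, toReal_enorm] at h1
  rw [← Real.sqrt_sq (norm_nonneg x), ← Real.sqrt_mul ENNReal.toReal_nonneg]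
  exact Real.sqrt_le_sqrt h1

end Expansion

/-! ### The form in one sector -/

/-- A measurable, antisymmetric and square integrable wave function. -/
structure IsWave {n : ℕ} {l : Fin n → ℕ} (f : Config l → ℂ) : Prop where
  measurable : Measurable f
  antisymm : IsAntisymmConfig f
  lt_top : sqInt (configMeasure l) f < ⊤

/-- The contribution of a sector to the interaction, without its combinatorial factor. -/
noncomputable def sectorForm {n : ℕ} (l : Fin n → ℕ) (S R : Fin n → Bool)
    (G : (Fin n → Particle) → ℂ) (f : Config (addOcc S l) → ℂ) (g : Config (addOcc R l) → ℂ) : ℂ :=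
  ∫ z : (Fin n → Particle) × Config l, G z.1 * (f (insertFor S z.1 z.2) * g (insertFor R z.1 z.2))
    ∂((kernelMeasure n).prod (configMeasure l))

/-- The combinatorial factor of a sector. -/
noncomputable def sectorFactor {n : ℕ} (l : Fin n → ℕ) : ℝ := √(∏ i, ((l i : ℝ) + 1))

theorem sectorFactor_pos {n : ℕ} (l : Fin n → ℕ) : 0 < sectorFactor l :=
  Real.sqrt_pos.2 (Finset.prod_pos fun i _ => by positivity)

theorem sqrt_toReal_prod_eq_sectorFactor {n : ℕ} (l : Fin n → ℕ) :
    √(∏ i, (l i + 1 : ℝ≥0∞)).toReal = sectorFactor l := by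
  rw [sectorFactor, ENNReal.toReal_prod]
  refine congrArg _ (Finset.prod_congr rfl fun i _ => ?_)
  rw [ENNReal.toReal_add (by simp) (by simp), ENNReal.toReal_natCast, ENNReal.toReal_one]

section SectorForm

variable {n : ℕ} {l : Fin n → ℕ} {S R : Fin n → Bool} {f : Config (addOcc S l) → ℂ}
  {g : Config (addOcc R l) → ℂ}

/-- Continuity in G within a fixed sector. It lacks the factor `sectorFactor`, hence is not uniform
in the sector, and serves only for approximation and degenerate cases. -/
theorem norm_sectorForm_le (hSR : ∀ i, R i = !S i) (hf : IsWave f) (hg : IsWave g)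
    {G : (Fin n → Particle) → ℂ} (hG : Measurable G) (hGt : sqInt (kernelMeasure n) G < ⊤) :
    ‖sectorForm l S R G f g‖ ≤ l2Norm (kernelMeasure n) G * l2Norm (configMeasure _) f
      * l2Norm (configMeasure _) g := by
  have h := config_bound_one l S R hSR hG hf.measurable hg.measurable hf.antisymm hg.antisymm
  have h1 : 1 * ‖sectorForm l S R G f g‖ₑ ^ 2 ≤ sqInt (kernelMeasure n) G
      * sqInt (configMeasure (addOcc S l)) f * sqInt (configMeasure (addOcc R l)) g := by
    rw [one_mul]
    refine le_trans ?_ h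
    gcongr
    exact enorm_integral_le_lintegral_enorm _
  have h2 := sqrt_toReal_mul_le h1
    (ENNReal.mul_lt_top (ENNReal.mul_lt_top hGt hf.lt_top) hg.lt_top).ne
  rw [ENNReal.toReal_one, Real.sqrt_one, one_mul, ENNReal.toReal_mul, ENNReal.toReal_mul,
    Real.sqrt_mul (by positivity), Real.sqrt_mul (by positivity)] at h2
  exact h2

theorem integrable_sectorForm (hSR : ∀ i, R i = !S i) (hf : IsWave f) (hg : IsWave g)
    {G : (Fin n → Particle) → ℂ} (hG : Measurable G) (hGt : sqInt (kernelMeasure n) G < ⊤) :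
    Integrable (fun z : (Fin n → Particle) × Config l =>
      G z.1 * (f (insertFor S z.1 z.2) * g (insertFor R z.1 z.2)))
      ((kernelMeasure n).prod (configMeasure l)) :=
  integrable_interaction l S R hSR hG hf.measurable hg.measurable hf.antisymm hg.antisymm hGt
    hf.lt_top hg.lt_top

theorem sectorForm_sum (hSR : ∀ i, R i = !S i) (hf : IsWave f) (hg : IsWave g) {κ : Type*}
    (b : Finset κ) (c : κ → ℂ) {H : κ → (Fin n → Particle) → ℂ} (hH : ∀ β, Measurable (H β))
    (hHt : ∀ β, sqInt (kernelMeasure n) (H β) < ⊤) :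
    sectorForm l S R (fun ξ => ∑ β ∈ b, c β * H β ξ) f g
      = ∑ β ∈ b, c β * sectorForm l S R (H β) f g := by
  unfold sectorForm
  simp_rw [Finset.sum_mul]
  rw [integral_finsetSum _ fun β _ => by
    simpa [mul_assoc] using (integrable_sectorForm hSR hf hg (hH β) (hHt β)).const_mul (c β)]
  refine Finset.sum_congr rfl fun β _ => ?_
  rw [← integral_const_mul]
  simp_rw [mul_assoc]

theorem sectorForm_sub (hSR : ∀ i, R i = !S i) (hf : IsWave f) (hg : IsWave g)
    {G H : (Fin n → Particle) → ℂ} (hG : Measurable G) (hGt : sqInt (kernelMeasure n) G < ⊤)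
    (hH : Measurable H) (hHt : sqInt (kernelMeasure n) H < ⊤) :
    sectorForm l S R (fun ξ => G ξ - H ξ) f g = sectorForm l S R G f g - sectorForm l S R H f g := by
  unfold sectorForm
  rw [← integral_sub (integrable_sectorForm hSR hf hg hG hGt) (integrable_sectorForm hSR hf hg hH hHt)]
  simp_rw [sub_mul]

theorem sectorFactor_mul_norm_sectorForm_prod_le (hSR : ∀ i, R i = !S i) (hf : IsWave f)
    (hg : IsWave g) {u : Fin n → Particle → ℂ} (hu : ∀ i, Measurable (u i))
    (hut : ∀ i, sqInt particleMeasure (u i) < ⊤) :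
    sectorFactor l * ‖sectorForm l S R (fun ξ => ∏ i, u i (ξ i)) f g‖
      ≤ (∏ i, l2Norm particleMeasure (u i)) * l2Norm (configMeasure _) f
        * l2Norm (configMeasure _) g := by
  have h := mode_bound l S R hSR hu hut hf.measurable hg.measurable hf.antisymm hg.antisymm
    hf.lt_top hg.lt_top
  have h2 := sqrt_toReal_mul_le h (ENNReal.mul_lt_top (ENNReal.mul_lt_top
    (ENNReal.prod_lt_top fun i _ => (hut i)) hf.lt_top) hg.lt_top).ne
  rw [sqrt_toReal_prod_eq_sectorFactor, ENNReal.toReal_mul, ENNReal.toReal_mul,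
    Real.sqrt_mul (by positivity), Real.sqrt_mul (by positivity), ENNReal.toReal_prod,
    Real.sqrt_prod _ fun i _ => ENNReal.toReal_nonneg] at h2
  exact h2

end SectorForm

/-! ### Energy weights -/

section Energy

variable {n : ℕ} (m : Fin (n + 1) → ℝ) (i : Fin (n + 1))

theorem energy_nonneg {n : ℕ} (m : Fin n → ℝ) (i : Fin n) {l : Fin n → ℕ} (X : Config l) :
    0 ≤ energy m i X :=
  Finset.sum_nonneg fun _ _ => Finset.sum_nonneg fun _ _ => omega_nonneg _ _

theorem measurable_energy {n : ℕ} (m : Fin n → ℝ) (i : Fin n) (l : Fin n → ℕ) :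
    Measurable (energy m i : Config l → ℝ) := by
  unfold energy
  refine Finset.measurable_sum _ fun j _ => Finset.measurable_sum _ fun r _ => ?_
  exact (measurable_omega _).comp ((measurable_pi_apply r).comp (measurable_pi_apply j))

theorem energy_permute {n : ℕ} (m : Fin n → ℝ) (i : Fin n) {l : Fin n → ℕ}
    (σ : ∀ i, Equiv.Perm (Fin (l i))) (X : Config l) : energy m i (permute σ X) = energy m i X :=
  Finset.sum_congr rfl fun j _ => Equiv.sum_comp (σ j) fun r => omega (m j) (X j r)

/-- `(∑_{j ≠ i} H_{f,j} + 1)^c f`. -/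
noncomputable def energyWeight {n : ℕ} (m : Fin n → ℝ) (i : Fin n) (c : ℝ) {l : Fin n → ℕ}
    (f : Config l → ℂ) (Y : Config l) : ℂ :=
  (((energy m i Y + 1) ^ c : ℝ) : ℂ) * f Y

theorem occWeight_le {l : Fin (n + 1) → ℕ} (b : Bool) (j : Fin n) (Y : Config l) :
    occWeight b (fun ξ => ENNReal.ofReal (omega (m (i.succAbove j)) ξ)) (Y (i.succAbove j))
      ≤ ENNReal.ofReal (energy m i Y + 1) := by
  cases b
  · simp only [occWeight, Bool.false_eq_true, if_false]
    rw [← ENNReal.ofReal_one]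
    exact ENNReal.ofReal_le_ofReal (by have := energy_nonneg m i Y; linarith)
  · simp only [occWeight, if_true]
    rw [← ENNReal.ofReal_sum_of_nonneg fun _ _ => omega_nonneg _ _]
    refine ENNReal.ofReal_le_ofReal ?_
    have := Finset.single_le_sum (s := Finset.univ.erase i)
      (f := fun j => ∑ r, omega (m j) (Y j r))
      (fun j _ => Finset.sum_nonneg fun r _ => omega_nonneg _ _)
      (Finset.mem_erase.2 ⟨Fin.succAbove_ne i j, Finset.mem_univ _⟩)
    refine this.trans ?_
    rw [energy]
    linarith

theorem enorm_energyWeight_sq {l : Fin (n + 1) → ℕ} (c : ℝ) (f : Config l → ℂ) (Y : Config l) :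
    ‖energyWeight m i c f Y‖ₑ ^ 2 = ENNReal.ofReal ((energy m i Y + 1) ^ (2 * c)) * ‖f Y‖ₑ ^ 2 := by
  have h : 0 < energy m i Y + 1 := by have := energy_nonneg m i Y; linarith
  rw [energyWeight, enorm_mul, mul_pow, ← ofReal_norm (((_ : ℝ) : ℂ)), Complex.norm_real,
    Real.norm_of_nonneg (by positivity), ← ENNReal.ofReal_pow (by positivity), ← Real.rpow_natCast,
    ← Real.rpow_mul h.le]
  congr 3
  push_cast
  ring

/-- Each of the n factors is either 1 or the energy of one species other than i, hence at most E+1.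
The exponent n/2 belongs to the amplitude and doubles on squaring. -/
theorem lintegral_occWeight_le {l : Fin (n + 1) → ℕ} (S : Fin (n + 1) → Bool) (f : Config l → ℂ) :
    ∫⁻ Y, ‖f Y‖ₑ ^ 2 * ∏ j, occWeight (S (i.succAbove j))
        (fun ξ => ENNReal.ofReal (omega (m (i.succAbove j)) ξ)) (Y (i.succAbove j)) ∂(configMeasure l)
      ≤ sqInt (configMeasure l) (energyWeight m i (n / 2) f) := by
  refine lintegral_mono fun Y => ?_
  have h : 0 < energy m i Y + 1 := by have := energy_nonneg m i Y; linarith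
  simp only
  rw [enorm_energyWeight_sq, mul_comm]
  gcongr
  refine (Finset.prod_le_prod' fun j _ => occWeight_le m i _ j Y).trans ?_
  rw [Finset.prod_const, Finset.card_univ, Fintype.card_fin, ← ENNReal.ofReal_pow h.le,
    ← Real.rpow_natCast]
  refine le_of_eq ?_
  congr 2
  ring

/-- The constant in the bound of `ω⁻¹` by the oscillators. -/
noncomputable def massConst (m : ℝ) : ℝ := (exists_weightedBound_omega m).choose

theorem massConst_pos (m : ℝ) : 0 < massConst m := (exists_weightedBound_omega m).choose_spec.1

theorem weightedBound_omega (m : ℝ) :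
    WeightedBound particleMeasure particleMode (fun ξ => (ENNReal.ofReal (omega m ξ))⁻¹)
      (fun a => ENNReal.ofReal (massConst m * modeEig a ^ massExponent m)) :=
  (exists_weightedBound_omega m).choose_spec.2

/-- Kernel modes, labelled by the mode of the species `i` and the modes of the others. -/
noncomputable def pairMode (p : Mode × (Fin n → Mode)) (ξ : Fin (n + 1) → Particle) : ℝ :=
  kernelMode (i.insertNth (α := fun _ => Mode) p.1 p.2) ξ

theorem pairMode_apply (p : Mode × (Fin n → Mode)) (ξ : Fin (n + 1) → Particle) :
    pairMode i p ξ = particleMode p.1 (ξ i) * ∏ j, particleMode (p.2 j) (ξ (i.succAbove j)) := by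
  rw [pairMode, kernelMode, Fin.prod_univ_succAbove _ i]
  simp

theorem isModeSystem_pairMode : IsModeSystem (kernelMeasure (n + 1)) (pairMode i) :=
  (isModeSystem_kernelMode (n + 1)).comp (f := MeasurableEquiv.refl _) (MeasurePreserving.id _)
    (Fin.insertNthEquiv (fun _ => Mode) i)

/-- The weight that controls the factors `ω⁻¹` in the energy bound. -/
noncomputable def energyEig (β : Fin n → Mode) : ℝ :=
  ∏ j, massConst (m (i.succAbove j)) * modeEig (β j) ^ massExponent (m (i.succAbove j))

theorem energyEig_pos (β : Fin n → Mode) : 0 < energyEig m i β :=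
  Finset.prod_pos fun _ _ => mul_pos (massConst_pos _) (Real.rpow_pos_of_pos (modeEig_pos _) _)

/-- Tensorization of `weightedBound_omega` over the other species, with trivial weight in slot i. -/
theorem weightedBound_pairMode :
    WeightedBound (kernelMeasure (n + 1)) (pairMode i)
      (fun ξ => ∏ j, (ENNReal.ofReal (omega (m (i.succAbove j)) (ξ (i.succAbove j))))⁻¹)
      (fun p => ENNReal.ofReal (energyEig m i p.2)) := by
  have hm : ∀ k : Fin (n + 1), Measurable (i.insertNth (α := fun _ => Particle → ℝ≥0∞) (fun _ => 1)
      (fun j ξ => (ENNReal.ofReal (omega (m (i.succAbove j)) ξ))⁻¹) k) := by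
    refine (Fin.forall_iff_succAbove i).2 ⟨?_, fun j => ?_⟩
    · rw [Fin.insertNth_apply_same]; exact measurable_const
    · rw [Fin.insertNth_apply_succAbove]
      exact (ENNReal.measurable_ofReal.comp (measurable_omega _)).inv
  have h := WeightedBound.pi (fun _ : Fin (n + 1) => particleMeasure) (u := fun _ => particleMode)
    (fun _ => isModeSystem_particleMode.measurable) hm
    (r := i.insertNth (α := fun _ => Mode → ℝ≥0∞) (fun _ => 1)
      fun j a => ENNReal.ofReal (massConst (m (i.succAbove j)) *
        modeEig a ^ massExponent (m (i.succAbove j)))) (by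
      refine (Fin.forall_iff_succAbove i).2 ⟨?_, fun j => ?_⟩
      · rw [Fin.insertNth_apply_same, Fin.insertNth_apply_same]
        exact isModeSystem_particleMode.weightedBound_one
      · rw [Fin.insertNth_apply_succAbove, Fin.insertNth_apply_succAbove]
        exact weightedBound_omega _)
  have h2 := h.comp (f := id) (fun a => (isModeSystem_kernelMode (n + 1)).measurable a)
    (by exact Finset.measurable_prod _ fun k _ => (hm k).comp (measurable_pi_apply k))
    (MeasurePreserving.id _) (Fin.insertNthEquiv (fun _ => Mode) i)
  intro s c
  refine le_trans (le_of_eq ?_) ((h2 s c).trans_eq ?_)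
  · refine lintegral_congr fun ξ => ?_
    simp only [Fin.prod_univ_succAbove _ i, Fin.insertNth_apply_same, Fin.insertNth_apply_succAbove,
      one_mul, id, pairMode_apply, Fin.insertNthEquiv_apply]
  · refine Finset.sum_congr rfl fun p _ => ?_
    simp only [Fin.prod_univ_succAbove _ i, Fin.insertNth_apply_same, Fin.insertNth_apply_succAbove,
      one_mul, energyEig, Fin.insertNthEquiv_apply]
    rw [ENNReal.ofReal_prod_of_nonneg fun j _ =>
      (mul_pos (massConst_pos _) (Real.rpow_pos_of_pos (modeEig_pos _) _)).le]

variable {l : Fin (n + 1) → ℕ} {S R : Fin (n + 1) → Bool} {f : Config (addOcc S l) → ℂ}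
  {g : Config (addOcc R l) → ℂ}

theorem IsModeSystem.measurable_sum {X ι : Type*} [MeasurableSpace X] {μ : Measure X}
    {u : ι → X → ℝ} (hu : IsModeSystem μ u) (s : Finset ι) (c : ι → ℂ) :
    Measurable fun x => ∑ a ∈ s, c a * (u a x : ℂ) :=
  Finset.measurable_sum _ fun a _ => measurable_const.mul
    (Complex.measurable_ofReal.comp (hu.measurable a))

theorem IsModeSystem.sqInt_sum {X ι : Type*} [MeasurableSpace X] {μ : Measure X}
    {u : ι → X → ℝ} (hu : IsModeSystem μ u) (s : Finset ι) (c : ι → ℂ) :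
    sqInt μ (fun x => ∑ a ∈ s, c a * (u a x : ℂ)) = ENNReal.ofReal (∑ a ∈ s, ‖c a‖ ^ 2) := by
  rw [sqInt, hu.lintegral_sum, ENNReal.ofReal_sum_of_nonneg fun _ _ => by positivity]
  simp [ENNReal.ofReal_pow, ofReal_norm]

/-- The endpoint θ = 0 in terms of mode coefficients: `energy_bound`, where the integral of |G|²
∏ω⁻¹ is replaced by the diagonal form of `weightedBound_pairMode`. -/
theorem sectorFactor_mul_norm_sectorForm_sum_le (hSR : ∀ i, R i = !S i) (hf : IsWave f)
    (hg : IsWave g) (hfe : sqInt (configMeasure _) (energyWeight m i (n / 2) f) < ⊤)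
    (hge : sqInt (configMeasure _) (energyWeight m i (n / 2) g) < ⊤)
    (s : Finset (Mode × (Fin n → Mode))) (c : Mode × (Fin n → Mode) → ℂ) :
    sectorFactor l * ‖sectorForm l S R (fun ξ => ∑ p ∈ s, c p * (pairMode i p ξ : ℂ)) f g‖
      ≤ √(∑ p ∈ s, energyEig m i p.2 * ‖c p‖ ^ 2)
        * (l2Norm (configMeasure _) (energyWeight m i (n / 2) f)
          * l2Norm (configMeasure _) (energyWeight m i (n / 2) g)) := by
  have hu := isModeSystem_pairMode (n := n) i
  have h := energy_bound l S R hSR i (w := fun j ξ => ENNReal.ofReal (omega (m (i.succAbove j)) ξ))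
    (fun _ => ENNReal.measurable_ofReal.comp (measurable_omega _))
    (fun j => by
      filter_upwards [ae_omega_pos (m (i.succAbove j))] with ξ hξ
      simpa using hξ)
    (fun j ξ => ENNReal.ofReal_ne_top) (hu.measurable_sum s c) hf.measurable
    hg.measurable hf.antisymm hg.antisymm (by rw [hu.sqInt_sum]; exact ENNReal.ofReal_lt_top)
    hf.lt_top hg.lt_top
  have hw := weightedBound_pairMode m i s c
  have h1 : ∑ p ∈ s, ENNReal.ofReal (energyEig m i p.2) * ‖c p‖ₑ ^ 2
      = ENNReal.ofReal (∑ p ∈ s, energyEig m i p.2 * ‖c p‖ ^ 2) := by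
    rw [ENNReal.ofReal_sum_of_nonneg fun p _ => mul_nonneg (energyEig_pos m i _).le (sq_nonneg _)]
    refine Finset.sum_congr rfl fun p _ => ?_
    rw [ENNReal.ofReal_mul (energyEig_pos m i _).le, ENNReal.ofReal_pow (norm_nonneg _), ofReal_norm]
  rw [h1] at hw
  have h2 := h.trans (mul_le_mul' (mul_le_mul' (by
    refine le_trans (le_of_eq ?_) hw
    exact lintegral_congr fun ξ => mul_comm _ _) (lintegral_occWeight_le m i S f))
    (lintegral_occWeight_le m i R g))
  have h3 := sqrt_toReal_mul_le h2
    (ENNReal.mul_lt_top (ENNReal.mul_lt_top ENNReal.ofReal_lt_top hfe) hge).ne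
  rw [sqrt_toReal_prod_eq_sectorFactor, ENNReal.toReal_mul, ENNReal.toReal_mul,
    Real.sqrt_mul (by positivity), Real.sqrt_mul (by positivity), ENNReal.toReal_ofReal
      (Finset.sum_nonneg fun p _ => mul_nonneg (energyEig_pos m i _).le (sq_nonneg _)), mul_assoc] at h3
  exact h3

end Energy

/-! ### The interpolated bound in one sector -/

section Interpolation

variable {n : ℕ} (m : Fin (n + 1) → ℝ) (i : Fin (n + 1))

/-- The weight of a mode in the interpolated bound. -/
noncomputable def interpWeight (s θ : ℝ) (β : Fin n → Mode) : ℝ :=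
  (∏ j, modeEig (β j) ^ s) ^ θ * √(energyEig m i β) ^ (1 - θ)

theorem interpWeight_nonneg (s θ : ℝ) (β : Fin n → Mode) : 0 ≤ interpWeight m i s θ β :=
  mul_nonneg (Real.rpow_nonneg (Finset.prod_nonneg fun _ _ => Real.rpow_nonneg (modeEig_pos _).le _) _)
    (Real.rpow_nonneg (Real.sqrt_nonneg _) _)

variable {l : Fin (n + 1) → ℕ} {S R : Fin (n + 1) → Bool} {f : Config (addOcc S l) → ℂ}
  {g : Config (addOcc R l) → ℂ}

theorem IsModeSystem.l2Norm_sum {X ι : Type*} [MeasurableSpace X] {μ : Measure X}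
    {u : ι → X → ℝ} (hu : IsModeSystem μ u) (s : Finset ι) (c : ι → ℂ) :
    l2Norm μ (fun x => ∑ a ∈ s, c a * (u a x : ℂ)) = √(∑ a ∈ s, ‖c a‖ ^ 2) := by
  rw [l2Norm, hu.sqInt_sum, ENNReal.toReal_ofReal (Finset.sum_nonneg fun _ _ => sq_nonneg _)]

theorem IsModeSystem.l2Norm_mode {X ι : Type*} [MeasurableSpace X] {μ : Measure X}
    {u : ι → X → ℝ} (hu : IsModeSystem μ u) (a : ι) : l2Norm μ (fun x => (u a x : ℂ)) = 1 := by
  simpa using hu.l2Norm_sum {a} (fun _ => 1)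

theorem IsModeSystem.sqInt_mode_lt_top {X ι : Type*} [MeasurableSpace X] {μ : Measure X}
    {u : ι → X → ℝ} (hu : IsModeSystem μ u) (a : ι) : sqInt μ (fun x => (u a x : ℂ)) < ⊤ := by
  have := hu.sqInt_sum {a} (fun _ => 1)
  simp only [Finset.sum_singleton, one_mul] at this
  rw [this]; exact ENNReal.ofReal_lt_top

/-- The endpoint θ = 1. For fixed β the whole sum over a is still a product kernel, with ∑ cₐuₐ as
its factor in species i. Hence no summability over the modes of species i is needed, and this
species gets no weight. -/
theorem sectorFactor_mul_norm_sectorForm_slice_le (hSR : ∀ i, R i = !S i) (hf : IsWave f)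
    (hg : IsWave g) (t : Finset Mode) (β : Fin n → Mode) (c : Mode → ℂ) :
    sectorFactor l * ‖sectorForm l S R (fun ξ => ∑ a ∈ t, c a * (pairMode i (a, β) ξ : ℂ)) f g‖
      ≤ (l2Norm (configMeasure _) f * l2Norm (configMeasure _) g) * √(∑ a ∈ t, ‖c a‖ ^ 2) := by
  have hp := isModeSystem_particleMode
  set u : Fin (n + 1) → Particle → ℂ := i.insertNth (α := fun _ => Particle → ℂ)
    (fun x => ∑ a ∈ t, c a * (particleMode a x : ℂ)) (fun j x => (particleMode (β j) x : ℂ)) with hu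
  have hH : ∀ ξ : Fin (n + 1) → Particle, ∑ a ∈ t, c a * (pairMode i (a, β) ξ : ℂ)
      = ∏ k, u k (ξ k) := fun ξ => by
    rw [Fin.prod_univ_succAbove _ i]
    simp only [hu, Fin.insertNth_apply_same, Fin.insertNth_apply_succAbove, pairMode_apply]
    rw [Finset.sum_mul]
    refine Finset.sum_congr rfl fun a _ => ?_
    push_cast; ring
  simp_rw [hH]
  have h := sectorFactor_mul_norm_sectorForm_prod_le hSR hf hg (u := u)
    ((Fin.forall_iff_succAbove i).2 ⟨by
      simp only [hu, Fin.insertNth_apply_same]; exact hp.measurable_sum t c, fun j => by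
      simp only [hu, Fin.insertNth_apply_succAbove]
      exact Complex.measurable_ofReal.comp (hp.measurable _)⟩)
    ((Fin.forall_iff_succAbove i).2 ⟨by
      simp only [hu, Fin.insertNth_apply_same]; rw [hp.sqInt_sum]; exact ENNReal.ofReal_lt_top,
      fun j => by
      simp only [hu, Fin.insertNth_apply_succAbove]
      exact hp.sqInt_mode_lt_top _⟩)
  rw [Fin.prod_univ_succAbove _ i] at h
  simp only [hu, Fin.insertNth_apply_same, Fin.insertNth_apply_succAbove, hp.l2Norm_mode,
    Finset.prod_const_one, mul_one, hp.l2Norm_sum] at h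
  calc _ ≤ _ := h
    _ = _ := by ring

/-- An instance of `norm_sum_le_interpolation` over the modes β of the other species: τ is the
contribution of the slice β, N the ℓ² norm of its coefficients, μ the root of `energyEig`, and R the
eigenvalue product to the power s. Multipliers in β merely rescale the coefficients, so the energy
bound holds for all of them. -/
theorem sectorForm_interpolation_finite (hSR : ∀ i, R i = !S i) (hf : IsWave f) (hg : IsWave g)
    (hfe : sqInt (configMeasure _) (energyWeight m i (n / 2) f) < ⊤)
    (hge : sqInt (configMeasure _) (energyWeight m i (n / 2) g) < ⊤)
    (hB : 0 < l2Norm (configMeasure _) (energyWeight m i (n / 2) f)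
      * l2Norm (configMeasure _) (energyWeight m i (n / 2) g))
    {s θ D : ℝ} (hθ₀ : 0 ≤ θ) (hθ₁ : θ ≤ 1) (hD : 0 < D)
    (hsD : ∀ b : Finset (Fin n → Mode), ∑ β ∈ b, ∏ j, modeEig (β j) ^ (-(2 * s)) ≤ D)
    (t : Finset Mode) (b : Finset (Fin n → Mode)) (c : Mode × (Fin n → Mode) → ℂ) :
    sectorFactor l * ‖sectorForm l S R (fun ξ => ∑ p ∈ t ×ˢ b, c p * (pairMode i p ξ : ℂ)) f g‖
      ≤ √D ^ θ * (l2Norm (configMeasure _) f * l2Norm (configMeasure _) g) ^ θ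
        * (l2Norm (configMeasure _) (energyWeight m i (n / 2) f)
          * l2Norm (configMeasure _) (energyWeight m i (n / 2) g)) ^ (1 - θ)
        * √(∑ p ∈ t ×ˢ b, (‖c p‖ * interpWeight m i s θ p.2) ^ 2) := by
  have hu := isModeSystem_pairMode (n := n) i
  set A := l2Norm (configMeasure _) f * l2Norm (configMeasure _) g
  set B := l2Norm (configMeasure _) (energyWeight m i (n / 2) f)
          * l2Norm (configMeasure _) (energyWeight m i (n / 2) g)
  set H : (Fin n → Mode) → (Fin (n + 1) → Particle) → ℂ :=
    fun β ξ => ∑ a ∈ t, c (a, β) * (pairMode i (a, β) ξ : ℂ) with hH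
  have hHm : ∀ β, Measurable (H β) := fun β =>
    Finset.measurable_sum _ fun a _ => measurable_const.mul
      (Complex.measurable_ofReal.comp (hu.measurable _))
  have hHt : ∀ β, sqInt (kernelMeasure (n + 1)) (H β) < ⊤ := fun β => by
    classical
    have := hu.sqInt_sum (t.map ⟨fun a => (a, β), fun a a' h => (Prod.mk.inj h).1⟩) c
    simp only [Finset.sum_map] at this
    exact this.trans_lt ENNReal.ofReal_lt_top
  set τ : (Fin n → Mode) → ℂ := fun β => (sectorFactor l : ℂ) * sectorForm l S R (H β) f g with hτ
  set N : (Fin n → Mode) → ℝ := fun β => √(∑ a ∈ t, ‖c (a, β)‖ ^ 2) with hN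
  have hnormτ : ∀ (y : ℂ), ‖(sectorFactor l : ℂ) * y‖ = sectorFactor l * ‖y‖ := fun y => by
    rw [norm_mul, Complex.norm_real, Real.norm_of_nonneg (sectorFactor_pos l).le]
  have hNsq : ∀ β, N β ^ 2 = ∑ a ∈ t, ‖c (a, β)‖ ^ 2 := fun β =>
    Real.sq_sqrt (Finset.sum_nonneg fun _ _ => sq_nonneg _)
  have key := norm_sum_le_interpolation b τ N (fun β => √(energyEig m i β))
    (fun β => ∏ j, modeEig (β j) ^ s) (A := A) (B := B) (D := √D) (fun β => Real.sqrt_nonneg _)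
    (fun β => Real.sqrt_pos.2 (energyEig_pos m i β))
    (fun β => Finset.prod_pos fun j _ => Real.rpow_pos_of_pos (modeEig_pos _) _)
    (mul_nonneg (l2Norm_nonneg _) (l2Norm_nonneg _)) hB (Real.sqrt_pos.2 hD) hθ₀ hθ₁
    (fun β _ => by
      rw [hτ, hnormτ]
      exact sectorFactor_mul_norm_sectorForm_slice_le i hSR hf hg t β fun a => c (a, β))
    (fun γ => by
      have e1 : ∑ β ∈ b, γ β * τ β = (sectorFactor l : ℂ) * sectorForm l S R
          (fun ξ => ∑ p ∈ t ×ˢ b, (γ p.2 * c p) * (pairMode i p ξ : ℂ)) f g := by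
        have e2 : ∀ ξ, ∑ p ∈ t ×ˢ b, (γ p.2 * c p) * (pairMode i p ξ : ℂ)
            = ∑ β ∈ b, γ β * H β ξ := fun ξ => by
          rw [Finset.sum_product_right]
          refine Finset.sum_congr rfl fun β _ => ?_
          rw [hH, Finset.mul_sum]
          exact Finset.sum_congr rfl fun a _ => mul_assoc _ _ _
        simp_rw [e2]
        rw [sectorForm_sum hSR hf hg b γ hHm hHt, Finset.mul_sum]
        exact Finset.sum_congr rfl fun β _ => by simp only [hτ]; ring
      rw [e1, hnormτ]
      refine (sectorFactor_mul_norm_sectorForm_sum_le m i hSR hf hg hfe hge _ _).trans_eq ?_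
      rw [mul_comm, Finset.sum_product_right]
      congr 2
      refine Finset.sum_congr rfl fun β _ => ?_
      rw [mul_pow, mul_pow, hNsq, Real.sq_sqrt (energyEig_pos m i β).le, Finset.mul_sum, Finset.mul_sum]
      refine Finset.sum_congr rfl fun a _ => ?_
      rw [norm_mul]; ring)
    (by
      rw [Real.sq_sqrt hD.le]
      refine le_trans (le_of_eq (Finset.sum_congr rfl fun β _ => ?_)) (hsD b)
      rw [← Finset.prod_pow, ← Finset.prod_inv_distrib]
      refine Finset.prod_congr rfl fun j _ => ?_
      rw [← Real.rpow_natCast, ← Real.rpow_mul (modeEig_pos _).le, ← Real.rpow_neg (modeEig_pos _).le]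
      congr 1; push_cast; ring)
  have e1 : ∑ β ∈ b, τ β = (sectorFactor l : ℂ) * sectorForm l S R
      (fun ξ => ∑ p ∈ t ×ˢ b, c p * (pairMode i p ξ : ℂ)) f g := by
    have e2 : ∀ ξ, ∑ p ∈ t ×ˢ b, c p * (pairMode i p ξ : ℂ) = ∑ β ∈ b, 1 * H β ξ := fun ξ => by
      rw [Finset.sum_product_right]
      exact Finset.sum_congr rfl fun β _ => (one_mul _).symm
    simp_rw [e2]
    rw [sectorForm_sum hSR hf hg b (fun _ => 1) hHm hHt, Finset.mul_sum]
    exact Finset.sum_congr rfl fun β _ => by simp only [hτ, one_mul]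
  rw [e1, hnormτ] at key
  refine key.trans_eq ?_
  congr 2
  rw [Finset.sum_product_right]
  refine Finset.sum_congr rfl fun β _ => ?_
  rw [mul_pow, hNsq, Finset.sum_mul]
  exact Finset.sum_congr rfl fun a _ => by rw [mul_pow _ (interpWeight m i s θ _), interpWeight, mul_pow]

/-- The finite bound is uniform in the set of modes, so the Hermite expansion of G is truncated and
the remainder is controlled by `norm_sectorForm_le`. -/
theorem sectorForm_interpolation (hSR : ∀ i, R i = !S i) (hf : IsWave f) (hg : IsWave g)
    (hfe : sqInt (configMeasure _) (energyWeight m i (n / 2) f) < ⊤)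
    (hge : sqInt (configMeasure _) (energyWeight m i (n / 2) g) < ⊤)
    {s θ D : ℝ} (hθ₀ : 0 ≤ θ) (hθ₁ : θ ≤ 1) (hD : 0 < D)
    (hsD : ∀ b : Finset (Fin n → Mode), ∑ β ∈ b, ∏ j, modeEig (β j) ^ (-(2 * s)) ≤ D)
    (G : KernelSpace (n + 1)) {W : ℝ} (hW : 0 ≤ W)
    (hGW : ∀ b : Finset (Mode × (Fin n → Mode)), ∑ p ∈ b,
      (‖∫ ξ, (pairMode i p ξ : ℂ) * G ξ ∂(kernelMeasure (n + 1))‖ * interpWeight m i s θ p.2) ^ 2 ≤ W ^ 2) :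
    sectorFactor l * ‖sectorForm l S R G f g‖
      ≤ √D ^ θ * (l2Norm (configMeasure _) f * l2Norm (configMeasure _) g) ^ θ
        * (l2Norm (configMeasure _) (energyWeight m i (n / 2) f)
          * l2Norm (configMeasure _) (energyWeight m i (n / 2) g)) ^ (1 - θ) * W := by
  classical
  have hu := isModeSystem_pairMode (n := n) i
  have hGm : Measurable G := (Lp.stronglyMeasurable G).measurable
  have hGt : sqInt (kernelMeasure (n + 1)) G < ⊤ :=
    (sqInt_lt_top_iff hGm.aestronglyMeasurable).2 (Lp.memLp G)
  have hC : 0 ≤ √D ^ θ * (l2Norm (configMeasure _) f * l2Norm (configMeasure _) g) ^ θ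
        * (l2Norm (configMeasure _) (energyWeight m i (n / 2) f)
          * l2Norm (configMeasure _) (energyWeight m i (n / 2) g)) ^ (1 - θ) := by
    have h1 := l2Norm_nonneg (μ := configMeasure _) f
    have h2 := l2Norm_nonneg (μ := configMeasure _) g
    have h3 := l2Norm_nonneg (μ := configMeasure _) (energyWeight m i (n / 2) f)
    have h4 := l2Norm_nonneg (μ := configMeasure _) (energyWeight m i (n / 2) g)
    positivity
  -- The interpolation needs B > 0. If B = 0, one of the wave functions has norm zero, since the
  -- energy weight is at least 1, and the form vanishes.
  rcases (mul_nonneg (l2Norm_nonneg (μ := configMeasure _) (energyWeight m i (n / 2) f))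
    (l2Norm_nonneg (μ := configMeasure _) (energyWeight m i (n / 2) g))).eq_or_lt with hB | hB
  · have h0 : ∀ {S : Fin (n + 1) → Bool} {h : Config (addOcc S l) → ℂ},
        sqInt (configMeasure _) (energyWeight m i (n / 2) h) < ⊤ →
        l2Norm (configMeasure _) (energyWeight m i (n / 2) h) = 0 → l2Norm (configMeasure _) h = 0 := by
      intro S h ht h0
      have h1 : sqInt (configMeasure _) (energyWeight m i (n / 2) h) = 0 :=
        ((ENNReal.toReal_eq_zero_iff _).1 ((Real.sqrt_eq_zero ENNReal.toReal_nonneg).1 h0)).resolve_right ht.ne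
      have h2 : sqInt (configMeasure (addOcc S l)) h ≤ 0 := by
        rw [← h1]
        refine lintegral_mono fun Y => ?_
        rw [enorm_energyWeight_sq]
        refine le_mul_of_one_le_left' ?_
        rw [← ENNReal.ofReal_one]
        refine ENNReal.ofReal_le_ofReal (Real.one_le_rpow ?_ (by positivity))
        have := energy_nonneg m i Y
        linarith
      rw [l2Norm, nonpos_iff_eq_zero.1 h2]; simp
    have h1 := norm_sectorForm_le hSR hf hg hGm hGt
    have h2 : l2Norm (kernelMeasure (n + 1)) G * l2Norm (configMeasure _) f
        * l2Norm (configMeasure _) g = 0 := by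
      rcases mul_eq_zero.1 hB.symm with h | h
      · rw [h0 hfe h]; ring
      · rw [h0 hge h]; ring
    rw [h2] at h1
    rw [le_antisymm h1 (norm_nonneg _), mul_zero]
    exact mul_nonneg hC hW
  set M := sectorFactor l * (l2Norm (configMeasure _) f * l2Norm (configMeasure _) g)
  have hM : 0 ≤ M := mul_nonneg (sectorFactor_pos l).le (mul_nonneg (l2Norm_nonneg _) (l2Norm_nonneg _))
  refine le_of_forall_pos_le_add fun ε hε => ?_
  -- M + 1 instead of M, because M may be zero.
  obtain ⟨b, hb⟩ := hu.exists_approx G (ε := ε / (M + 1)) (by positivity)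
  set γ : Mode × (Fin n → Mode) → ℂ := fun p => ∫ ξ, (pairMode i p ξ : ℂ) * G ξ ∂(kernelMeasure (n + 1))
  set Gb : (Fin (n + 1) → Particle) → ℂ := fun ξ => ∑ p ∈ b, γ p * (pairMode i p ξ : ℂ) with hGb
  have hGbm : Measurable Gb := hu.measurable_sum b γ
  have hGbt : sqInt (kernelMeasure (n + 1)) Gb < ⊤ := by
    rw [hGb, hu.sqInt_sum]; exact ENNReal.ofReal_lt_top
  have hsub : sqInt (kernelMeasure (n + 1)) (fun ξ => G ξ - Gb ξ) < ⊤ := by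
    refine (sqInt_lt_top_iff (hGm.sub hGbm).aestronglyMeasurable).2 ?_
    exact (Lp.memLp G).sub ((sqInt_lt_top_iff hGbm.aestronglyMeasurable).1 hGbt)
  have h1 := norm_sectorForm_le hSR hf hg (hGm.sub hGbm) hsub
  have h1' : ‖sectorForm l S R (fun ξ => G ξ - Gb ξ) f g‖ ≤ _ := h1
  rw [sectorForm_sub hSR hf hg hGm hGt hGbm hGbt] at h1'
  have hbsub : b ⊆ b.image Prod.fst ×ˢ b.image Prod.snd := fun p hp =>
    Finset.mem_product.2 ⟨Finset.mem_image_of_mem _ hp, Finset.mem_image_of_mem _ hp⟩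
  have h2 := sectorForm_interpolation_finite m i hSR hf hg hfe hge hB (s := s) hθ₀ hθ₁ hD hsD
    (b.image Prod.fst) (b.image Prod.snd) (fun p => if p ∈ b then γ p else 0)
  have e1 : ∀ ξ, ∑ p ∈ b.image Prod.fst ×ˢ b.image Prod.snd,
      (if p ∈ b then γ p else 0) * (pairMode i p ξ : ℂ) = Gb ξ := fun ξ => by
    rw [← Finset.sum_subset hbsub fun p _ hp => by simp [hp]]
    exact Finset.sum_congr rfl fun p hp => by simp [hp]
  have e2 : ∑ p ∈ b.image Prod.fst ×ˢ b.image Prod.snd,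
      (‖(if p ∈ b then γ p else 0)‖ * interpWeight m i s θ p.2) ^ 2
      = ∑ p ∈ b, (‖γ p‖ * interpWeight m i s θ p.2) ^ 2 := by
    rw [← Finset.sum_subset hbsub fun p _ hp => by simp [hp]]
    exact Finset.sum_congr rfl fun p hp => by simp [hp]
  simp_rw [e1] at h2
  rw [e2] at h2
  have h3 : √(∑ p ∈ b, (‖γ p‖ * interpWeight m i s θ p.2) ^ 2) ≤ W := by
    rw [Real.sqrt_le_left hW]; exact hGW b
  have h4 := h2.trans (mul_le_mul_of_nonneg_left h3 hC)
  have h5 : sectorFactor l * ‖sectorForm l S R G f g - sectorForm l S R Gb f g‖ ≤ ε := by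
    calc _ ≤ sectorFactor l * (ε / (M + 1) * l2Norm (configMeasure _) f * l2Norm (configMeasure _) g) := by
          refine mul_le_mul_of_nonneg_left (h1'.trans ?_) (sectorFactor_pos l).le
          refine mul_le_mul_of_nonneg_right (mul_le_mul_of_nonneg_right hb.le (l2Norm_nonneg _)) (l2Norm_nonneg _)
      _ = M * ε / (M + 1) := by ring
      _ ≤ ε := by rw [div_le_iff₀ (by positivity)]; nlinarith
  have h6 : ‖sectorForm l S R G f g‖ ≤ ‖sectorForm l S R Gb f g‖
      + ‖sectorForm l S R G f g - sectorForm l S R Gb f g‖ := by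
    have := norm_add_le (sectorForm l S R Gb f g) (sectorForm l S R G f g - sectorForm l S R Gb f g)
    simpa using this
  calc _ ≤ sectorFactor l * (‖sectorForm l S R Gb f g‖
      + ‖sectorForm l S R G f g - sectorForm l S R Gb f g‖) :=
        mul_le_mul_of_nonneg_left h6 (sectorFactor_pos l).le
    _ = _ := mul_add _ _ _
    _ ≤ _ := add_le_add h4 h5

end Interpolation

/-! ### Energy cutoffs -/

section Cutoff

variable {n : ℕ} (m : Fin n → ℝ) (i : Fin n) {l : Fin n → ℕ}

/-- The restriction of a wave function to the configurations with `a ≤ E + 1 < b`. -/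
noncomputable def energyCut (a b : ℝ) (f : Config l → ℂ) (Y : Config l) : ℂ :=
  {Y | a ≤ energy m i Y + 1 ∧ energy m i Y + 1 < b}.indicator f Y

theorem energyCut_of_mem {a b : ℝ} {Y : Config l} (h : a ≤ energy m i Y + 1 ∧ energy m i Y + 1 < b)
    (f : Config l → ℂ) : energyCut m i a b f Y = f Y := by
  simp only [energyCut, Set.indicator, Set.mem_ofPred_eq, h, and_self, if_true]

theorem energyCut_of_not {a b : ℝ} {Y : Config l}
    (h : ¬ (a ≤ energy m i Y + 1 ∧ energy m i Y + 1 < b)) (f : Config l → ℂ) :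
    energyCut m i a b f Y = 0 := by
  simp only [energyCut, Set.indicator, Set.mem_ofPred_eq, h, if_false]

theorem measurableSet_energyShell (a b : ℝ) :
    MeasurableSet {Y : Config l | a ≤ energy m i Y + 1 ∧ energy m i Y + 1 < b} :=
  (measurableSet_le measurable_const ((measurable_energy m i l).add_const 1)).inter
    (measurableSet_lt ((measurable_energy m i l).add_const 1) measurable_const)

theorem enorm_energyCut_le (a b : ℝ) (f : Config l → ℂ) (Y : Config l) :
    ‖energyCut m i a b f Y‖ₑ ≤ ‖f Y‖ₑ := by
  unfold energyCut Set.indicator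
  split_ifs
  · exact le_rfl
  · simp

theorem sqInt_energyCut_le (a b : ℝ) (f : Config l → ℂ) :
    sqInt (configMeasure l) (energyCut m i a b f) ≤ sqInt (configMeasure l) f :=
  lintegral_mono fun Y => by gcongr; exact enorm_energyCut_le m i a b f Y

theorem energyWeight_energyCut (a b c : ℝ) (f : Config l → ℂ) :
    energyWeight m i c (energyCut m i a b f) = energyCut m i a b (energyWeight m i c f) := by
  ext Y
  unfold energyWeight energyCut Set.indicator
  split_ifs <;> simp

theorem IsWave.energyCut {f : Config l → ℂ} (hf : IsWave f) (a b : ℝ) :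
    IsWave (energyCut m i a b f) where
  measurable := hf.measurable.indicator (measurableSet_energyShell m i a b)
  antisymm σ X := by
    simp only [FermiFields.energyCut, Set.indicator, Set.mem_ofPred_eq, energy_permute]
    split_ifs
    · exact hf.antisymm σ X
    · simp
  lt_top := (sqInt_energyCut_le m i a b f).trans_lt hf.lt_top

theorem l2Norm_mono {X : Type*} [MeasurableSpace X] {μ : Measure X} {f g : X → ℂ}
    (hg : sqInt μ g < ⊤) {k : ℝ} (hk : 0 ≤ k) (h : ∀ x, ‖f x‖ ≤ k * ‖g x‖) :
    l2Norm μ f ≤ k * l2Norm μ g := by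
  have h1 : sqInt μ f ≤ ENNReal.ofReal (k ^ 2) * sqInt μ g := by
    unfold sqInt
    rw [← lintegral_const_mul' _ _ ENNReal.ofReal_ne_top]
    refine lintegral_mono fun x => ?_
    have := ENNReal.ofReal_le_ofReal (pow_le_pow_left₀ (norm_nonneg _) (h x) 2)
    rw [mul_pow, ENNReal.ofReal_mul (sq_nonneg k)] at this
    simpa [ENNReal.ofReal_pow, ofReal_norm] using this
  have h2 := ENNReal.toReal_mono (ENNReal.mul_lt_top ENNReal.ofReal_lt_top hg).ne h1
  rw [ENNReal.toReal_mul, ENNReal.toReal_ofReal (sq_nonneg k)] at h2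
  have h3 := Real.sqrt_le_sqrt h2
  rw [Real.sqrt_mul (sq_nonneg k), Real.sqrt_sq hk] at h3
  exact h3

theorem norm_energyWeight (c : ℝ) (f : Config l → ℂ) (Y : Config l) :
    ‖energyWeight m i c f Y‖ = (energy m i Y + 1) ^ c * ‖f Y‖ := by
  have h : 0 ≤ energy m i Y + 1 := by have := energy_nonneg m i Y; linarith
  rw [energyWeight, norm_mul, Complex.norm_real, Real.norm_of_nonneg (Real.rpow_nonneg h c)]

theorem l2Norm_energyCut_le (a b : ℝ) {f : Config l → ℂ} (hf : sqInt (configMeasure l) f < ⊤) :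
    l2Norm (configMeasure l) (energyCut m i a b f) ≤ l2Norm (configMeasure l) f :=
  Real.sqrt_le_sqrt (ENNReal.toReal_mono hf.ne (sqInt_energyCut_le m i a b f))

theorem norm_energyWeight_energyCut_le {a b c : ℝ} (hc : 0 ≤ c) (f : Config l → ℂ)
    (Y : Config l) :
    ‖energyWeight m i c (energyCut m i a b f) Y‖ ≤ b ^ c * ‖energyCut m i a b f Y‖ := by
  rw [norm_energyWeight]
  have h : 0 ≤ energy m i Y + 1 := by have := energy_nonneg m i Y; linarith
  by_cases hY : a ≤ energy m i Y + 1 ∧ energy m i Y + 1 < b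
  · gcongr
    exact hY.2.le
  · have : energyCut m i a b f Y = 0 := energyCut_of_not m i hY f
    simp [this]

theorem sqInt_energyWeight_energyCut_lt_top {a b c : ℝ} (hc : 0 ≤ c) {f : Config l → ℂ}
    (hf : IsWave f) : sqInt (configMeasure l) (energyWeight m i c (energyCut m i a b f)) < ⊤ := by
  have h1 : sqInt (configMeasure l) (energyWeight m i c (energyCut m i a b f))
      ≤ ENNReal.ofReal ((b ^ c) ^ 2) * sqInt (configMeasure l) (energyCut m i a b f) := by
    unfold sqInt
    rw [← lintegral_const_mul' _ _ ENNReal.ofReal_ne_top]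
    refine lintegral_mono fun x => ?_
    have := ENNReal.ofReal_le_ofReal (pow_le_pow_left₀ (norm_nonneg _)
      (norm_energyWeight_energyCut_le m i (a := a) (b := b) hc f x) 2)
    rw [mul_pow, ENNReal.ofReal_mul (sq_nonneg _)] at this
    simpa only [ENNReal.ofReal_pow (norm_nonneg _), ofReal_norm] using this
  exact h1.trans_lt (ENNReal.mul_lt_top ENNReal.ofReal_lt_top (hf.energyCut m i a b).lt_top)

theorem l2Norm_energyWeight_energyCut_le {a b c : ℝ} (hb : 0 ≤ b) (hc : 0 ≤ c) {f : Config l → ℂ}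
    (hf : IsWave f) : l2Norm (configMeasure l) (energyWeight m i c (energyCut m i a b f))
      ≤ b ^ c * l2Norm (configMeasure l) (energyCut m i a b f) :=
  l2Norm_mono (hf.energyCut m i a b).lt_top (by positivity)
    (norm_energyWeight_energyCut_le m i hc f)

theorem l2Norm_energyCut_le_energyWeight {a b c : ℝ} (ha : 0 < a) (hc : 0 ≤ c) {f : Config l → ℂ}
    (hf : sqInt (configMeasure l) (energyWeight m i c f) < ⊤) :
    l2Norm (configMeasure l) (energyCut m i a b f)
      ≤ a ^ (-c) * l2Norm (configMeasure l) (energyWeight m i c f) := by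
  refine l2Norm_mono hf (by positivity) fun Y => ?_
  have h : 0 ≤ energy m i Y + 1 := by have := energy_nonneg m i Y; linarith
  rw [norm_energyWeight, ← mul_assoc]
  by_cases hY : a ≤ energy m i Y + 1 ∧ energy m i Y + 1 < b
  · have e : energyCut m i a b f Y = f Y := energyCut_of_mem m i hY f
    rw [e]
    refine le_mul_of_one_le_left (norm_nonneg _) ?_
    rw [Real.rpow_neg ha.le, inv_mul_eq_div, one_le_div (by positivity)]
    gcongr
    exact hY.1
  · have e : energyCut m i a b f Y = 0 := energyCut_of_not m i hY f
    rw [e, norm_zero]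
    positivity

theorem energyCut_eq_sum (K : ℕ) (f : Config l → ℂ) (Y : Config l) :
    energyCut m i 1 (2 ^ K) f Y = ∑ k ∈ Finset.range K, energyCut m i (2 ^ k) (2 ^ (k + 1)) f Y := by
  induction K with
  | zero =>
    refine Set.indicator_of_notMem ?_ f
    simp only [Set.mem_ofPred_eq, pow_zero]
    intro h
    linarith [h.1, h.2]
  | succ K ih =>
    rw [Finset.sum_range_succ, ← ih]
    have h1 : (1 : ℝ) ≤ 2 ^ K := one_le_pow₀ (by norm_num)
    have h2 : (2 : ℝ) ^ K ≤ 2 ^ (K + 1) := pow_le_pow_right₀ (by norm_num) (by omega)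
    simp only [energyCut, Set.indicator, Set.mem_ofPred_eq]
    by_cases h3 : energy m i Y + 1 < 2 ^ K
    · have h4 : ¬ (2 : ℝ) ^ K ≤ energy m i Y + 1 := not_le.2 h3
      have h5 := h3.trans_le h2
      simp [h3, h4, h5]
    · have h4 := not_lt.1 h3
      have h5 := h1.trans h4
      simp [h3, h4, h5]

variable {S R : Fin n → Bool} {f : Config (addOcc S l) → ℂ} {g : Config (addOcc R l) → ℂ}

theorem sectorForm_sum_sum (hSR : ∀ i, R i = !S i) {G : (Fin n → Particle) → ℂ} (hG : Measurable G)
    (hGt : sqInt (kernelMeasure n) G < ⊤) (s : Finset ℕ) {F : ℕ → Config (addOcc S l) → ℂ}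
    {F' : ℕ → Config (addOcc R l) → ℂ} (hF : ∀ k, IsWave (F k)) (hF' : ∀ k, IsWave (F' k)) :
    sectorForm l S R G (fun Y => ∑ k ∈ s, F k Y) (fun Y => ∑ k ∈ s, F' k Y)
      = ∑ k ∈ s, ∑ k' ∈ s, sectorForm l S R G (F k) (F' k') := by
  unfold sectorForm
  simp_rw [Finset.sum_mul_sum, Finset.mul_sum]
  rw [integral_finsetSum _ fun k _ => integrable_finsetSum _ fun k' _ =>
    integrable_sectorForm hSR (hF k) (hF' k') hG hGt]
  refine Finset.sum_congr rfl fun k _ => ?_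
  rw [integral_finsetSum _ fun k' _ => integrable_sectorForm hSR (hF k) (hF' k') hG hGt]

/-- Cutting both wave functions amounts to restricting the integral to the set where both energies
plus 1 are below 2^K. These sets increase to the whole space and the integrand is integrable. -/
theorem norm_sectorForm_le_of_energyCut (hSR : ∀ i, R i = !S i) {G : (Fin n → Particle) → ℂ}
    (hG : Measurable G) (hGt : sqInt (kernelMeasure n) G < ⊤) (hf : IsWave f) (hg : IsWave g) {M : ℝ}
    (h : ∀ K : ℕ, ‖sectorForm l S R G (energyCut m i 1 (2 ^ K) f) (energyCut m i 1 (2 ^ K) g)‖ ≤ M) :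
    ‖sectorForm l S R G f g‖ ≤ M := by
  set Z : ℕ → Set ((Fin n → Particle) × Config l) := fun K =>
    {z | energy m i (insertFor S z.1 z.2) + 1 < 2 ^ K ∧ energy m i (insertFor R z.1 z.2) + 1 < 2 ^ K}
  have hZm : ∀ K, MeasurableSet (Z K) := fun K =>
    (measurableSet_lt (((measurable_energy m i _).comp (measurable_insertFor S l)).add_const 1)
      measurable_const).inter
    (measurableSet_lt (((measurable_energy m i _).comp (measurable_insertFor R l)).add_const 1)
      measurable_const)
  have hmono : Monotone Z := fun K K' hK z hz => by
    have : (2 : ℝ) ^ K ≤ 2 ^ K' := pow_le_pow_right₀ (by norm_num) hK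
    exact ⟨hz.1.trans_le this, hz.2.trans_le this⟩
  have hU : ⋃ K, Z K = Set.univ := by
    refine Set.eq_univ_of_forall fun z => Set.mem_iUnion.2 ?_
    obtain ⟨K, hK⟩ := pow_unbounded_of_one_lt (max (energy m i (insertFor S z.1 z.2) + 1)
      (energy m i (insertFor R z.1 z.2) + 1)) (by norm_num : (1 : ℝ) < 2)
    exact ⟨K, (le_max_left _ _).trans_lt hK, (le_max_right _ _).trans_lt hK⟩
  have hintg := integrable_sectorForm (l := l) hSR hf hg hG hGt
  have ht := tendsto_setIntegral_of_monotone hZm hmono (by rw [hU]; exact hintg.integrableOn)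
  rw [hU, setIntegral_univ] at ht
  refine le_of_tendsto ht.norm (Filter.Eventually.of_forall fun K => ?_)
  refine le_trans (le_of_eq ?_) (h K)
  rw [← integral_indicator (hZm K), sectorForm]
  congr 2 with z
  have e1 := energy_nonneg m i (insertFor S z.1 z.2)
  have e2 := energy_nonneg m i (insertFor R z.1 z.2)
  simp only [Z, energyCut, Set.indicator, Set.mem_ofPred_eq]
  by_cases h1 : energy m i (insertFor S z.1 z.2) + 1 < 2 ^ K <;>
    by_cases h2 : energy m i (insertFor R z.1 z.2) + 1 < 2 ^ K <;> simp [h1, h2, e1, e2]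

end Cutoff

/-! ### The bound in one sector -/

section SectorBound

variable {n : ℕ} (m : Fin (n + 1) → ℝ) (i : Fin (n + 1))

/-- The bound of the form in one sector, in terms of the weighted norms of the wave functions. -/
def SectorBound (s' θ' c C : ℝ) : Prop :=
  ∀ (l : Fin (n + 1) → ℕ) (S R : Fin (n + 1) → Bool), (∀ i, R i = !S i) →
    ∀ (f : Config (addOcc S l) → ℂ) (g : Config (addOcc R l) → ℂ), IsWave f → IsWave g →
    sqInt (configMeasure _) (energyWeight m i c f) < ⊤ →
    sqInt (configMeasure _) (energyWeight m i c g) < ⊤ →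
    ∀ (G : KernelSpace (n + 1)) (W : ℝ), 0 ≤ W →
    (∀ b : Finset (Mode × (Fin n → Mode)), ∑ p ∈ b,
      (‖∫ ξ, (pairMode i p ξ : ℂ) * G ξ ∂(kernelMeasure (n + 1))‖ * interpWeight m i s' θ' p.2) ^ 2
        ≤ W ^ 2) →
    sectorFactor l * ‖sectorForm l S R G f g‖
      ≤ C * W * (l2Norm (configMeasure _) (energyWeight m i c f)
          * l2Norm (configMeasure _) (energyWeight m i c g))

theorem energyWeight_zero {n : ℕ} (m : Fin n → ℝ) (i : Fin n) {l : Fin n → ℕ} (f : Config l → ℂ) :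
    energyWeight m i 0 f = f := by
  ext Y; simp [energyWeight]

/-- Reduction to bounded energies. The interpolated bound involves the norm with weight exponent
n/2, which may be infinite when only the one with exponent c is assumed finite; after the cut it is
finite. -/
theorem sectorBound_of_cut {s' θ' c C : ℝ}
    (h : ∀ (l : Fin (n + 1) → ℕ) (S R : Fin (n + 1) → Bool), (∀ i, R i = !S i) →
    ∀ (f : Config (addOcc S l) → ℂ) (g : Config (addOcc R l) → ℂ), IsWave f → IsWave g →
    sqInt (configMeasure _) (energyWeight m i c f) < ⊤ →
    sqInt (configMeasure _) (energyWeight m i c g) < ⊤ →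
    ∀ (G : KernelSpace (n + 1)) (W : ℝ), 0 ≤ W →
    (∀ b : Finset (Mode × (Fin n → Mode)), ∑ p ∈ b,
      (‖∫ ξ, (pairMode i p ξ : ℂ) * G ξ ∂(kernelMeasure (n + 1))‖ * interpWeight m i s' θ' p.2) ^ 2
        ≤ W ^ 2) → ∀ K : ℕ,
    sectorFactor l * ‖sectorForm l S R G (energyCut m i 1 (2 ^ K) f) (energyCut m i 1 (2 ^ K) g)‖
      ≤ C * W * (l2Norm (configMeasure _) (energyWeight m i c f)
          * l2Norm (configMeasure _) (energyWeight m i c g))) :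
    SectorBound m i s' θ' c C := by
  intro l S R hSR f g hf hg hfe hge G W hW hGW
  have hGm : Measurable G := (Lp.stronglyMeasurable G).measurable
  have hGt : sqInt (kernelMeasure (n + 1)) G < ⊤ :=
    (sqInt_lt_top_iff hGm.aestronglyMeasurable).2 (Lp.memLp G)
  rw [← le_div_iff₀' (sectorFactor_pos l)]
  refine norm_sectorForm_le_of_energyCut m i hSR hGm hGt hf hg fun K => ?_
  rw [le_div_iff₀' (sectorFactor_pos l)]
  exact h l S R hSR f g hf hg hfe hge G W hW hGW K

/-- For θ = 0 or θ = 1 one of the two norms has exponent zero, and for n = 0 the energy weight is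
trivial; the product of powers is then already the required norm. -/
theorem sectorBound_endpoint {s θ D : ℝ} (hθ₀ : 0 ≤ θ) (hθ₁ : θ ≤ 1) (hD : 0 < D)
    (hsD : ∀ b : Finset (Fin n → Mode), ∑ β ∈ b, ∏ j, modeEig (β j) ^ (-(2 * s)) ≤ D)
    (h : θ = 0 ∨ θ = 1 ∨ n = 0) : SectorBound m i s θ (n / 2 * (1 - θ)) (√D ^ θ) := by
  refine sectorBound_of_cut m i fun l S R hSR f g hf hg hfe hge G W hW hGW K => ?_
  set a : ℝ := 1
  set b : ℝ := 2 ^ K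
  have hb : 0 ≤ b := by positivity
  have hn : (0 : ℝ) ≤ n / 2 := by positivity
  have key := sectorForm_interpolation m i hSR (hf.energyCut m i a b) (hg.energyCut m i a b)
    (sqInt_energyWeight_energyCut_lt_top m i hn hf)
    (sqInt_energyWeight_energyCut_lt_top m i hn hg) (s := s) hθ₀ hθ₁ hD hsD G hW hGW
  refine key.trans ?_
  rw [mul_right_comm, mul_right_comm (√D ^ θ), mul_assoc (√D ^ θ * W)]
  refine mul_le_mul_of_nonneg_left ?_ (by positivity)
  have nn : ∀ {S : Fin (n + 1) → Bool} (f : Config (addOcc S l) → ℂ),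
    0 ≤ l2Norm (configMeasure _) f := fun f => l2Norm_nonneg _
  rcases h with rfl | rfl | rfl
  · rw [sub_zero, mul_one] at hfe hge ⊢
    rw [Real.rpow_zero, one_mul, Real.rpow_one, energyWeight_energyCut, energyWeight_energyCut]
    exact mul_le_mul (l2Norm_energyCut_le m i a b hfe) (l2Norm_energyCut_le m i a b hge) (nn _) (nn _)
  · rw [sub_self, mul_zero, energyWeight_zero, energyWeight_zero, Real.rpow_zero, Real.rpow_one, mul_one]
    exact mul_le_mul (l2Norm_energyCut_le m i a b hf.lt_top) (l2Norm_energyCut_le m i a b hg.lt_top)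
      (nn _) (nn _)
  · simp only [Nat.cast_zero, zero_div, zero_mul, energyWeight_zero]
    rw [← Real.rpow_add_of_nonneg (mul_nonneg (nn _) (nn _)) hθ₀ (by linarith)]
    rw [add_sub_cancel, Real.rpow_one]
    exact mul_le_mul (l2Norm_energyCut_le m i a b hf.lt_top) (l2Norm_energyCut_le m i a b hg.lt_top)
      (nn _) (nn _)

/-- Let x be the norm of f on the shell a ≤ E+1 < 2a. Its weighted norm there is at most (2a)^{n/2}
x, so the interpolated product is at most (2a)^{n(1-θ')/2} x, and x ≤ a^{-n(1-θ)/2} times the target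
norm. The power a^{-n(θ'-θ)/2} remains, and likewise for g with b. -/
theorem sectorForm_shell_le {s θ θ' D : ℝ} (hθ : θ ≤ 1) (hθ₀' : 0 ≤ θ') (hθ₁' : θ' ≤ 1)
    (hD : 0 < D)
    (hsD : ∀ b : Finset (Fin n → Mode), ∑ β ∈ b, ∏ j, modeEig (β j) ^ (-(2 * s)) ≤ D)
    {l : Fin (n + 1) → ℕ} {S R : Fin (n + 1) → Bool} (hSR : ∀ i, R i = !S i)
    {f : Config (addOcc S l) → ℂ} {g : Config (addOcc R l) → ℂ} (hf : IsWave f) (hg : IsWave g)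
    (hfe : sqInt (configMeasure _) (energyWeight m i (n / 2 * (1 - θ)) f) < ⊤)
    (hge : sqInt (configMeasure _) (energyWeight m i (n / 2 * (1 - θ)) g) < ⊤)
    (G : KernelSpace (n + 1)) {W : ℝ} (hW : 0 ≤ W)
    (hGW : ∀ b : Finset (Mode × (Fin n → Mode)), ∑ p ∈ b,
      (‖∫ ξ, (pairMode i p ξ : ℂ) * G ξ ∂(kernelMeasure (n + 1))‖ * interpWeight m i s θ' p.2) ^ 2 ≤ W ^ 2)
    {a b : ℝ} (ha : 0 < a) (hb : 0 < b) :
    sectorFactor l * ‖sectorForm l S R G (energyCut m i a (2 * a) f) (energyCut m i b (2 * b) g)‖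
      ≤ √D ^ θ' * (2 ^ (n / 2 * (1 - θ')) * 2 ^ (n / 2 * (1 - θ'))) * W
        * (l2Norm (configMeasure _) (energyWeight m i (n / 2 * (1 - θ)) f)
          * l2Norm (configMeasure _) (energyWeight m i (n / 2 * (1 - θ)) g))
        * (a ^ (-(n / 2 * (θ' - θ))) * b ^ (-(n / 2 * (θ' - θ)))) := by
  have hn : (0 : ℝ) ≤ n / 2 := by positivity
  have ha2 : (0 : ℝ) ≤ 2 * a := by positivity
  have hb2 : (0 : ℝ) ≤ 2 * b := by positivity
  have key := sectorForm_interpolation m i hSR (hf.energyCut m i a (2 * a))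
    (hg.energyCut m i b (2 * b)) (sqInt_energyWeight_energyCut_lt_top m i hn hf)
    (sqInt_energyWeight_energyCut_lt_top m i hn hg) (s := s) hθ₀' hθ₁' hD hsD G hW hGW
  refine key.trans ?_
  have hside : ∀ {S : Fin (n + 1) → Bool} {f : Config (addOcc S l) → ℂ}, IsWave f →
      sqInt (configMeasure _) (energyWeight m i (n / 2 * (1 - θ)) f) < ⊤ → ∀ {a : ℝ}, 0 < a →
      l2Norm (configMeasure _) (energyCut m i a (2 * a) f) ^ θ' *
        l2Norm (configMeasure _) (energyWeight m i (n / 2) (energyCut m i a (2 * a) f)) ^ (1 - θ')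
      ≤ 2 ^ (n / 2 * (1 - θ')) * a ^ (-(n / 2 * (θ' - θ)))
        * l2Norm (configMeasure _) (energyWeight m i (n / 2 * (1 - θ)) f) := by
    intro S f hf hfe a ha
    set x := l2Norm (configMeasure _) (energyCut m i a (2 * a) f)
    have hx : 0 ≤ x := l2Norm_nonneg _
    have h1 : l2Norm (configMeasure _) (energyWeight m i (n / 2) (energyCut m i a (2 * a) f))
        ≤ (2 * a) ^ ((n : ℝ) / 2) * x :=
      l2Norm_energyWeight_energyCut_le m i (by positivity) hn hf
    have h2 : x ≤ a ^ (-(n / 2 * (1 - θ))) * l2Norm (configMeasure _)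
        (energyWeight m i (n / 2 * (1 - θ)) f) :=
      l2Norm_energyCut_le_energyWeight m i ha (mul_nonneg hn (by linarith)) hfe
    calc _ ≤ x ^ θ' * ((2 * a) ^ ((n : ℝ) / 2) * x) ^ (1 - θ') := by
          refine mul_le_mul_of_nonneg_left ?_ (by positivity)
          exact Real.rpow_le_rpow (l2Norm_nonneg _) h1 (by linarith)
      _ = (2 * a) ^ (n / 2 * (1 - θ')) * x := by
          rw [Real.mul_rpow (by positivity) hx, ← Real.rpow_mul (by positivity), mul_left_comm,
            ← Real.rpow_add_of_nonneg hx hθ₀' (by linarith), add_sub_cancel, Real.rpow_one]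
      _ ≤ (2 * a) ^ (n / 2 * (1 - θ')) * (a ^ (-(n / 2 * (1 - θ))) * l2Norm (configMeasure _)
            (energyWeight m i (n / 2 * (1 - θ)) f)) := by gcongr
      _ = _ := by
          rw [Real.mul_rpow (by norm_num) ha.le]
          have : a ^ (-(n / 2 * (θ' - θ)))
              = a ^ ((n : ℝ) / 2 * (1 - θ')) * a ^ (-((n : ℝ) / 2 * (1 - θ))) := by
            rw [← Real.rpow_add ha]; congr 1; ring
          rw [this]; ring
  rw [Real.mul_rpow (l2Norm_nonneg _) (l2Norm_nonneg _), Real.mul_rpow (l2Norm_nonneg _) (l2Norm_nonneg _)]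
  have h3 := mul_le_mul (hside hf hfe ha) (hside hg hge hb)
    (mul_nonneg (Real.rpow_nonneg (l2Norm_nonneg _) _) (Real.rpow_nonneg (l2Norm_nonneg _) _))
    (mul_nonneg (by positivity) (l2Norm_nonneg _))
  have h4 := mul_le_mul_of_nonneg_left h3 (mul_nonneg (by positivity : 0 ≤ √D ^ θ') hW)
  calc _ = _ := ?_
    _ ≤ _ := h4
    _ = _ := ?_
  · ring
  · ring

theorem sum_geometric_le {q : ℝ} (hq0 : 0 ≤ q) (hq1 : q < 1) (K : ℕ) :
    ∑ k ∈ Finset.range K, q ^ k ≤ (1 - q)⁻¹ := by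
  rw [← tsum_geometric_of_lt_one hq0 hq1]
  exact (summable_geometric_of_lt_one hq0 hq1).sum_le_tsum _ fun k _ => by positivity

/-- The kernel need not conserve energy, so all pairs of shells of f and g interact and decay in
both indices is required. The strict inequality θ < θ' makes both sums geometric. -/
theorem sectorBound_interior {s θ θ' D : ℝ} (hn : 0 < n) (hθθ' : θ < θ') (hθ₀ : 0 ≤ θ)
    (hθ₁' : θ' ≤ 1) (hD : 0 < D)
    (hsD : ∀ b : Finset (Fin n → Mode), ∑ β ∈ b, ∏ j, modeEig (β j) ^ (-(2 * s)) ≤ D) :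
    SectorBound m i s θ' (n / 2 * (1 - θ)) (√D ^ θ' * (2 ^ (n / 2 * (1 - θ')) * 2 ^ (n / 2 * (1 - θ')))
      * ((1 - (2 : ℝ) ^ (-(n / 2 * (θ' - θ))))⁻¹ * (1 - (2 : ℝ) ^ (-(n / 2 * (θ' - θ))))⁻¹)) := by
  refine sectorBound_of_cut m i fun l S R hSR f g hf hg hfe hge G W hW hGW K => ?_
  have hGm : Measurable G := (Lp.stronglyMeasurable G).measurable
  have hGt : sqInt (kernelMeasure (n + 1)) G < ⊤ :=
    (sqInt_lt_top_iff hGm.aestronglyMeasurable).2 (Lp.memLp G)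
  set ε : ℝ := n / 2 * (θ' - θ)
  have hε : 0 < ε := mul_pos (by positivity) (by linarith)
  set q : ℝ := 2 ^ (-ε) with hq
  have hq0 : 0 ≤ q := by positivity
  have hq1 : q < 1 := Real.rpow_lt_one_of_one_lt_of_neg (by norm_num) (by linarith)
  have hpow : ∀ k : ℕ, ((2 : ℝ) ^ k) ^ (-ε) = q ^ k := fun k => by
    rw [hq, ← Real.rpow_natCast, ← Real.rpow_natCast, ← Real.rpow_mul (by norm_num),
      ← Real.rpow_mul (by norm_num), mul_comm]
  set C₀ := √D ^ θ' * (2 ^ (n / 2 * (1 - θ')) * 2 ^ (n / 2 * (1 - θ'))) * W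
        * (l2Norm (configMeasure _) (energyWeight m i (n / 2 * (1 - θ)) f)
          * l2Norm (configMeasure _) (energyWeight m i (n / 2 * (1 - θ)) g)) with hC₀
  have hC0 : 0 ≤ C₀ := mul_nonneg (by positivity) (mul_nonneg (l2Norm_nonneg _) (l2Norm_nonneg _))
  have e1 : ∀ {S : Fin (n + 1) → Bool} (f : Config (addOcc S l) → ℂ), energyCut m i 1 (2 ^ K) f
      = fun Y => ∑ k ∈ Finset.range K, energyCut m i (2 ^ k) (2 ^ (k + 1)) f Y := fun f =>
    funext fun Y => energyCut_eq_sum m i K f Y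
  rw [e1, e1, sectorForm_sum_sum hSR hGm hGt (Finset.range K) (fun k => hf.energyCut m i _ _)
    (fun k => hg.energyCut m i _ _)]
  calc _ ≤ sectorFactor l * ∑ k ∈ Finset.range K, ∑ k' ∈ Finset.range K, ‖sectorForm l S R G
        (energyCut m i (2 ^ k) (2 ^ (k + 1)) f) (energyCut m i (2 ^ k') (2 ^ (k' + 1)) g)‖ := by
        refine mul_le_mul_of_nonneg_left ?_ (sectorFactor_pos l).le
        exact (norm_sum_le _ _).trans (Finset.sum_le_sum fun k _ => norm_sum_le _ _)
    _ = ∑ k ∈ Finset.range K, ∑ k' ∈ Finset.range K, sectorFactor l * ‖sectorForm l S R G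
        (energyCut m i (2 ^ k) (2 ^ (k + 1)) f) (energyCut m i (2 ^ k') (2 ^ (k' + 1)) g)‖ := by
        simp_rw [Finset.mul_sum]
    _ ≤ ∑ k ∈ Finset.range K, ∑ k' ∈ Finset.range K, C₀ * (q ^ k * q ^ k') := by
        refine Finset.sum_le_sum fun k _ => Finset.sum_le_sum fun k' _ => ?_
        have := sectorForm_shell_le m i (hθθ'.le.trans hθ₁') (hθ₀.trans hθθ'.le) hθ₁' hD hsD hSR hf hg
          hfe hge G hW hGW (a := 2 ^ k) (b := 2 ^ k') (by positivity) (by positivity)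
        rw [← pow_succ', ← pow_succ', hpow, hpow] at this
        exact this
    _ = C₀ * ((∑ k ∈ Finset.range K, q ^ k) * ∑ k ∈ Finset.range K, q ^ k) := by
        rw [Finset.sum_mul_sum, Finset.mul_sum]
        simp_rw [Finset.mul_sum]
    _ ≤ C₀ * ((1 - q)⁻¹ * (1 - q)⁻¹) := by
        have hs := sum_geometric_le hq0 hq1 K
        have hs0 : 0 ≤ ∑ k ∈ Finset.range K, q ^ k := Finset.sum_nonneg fun k _ => by positivity
        gcongr
    _ = _ := by rw [hC₀]; ring

/-- Raising θ while keeping s'θ' = θs leaves the total power of the eigenvalues unchanged. There is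
room for this because s > 1/2 is a strict inequality. -/
theorem exists_sectorBound {s θ : ℝ} (hs : 1 / 2 < s) (hθ₀ : 0 ≤ θ) (hθ₁ : θ ≤ 1) :
    ∃ s' θ' C : ℝ, 0 ≤ C ∧ θ ≤ θ' ∧ θ' ≤ 1 ∧ s' * θ' = θ * s ∧
      SectorBound m i s' θ' (n / 2 * (1 - θ)) C := by
  by_cases h : θ = 0 ∨ θ = 1 ∨ n = 0
  · obtain ⟨D, hD, hsD⟩ := exists_sum_prod_modeEig_le hs n
    exact ⟨s, θ, √D ^ θ, by positivity, le_rfl, hθ₁, mul_comm _ _, sectorBound_endpoint m i hθ₀ hθ₁ hD hsD h⟩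
  · push Not at h
    have h0 : 0 < θ := lt_of_le_of_ne hθ₀ (Ne.symm h.1)
    have h1 : θ < 1 := lt_of_le_of_ne hθ₁ h.2.1
    have hn : 0 < n := Nat.pos_of_ne_zero h.2.2
    -- The midpoint of θ and 2θs, capped at 1: any θ' < 2θs keeps s' = θs/θ' above 1/2.
    set θ' := min 1 ((θ + 2 * (θ * s)) / 2)
    have hlt : θ < 2 * (θ * s) := by nlinarith
    have h2 : θ < θ' := lt_min h1 (by linarith)
    have h3 : θ' < 2 * (θ * s) := (min_le_right _ _).trans_lt (by linarith)
    have h4 : θ' ≤ 1 := min_le_left _ _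
    have h5 : 0 < θ' := h0.trans h2
    have hs' : 1 / 2 < θ * s / θ' := by
      rw [lt_div_iff₀ h5]; linarith
    obtain ⟨D, hD, hsD⟩ := exists_sum_prod_modeEig_le hs' n
    refine ⟨_, θ', _, ?_, h2.le, h4, div_mul_cancel₀ _ h5.ne',
      sectorBound_interior m i hn h2 hθ₀ h4 hD hsD⟩
    have hε : (0 : ℝ) < n / 2 * (θ' - θ) := mul_pos (by positivity) (by linarith)
    have hq1 : (2 : ℝ) ^ (-(n / 2 * (θ' - θ))) < 1 :=
      Real.rpow_lt_one_of_one_lt_of_neg (by norm_num) (by linarith)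
    have : 0 ≤ (1 - (2 : ℝ) ^ (-(n / 2 * (θ' - θ))))⁻¹ := inv_nonneg.2 (by linarith)
    positivity

/-- The exponent of the oscillators of a species of mass `m`. -/
noncomputable def oscExponent (s θ m : ℝ) : ℝ :=
  if 0 < m then θ * s else 1 / 12 + θ * (s - 1 / 12)

/-- A massless species has total exponent s'θ' + (1-θ')/12 ≤ θs + (1-θ)/12 = 1/12 + θ(s - 1/12), and
a massive one s'θ' = θs. The comparison uses that all eigenvalues are at least 1. -/
theorem exists_interpWeight_le {s θ s' θ' : ℝ} (hθθ' : θ ≤ θ') (h : s' * θ' = θ * s) :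
    ∃ C : ℝ, 0 < C ∧ ∀ β : Fin n → Mode, interpWeight m i s' θ' β
      ≤ C * ∏ j, modeEig (β j) ^ oscExponent s θ (m (i.succAbove j)) := by
  refine ⟨∏ j, √(massConst (m (i.succAbove j))) ^ (1 - θ'), Finset.prod_pos fun j _ =>
    Real.rpow_pos_of_pos (Real.sqrt_pos.2 (massConst_pos _)) _, fun β => ?_⟩
  unfold interpWeight energyEig
  have hp : ∀ (j : Fin n) (x : ℝ), 0 < modeEig (β j) ^ x := fun j x =>
    Real.rpow_pos_of_pos (modeEig_pos _) x
  rw [← Real.finsetProd_rpow _ _ fun j _ => (hp j _).le,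
    Real.sqrt_prod _ fun j _ => mul_nonneg (massConst_pos _).le (hp j _).le,
    ← Real.finsetProd_rpow _ _ fun j _ => Real.sqrt_nonneg _, ← Finset.prod_mul_distrib,
    ← Finset.prod_mul_distrib]
  refine Finset.prod_le_prod (fun j _ => mul_nonneg (Real.rpow_nonneg (hp j _).le _)
    (Real.rpow_nonneg (Real.sqrt_nonneg _) _)) fun j _ => ?_
  rw [Real.sqrt_mul (massConst_pos _).le, Real.mul_rpow (Real.sqrt_nonneg _) (Real.sqrt_nonneg _),
    mul_left_comm, Real.sqrt_eq_rpow (modeEig (β j) ^ _), ← Real.rpow_mul (modeEig_pos _).le, h,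
    ← Real.rpow_mul (modeEig_pos _).le, ← Real.rpow_mul (modeEig_pos _).le,
    ← Real.rpow_add (modeEig_pos _)]
  refine mul_le_mul_of_nonneg_left ?_ (Real.rpow_nonneg (Real.sqrt_nonneg _) _)
  refine Real.rpow_le_rpow_of_exponent_le (one_le_modeEig _) ?_
  unfold massExponent oscExponent
  split_ifs
  · linarith
  · linarith

end SectorBound

/-! ### Eigenvectors and products of powers of operators -/

section Scales

theorem opProd_append {E : Type} {L₁ L₂ : List (OpGraph E)} {x y : E} (h : opProd (L₁ ++ L₂) x y) :
    ∃ z, opProd L₂ x z ∧ opProd L₁ z y := by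
  induction L₁ generalizing y with
  | nil => exact ⟨y, h, rfl⟩
  | cons T Ts ih =>
    obtain ⟨z, hz, hy⟩ := h
    obtain ⟨w, hw, hz⟩ := ih hz
    exact ⟨w, hw, z, hz, hy⟩

variable {E : Type} [NormedAddCommGroup E] [InnerProductSpace ℂ E]

/-- `⟪u, T x⟫ = r ⟪u, x⟫` on the domain of `T`, as for an eigenvector `u` of a symmetric `T`. -/
def ScalesInner (u : E) (T : OpGraph E) (r : ℂ) : Prop :=
  ∀ x y, T x y → inner ℂ u y = r * inner ℂ u x

/-- In any spectral representation the image of the eigenvector u vanishes where f ≠ r, so against u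
the multiplication by f^a acts as r^a. The argument works in whichever representation is given, so
uniqueness of the power is not at issue. -/
theorem scalesInner_opPow {u : E} {T : OpGraph E} {r : ℝ} (hu : T u ((r : ℂ) • u)) (a : ℝ) :
    ScalesInner u (opPow T a) ((r ^ a : ℝ) : ℂ) := by
  rintro x y ⟨Ω, _, ν, U, f, -, -, hT, hy⟩
  rw [← U.inner_map_map u y, ← U.inner_map_map u x, L2.inner_def, L2.inner_def,
    ← integral_const_mul]
  have h := (hT _ _).1 hu
  rw [map_smul] at h
  refine integral_congr_ae ?_
  filter_upwards [h, hy, Lp.coeFn_smul (r : ℂ) (U u)] with w h₁ h₂ h₃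
  rw [h₃, Pi.smul_apply, smul_eq_mul] at h₁
  rw [h₂]
  by_cases h0 : U u w = 0
  · simp [h0]
  · have : r = f w := by exact_mod_cast mul_right_cancel₀ h0 h₁
    rw [this]
    simp only [RCLike.inner_apply]
    ring

theorem scalesInner_opProd_append {u : E} {L₁ L₂ : List (OpGraph E)} {r₁ r₂ : ℂ}
    (h₁ : ScalesInner u (opProd L₁) r₁) (h₂ : ScalesInner u (opProd L₂) r₂) :
    ScalesInner u (opProd (L₁ ++ L₂)) (r₁ * r₂) := by
  intro x y hxy
  obtain ⟨z, hz, hy⟩ := opProd_append hxy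
  rw [h₁ z y hy, h₂ x z hz, mul_assoc]

theorem scalesInner_opProd_flatMap {ι : Type*} {u : E} {g : ι → List (OpGraph E)} {r : ι → ℂ}
    (h : ∀ i, ScalesInner u (opProd (g i)) (r i)) (L : List ι) :
    ScalesInner u (opProd (L.flatMap g)) (L.map r).prod := by
  induction L with
  | nil =>
    rintro x y rfl
    simp
  | cons i L ih =>
    rw [List.flatMap_cons, List.map_cons, List.prod_cons]
    exact scalesInner_opProd_append (h i) ih

theorem scalesInner_opProd_map {ι : Type*} {u : E} {g : ι → OpGraph E} {r : ι → ℂ}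
    (h : ∀ i, ScalesInner u (g i) (r i)) (L : List ι) :
    ScalesInner u (opProd (L.map g)) (L.map r).prod := by
  induction L with
  | nil =>
    rintro x y rfl
    simp
  | cons i L ih =>
    rintro x y ⟨z, hz, hy⟩
    rw [List.map_cons, List.prod_cons, h i z y hy, ih x z hz, mul_assoc]

end Scales

/-! ### Hermite functions are eigenvectors of the oscillators -/

section Oscillator

variable {n : ℕ}

theorem measurePreserving_splitSpin (n : ℕ) :
    MeasurePreserving (MeasurableEquiv.arrowProdEquivProdArrow (Fin 3 → ℝ) (Fin 2) (Fin n))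
      (kernelMeasure n)
      ((volume : Measure (Fin n → Fin 3 → ℝ)).prod (Measure.pi fun _ => Measure.count)) :=
  measurePreserving_arrowProdEquivProdArrow (Fin 3 → ℝ) (Fin 2) (Fin n)
    (fun _ => volume) (fun _ => Measure.count)

/-- There are finitely many spin configurations, so the integrals can be compared in the momenta
alone; continuity and compact support give the integrability for Fubini. -/
theorem integral_kernelMeasure_congr {Φ₁ Φ₂ : (Fin n → Particle) → ℂ}
    (hc₁ : ∀ τ : Fin n → Fin 2, Continuous fun k : Fin n → Fin 3 → ℝ => Φ₁ fun i => (k i, τ i))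
    (hs₁ : ∀ τ : Fin n → Fin 2,
      HasCompactSupport fun k : Fin n → Fin 3 → ℝ => Φ₁ fun i => (k i, τ i))
    (hc₂ : ∀ τ : Fin n → Fin 2, Continuous fun k : Fin n → Fin 3 → ℝ => Φ₂ fun i => (k i, τ i))
    (hs₂ : ∀ τ : Fin n → Fin 2,
      HasCompactSupport fun k : Fin n → Fin 3 → ℝ => Φ₂ fun i => (k i, τ i))
    (h : ∀ τ : Fin n → Fin 2,
      ∫ k : Fin n → Fin 3 → ℝ, Φ₁ (fun i => (k i, τ i)) =
        ∫ k : Fin n → Fin 3 → ℝ, Φ₂ fun i => (k i, τ i)) :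
    ∫ ξ, Φ₁ ξ ∂kernelMeasure n = ∫ ξ, Φ₂ ξ ∂kernelMeasure n := by
  have key : ∀ {Φ : (Fin n → Particle) → ℂ},
      (∀ τ : Fin n → Fin 2, Continuous fun k : Fin n → Fin 3 → ℝ => Φ fun i => (k i, τ i)) →
      (∀ τ : Fin n → Fin 2,
        HasCompactSupport fun k : Fin n → Fin 3 → ℝ => Φ fun i => (k i, τ i)) →
      ∫ ξ, Φ ξ ∂kernelMeasure n = ∫ τ, (∫ k : Fin n → Fin 3 → ℝ, Φ fun i => (k i, τ i))
        ∂(Measure.pi fun _ : Fin n => (Measure.count : Measure (Fin 2))) := by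
    intro Φ hc hs
    have h₁ := (measurePreserving_splitSpin n).integral_comp'
      (fun z : (Fin n → Fin 3 → ℝ) × (Fin n → Fin 2) => Φ fun i => (z.1 i, z.2 i))
    have h₂ : ∫ ξ, Φ ξ ∂kernelMeasure n = _ := h₁
    rw [h₂]
    refine integral_prod_symm _ ?_
    have hm : Measurable fun z : (Fin n → Fin 3 → ℝ) × (Fin n → Fin 2) =>
        Φ fun i => (z.1 i, z.2 i) :=
      measurable_from_prod_countable_left fun τ => (hc τ).measurable
    refine (integrable_prod_iff' hm.aestronglyMeasurable).2
      ⟨Filter.Eventually.of_forall fun τ => (hc τ).integrable_of_hasCompactSupport (hs τ),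
        Integrable.of_finite⟩
  rw [key hc₁ hs₁, key hc₂ hs₂]
  simp only [h]

/-- The unit vector in the direction of `k_{i,j}`. -/
def axis (i : Fin n) (j : Fin 3) : Fin n → Fin 3 → ℝ := Pi.single i (Pi.single j 1)

theorem update_eq_add_axis (i : Fin n) (j : Fin 3) (k : Fin n → Fin 3 → ℝ) (t : ℝ) :
    Function.update k i (Function.update (k i) j t) = k + (t - k i j) • axis i j := by
  ext i' j'
  by_cases hi : i' = i
  · subst hi
    by_cases hj : j' = j
    · subst hj
      simp [axis]
    · simp [axis, hj]
  · simp [axis, hi]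

/-- Rewrites the slice derivative as an iterated directional derivative, the form suited to
integration by parts along an axis. -/
theorem oscExpr_apply (i : Fin n) (j : Fin 3) {χ : (Fin n → Particle) → ℂ} (τ : Fin n → Fin 2)
    (hχ : ContDiff ℝ ∞ fun k : Fin n → Fin 3 → ℝ => χ fun i => (k i, τ i))
    (k : Fin n → Fin 3 → ℝ) :
    oscExpr i j χ (fun i => (k i, τ i)) =
      - fderiv ℝ (fun k' => fderiv ℝ (fun k : Fin n → Fin 3 → ℝ => χ fun i => (k i, τ i)) k'
          (axis i j)) k (axis i j)
        + ((k i j ^ 2 : ℝ) : ℂ) * χ fun i => (k i, τ i) := by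
  set F : (Fin n → Fin 3 → ℝ) → ℂ := fun k => χ fun i => (k i, τ i) with hF
  have hslice : (fun t : ℝ => χ (Function.update (fun i => (k i, τ i)) i
      (Function.update (k i) j t, τ i))) = fun t => F (k + (t - k i j) • axis i j) := by
    funext t
    rw [← update_eq_add_axis, hF]
    dsimp only
    congr 1
    funext i'
    by_cases hi : i' = i
    · subst hi; simp
    · simp [hi]
  have hderiv : ∀ {H : (Fin n → Fin 3 → ℝ) → ℂ}, Differentiable ℝ H → ∀ t : ℝ,
      HasDerivAt (fun t => H (k + (t - k i j) • axis i j))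
        (fderiv ℝ H (k + (t - k i j) • axis i j) (axis i j)) t := by
    intro H hH t
    have h₁ : HasDerivAt (fun t : ℝ => k + (t - k i j) • axis i j) (axis i j) t := by
      simpa using (((hasDerivAt_id t).sub_const (k i j)).smul_const (axis i j)).const_add k
    exact (hH _).hasFDerivAt.comp_hasDerivAt t h₁
  have hd : Differentiable ℝ F := hχ.differentiable (by simp)
  have hd' : Differentiable ℝ fun k' => fderiv ℝ F k' (axis i j) :=
    ((hχ.fderiv_right (m := 1) (by norm_cast)).clm_apply contDiff_const).differentiable (by simp)
  unfold oscExpr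
  dsimp only
  rw [hslice, iteratedDeriv_succ, iteratedDeriv_one,
    funext fun t => (hderiv hd t).deriv, (hderiv hd' _).deriv]
  simp

theorem hasLineDerivAt_mul_axis (i : Fin n) (j : Fin 3) {A : (Fin n → Fin 3 → ℝ) → ℝ}
    (hA : ∀ k (t : ℝ), A (k + t • axis i j) = A k) {h : ℝ → ℝ} {h' : ℝ} (k : Fin n → Fin 3 → ℝ)
    (hh : HasDerivAt h h' (k i j)) :
    HasLineDerivAt ℝ (fun k => ((A k * h (k i j) : ℝ) : ℂ)) ((A k * h' : ℝ) : ℂ) k (axis i j) := by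
  unfold HasLineDerivAt
  simp only [hA]
  have hc : ∀ t : ℝ, (k + t • axis i j) i j = k i j + t := by
    intro t
    simp [axis]
  simp only [hc]
  refine HasDerivAt.ofReal_comp (f := fun t => A k * h (k i j + t)) ?_
  refine HasDerivAt.const_mul _ (HasDerivAt.comp_const_add (k i j) 0 ?_)
  simpa using hh

/-- Two integrations by parts along one axis, on which A is constant; F has compact support, so no
boundary terms occur, and the Hermite equation supplies the second derivative. -/
theorem integral_mul_second_deriv (i : Fin n) (j : Fin 3) {A : (Fin n → Fin 3 → ℝ) → ℝ}
    (hAc : Continuous A) (hA : ∀ k (t : ℝ), A (k + t • axis i j) = A k) (a : ℕ)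
    {F : (Fin n → Fin 3 → ℝ) → ℂ} (hF : ContDiff ℝ ∞ F) (hFs : HasCompactSupport F) :
    ∫ k, ((A k * hermFun a (k i j) : ℝ) : ℂ) *
        fderiv ℝ (fun k' => fderiv ℝ F k' (axis i j)) k (axis i j) =
      ∫ k, ((A k * (k i j ^ 2 * hermFun a (k i j) - oscEig a * hermFun a (k i j)) : ℝ) : ℂ) *
        F k := by
  set F₁ : (Fin n → Fin 3 → ℝ) → ℂ := fun k => fderiv ℝ F k (axis i j) with hF₁
  have hF₁d : ContDiff ℝ ∞ F₁ := (hF.fderiv_right (m := ∞) le_rfl).clm_apply contDiff_const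
  have hF₁s : HasCompactSupport F₁ := hFs.fderiv_apply ℝ (axis i j)
  have hF₂c : Continuous fun k => fderiv ℝ F₁ k (axis i j) :=
    ((hF₁d.fderiv_right (m := ∞) le_rfl).clm_apply contDiff_const).continuous
  have hF₂s : HasCompactSupport fun k => fderiv ℝ F₁ k (axis i j) :=
    hF₁s.fderiv_apply ℝ (axis i j)
  have hc₀ : Continuous (hermFun a) := continuous_gaussPoly _
  have hc₁ : Continuous (hermFun' a) := continuous_gaussPoly _
  have hintg : ∀ {h : ℝ → ℝ} {H : (Fin n → Fin 3 → ℝ) → ℂ}, Continuous h → Continuous H →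
      HasCompactSupport H →
      Integrable (fun k => ContinuousLinearMap.mul ℝ ℂ ((A k * h (k i j) : ℝ) : ℂ) (H k)) := by
    intro h H hh hH hHs
    refine Continuous.integrable_of_hasCompactSupport ?_ ?_
    · simp only [ContinuousLinearMap.mul_apply']
      fun_prop
    · simp only [ContinuousLinearMap.mul_apply']
      exact hHs.mul_left
  have h₁ := integral_bilinear_hasLineDerivAt_right_eq_neg_left_of_integrable
    (μ := volume) (B := ContinuousLinearMap.mul ℝ ℂ) (v := axis i j)
    (hintg hc₁ hF₁d.continuous hF₁s) (hintg hc₀ hF₂c hF₂s) (hintg hc₀ hF₁d.continuous hF₁s)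
    (fun k _ => hasLineDerivAt_mul_axis i j hA k (hasDerivAt_hermFun a (k i j)))
    (fun k _ => ((hF₁d.differentiable (by simp)) k).hasFDerivAt.hasLineDerivAt _)
  have h₂ := integral_bilinear_hasLineDerivAt_right_eq_neg_left_of_integrable
    (μ := volume) (B := ContinuousLinearMap.mul ℝ ℂ) (v := axis i j)
    (hintg (h := fun x => x ^ 2 * hermFun a x - oscEig a * hermFun a x) (by fun_prop)
      hF.continuous hFs) (hintg hc₁ hF₁d.continuous hF₁s) (hintg hc₁ hF.continuous hFs)
    (fun k _ => hasLineDerivAt_mul_axis i j hA k (hasDerivAt_hermFun' a (k i j)))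
    (fun k _ => ((hF.differentiable (by simp)) k).hasFDerivAt.hasLineDerivAt _)
  simp only [ContinuousLinearMap.mul_apply'] at h₁ h₂
  rw [h₁, h₂, neg_neg]

theorem continuous_particleMode (a : Mode) (τ : Fin 2) :
    Continuous fun k : Fin 3 → ℝ => particleMode a (k, τ) := by
  have hc : ∀ a, Continuous (hermFun a) := fun a => continuous_gaussPoly _
  refine Continuous.mul (g := fun _ => if τ = a.2 then (1 : ℝ) else 0) ?_ continuous_const
  dsimp only
  fun_prop

theorem exists_kernelMode_eq_mul (α : Fin n → Mode) (τ : Fin n → Fin 2) (i : Fin n) (j : Fin 3) :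
    ∃ A : (Fin n → Fin 3 → ℝ) → ℝ, Continuous A ∧
      (∀ k (t : ℝ), A (k + t • axis i j) = A k) ∧
      ∀ k, kernelMode α (fun i => (k i, τ i)) = A k * hermFun ((α i).1 j) (k i j) := by
  have hc : ∀ a, Continuous (hermFun a) := fun a => continuous_gaussPoly _
  refine ⟨fun k => (∏ i' ∈ Finset.univ.erase i, particleMode (α i') (k i', τ i')) *
    ((∏ j' ∈ Finset.univ.erase j, hermFun ((α i).1 j') (k i j')) *
      if τ i = (α i).2 then 1 else 0), ?_, ?_, ?_⟩
  · refine Continuous.mul (continuous_finsetProd _ fun i' _ =>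
      (continuous_particleMode (α i') (τ i')).comp (continuous_apply i')) (Continuous.mul ?_ ?_)
    · fun_prop
    · exact continuous_const
  · intro k t
    dsimp only
    congr 1
    · refine Finset.prod_congr rfl fun i' hi' => ?_
      simp [axis, Finset.ne_of_mem_erase hi']
    · congr 1
      refine Finset.prod_congr rfl fun j' hj' => ?_
      simp [axis, Finset.ne_of_mem_erase hj']
  · intro k
    unfold kernelMode
    rw [← Finset.mul_prod_erase _ _ (Finset.mem_univ i)]
    conv_lhs => rw [particleMode, ← Finset.mul_prod_erase _ _ (Finset.mem_univ j)]
    ring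

/-- At fixed spins a mode is a Hermite function of k_{i,j} times a factor independent of that
variable, so the distributional eigenvalue equation reduces to `integral_mul_second_deriv`. -/
theorem oscillator_kernelMode (α : Fin n → Mode) (i : Fin n) (j : Fin 3) :
    oscillator i j ((isModeSystem_kernelMode n).toLp α)
      (((oscEig ((α i).1 j) : ℝ) : ℂ) • (isModeSystem_kernelMode n).toLp α) := by
  intro χ hχ
  have hcoe := (isModeSystem_kernelMode n).coeFn_toLp α
  have hL : ∫ ξ, (((oscEig ((α i).1 j) : ℝ) : ℂ) • (isModeSystem_kernelMode n).toLp α) ξ * χ ξ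
      ∂kernelMeasure n =
      ∫ ξ, ((oscEig ((α i).1 j) : ℝ) : ℂ) * (kernelMode α ξ : ℂ) * χ ξ ∂kernelMeasure n := by
    refine integral_congr_ae ?_
    filter_upwards [hcoe, Lp.coeFn_smul ((oscEig ((α i).1 j) : ℝ) : ℂ)
      ((isModeSystem_kernelMode n).toLp α)] with ξ h₁ h₂
    rw [h₂, Pi.smul_apply, h₁, smul_eq_mul]
  have hR : ∫ ξ, (isModeSystem_kernelMode n).toLp α ξ * oscExpr i j χ ξ ∂kernelMeasure n =
      ∫ ξ, (kernelMode α ξ : ℂ) * oscExpr i j χ ξ ∂kernelMeasure n := by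
    refine integral_congr_ae ?_
    filter_upwards [hcoe] with ξ h₁
    rw [h₁]
  rw [hL, hR]
  have hmode : ∀ τ : Fin n → Fin 2,
      Continuous fun k : Fin n → Fin 3 → ℝ => kernelMode α fun i => (k i, τ i) := by
    intro τ
    exact continuous_finsetProd _ fun i' _ =>
      (continuous_particleMode (α i') (τ i')).comp (continuous_apply i')
  have hd₁ := fun τ => ((hχ τ).1.fderiv_right (m := ∞) le_rfl).clm_apply
    (contDiff_const (c := axis i j))
  have hc₂ := fun τ => (((hd₁ τ).fderiv_right (m := ∞) le_rfl).clm_apply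
    (contDiff_const (c := axis i j))).continuous
  have hs₂ := fun τ => ((hχ τ).2.fderiv_apply ℝ (axis i j)).fderiv_apply ℝ (axis i j)
  have hosc : ∀ τ : Fin n → Fin 2, (Continuous fun k : Fin n → Fin 3 → ℝ =>
      oscExpr i j χ fun i => (k i, τ i)) ∧ HasCompactSupport fun k : Fin n → Fin 3 → ℝ =>
      oscExpr i j χ fun i => (k i, τ i) := by
    intro τ
    have hχc := (hχ τ).1.continuous
    simp only [oscExpr_apply i j τ (hχ τ).1]
    constructor
    · exact (hc₂ τ).neg.add (Continuous.mul (by fun_prop) hχc)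
    · exact (hs₂ τ).neg.add (hχ τ).2.mul_left
  refine integral_kernelMeasure_congr (fun τ => ?_) (fun τ => (hχ τ).2.mul_left) (fun τ => ?_)
    (fun τ => (hosc τ).2.mul_left) fun τ => ?_
  · exact (continuous_const.mul (Complex.continuous_ofReal.comp (hmode τ))).mul
      (hχ τ).1.continuous
  · exact (Complex.continuous_ofReal.comp (hmode τ)).mul (hosc τ).1
  · obtain ⟨A, hAc, hA, hAk⟩ := exists_kernelMode_eq_mul α τ i j
    have hparts := integral_mul_second_deriv i j hAc hA ((α i).1 j) (hχ τ).1 (hχ τ).2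
    simp only [oscExpr_apply i j τ (hχ τ).1, mul_add, mul_neg]
    have hm := hmode τ
    have hχc := (hχ τ).1.continuous
    have h2c := hc₂ τ
    rw [integral_add, integral_neg]
    · simp only [hAk]
      rw [hparts, ← integral_neg, ← integral_add]
      · refine integral_congr_ae (Filter.Eventually.of_forall fun k => ?_)
        dsimp only
        push_cast
        ring
      · refine (Continuous.integrable_of_hasCompactSupport ?_ ?_).neg
        · have : Continuous (hermFun ((α i).1 j)) := continuous_gaussPoly _
          exact Continuous.mul (by fun_prop) hχc
        · exact (hχ τ).2.mul_left
      · simp only [← hAk]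
        refine Continuous.integrable_of_hasCompactSupport
          ((Complex.continuous_ofReal.comp hm).mul (Continuous.mul (by fun_prop) hχc)) ?_
        exact (hχ τ).2.mul_left.mul_left
    · refine (Continuous.integrable_of_hasCompactSupport ?_ ?_).neg
      · exact (Complex.continuous_ofReal.comp hm).mul h2c
      · exact (hs₂ τ).mul_left
    · refine Continuous.integrable_of_hasCompactSupport
        ((Complex.continuous_ofReal.comp hm).mul (Continuous.mul (by fun_prop) hχc)) ?_
      exact (hχ τ).2.mul_left.mul_left

/-- The coefficients of `W_{i₀} G` in the Hermite basis. -/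
theorem integral_pairMode_mul_of_weightOp {m : Fin (n + 1) → ℝ} (hm : ∀ i, 0 ≤ m i) {s θ : ℝ}
    {i₀ : Fin (n + 1)} {G F : KernelSpace (n + 1)} (h : weightOp m s θ i₀ G F)
    (p : Mode × (Fin n → Mode)) :
    ∫ ξ, (pairMode i₀ p ξ : ℂ) * F ξ ∂kernelMeasure (n + 1) =
      ((∏ j, modeEig (p.2 j) ^ oscExponent s θ (m (i₀.succAbove j)) : ℝ) : ℂ) *
        ∫ ξ, (pairMode i₀ p ξ : ℂ) * G ξ ∂kernelMeasure (n + 1) := by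
  set α : Fin (n + 1) → Mode := i₀.insertNth p.1 p.2 with hα
  set u := (isModeSystem_kernelMode (n + 1)).toLp α with hu
  have hpow : ∀ (a : ℝ) (i : Fin (n + 1)) (j : Fin 3),
      ScalesInner u (opPow (oscillator i j) a) ((oscEig ((α i).1 j) ^ a : ℝ) : ℂ) :=
    fun a i j => scalesInner_opPow (oscillator_kernelMode α i j) a
  have hprod : ∀ (a : ℝ) (L : List (Fin (n + 1))),
      ScalesInner u (opProd (L.flatMap fun i =>
        (List.finRange 3).map fun j => opPow (oscillator i j) a))
        (L.map fun i => ((modeEig (α i) ^ a : ℝ) : ℂ)).prod := by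
    intro a L
    refine scalesInner_opProd_flatMap (fun i => ?_) L
    convert scalesInner_opProd_map (hpow a i) (List.finRange 3) using 1
    rw [modeEig, ← Real.finsetProd_rpow _ _ fun j _ => (oscEig_pos _).le, ← Fin.prod_univ_def,
      Complex.ofReal_prod]
  have hscale := scalesInner_opProd_append
    (hprod (θ * s) ((List.finRange (n + 1)).filter fun i => i ≠ i₀ ∧ 0 < m i))
    (hprod (1 / 12 + θ * (s - 1 / 12)) ((List.finRange (n + 1)).filter fun i => i ≠ i₀ ∧ m i = 0))
    G F h
  rw [hu, (isModeSystem_kernelMode (n + 1)).inner_toLp,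
    (isModeSystem_kernelMode (n + 1)).inner_toLp] at hscale
  refine hscale.trans ?_
  congr 1
  -- Species i₀ is in neither list, and every other species is in exactly one of them because masses
  -- are nonnegative; the two list products thus merge into one product over the other species.
  rw [← List.prod_toFinset _ ((List.nodup_finRange _).filter _),
    ← List.prod_toFinset _ ((List.nodup_finRange _).filter _), List.toFinset_filter,
    List.toFinset_filter, List.toFinset_finRange, Finset.prod_filter, Finset.prod_filter,
    ← Finset.prod_mul_distrib, Fin.prod_univ_succAbove _ i₀, Complex.ofReal_prod]
  simp only [ne_eq, not_true_eq_false, false_and, decide_false, Bool.false_eq_true, if_false,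
    one_mul]
  refine Finset.prod_congr rfl fun j _ => ?_
  have hαj : α (i₀.succAbove j) = p.2 j := by simp [hα]
  rw [hαj]
  rcases (hm (i₀.succAbove j)).lt_or_eq with h0 | h0
  · simp [h0, h0.ne', oscExponent, Fin.succAbove_ne]
  · simp [← h0, oscExponent, Fin.succAbove_ne]

end Oscillator

/-! ### Products of annihilation operators -/

theorem apply_congr_config {n : ℕ} (Ψ : ∀ l : Fin n → ℕ, Config l → ℂ) {l₁ l₂ : Fin n → ℕ}
    {X₁ : Config l₁} {X₂ : Config l₂} (hl : ∀ i, l₁ i = l₂ i) (hX : ∀ i, HEq (X₁ i) (X₂ i)) :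
    Ψ l₁ X₁ = Ψ l₂ X₂ := by
  obtain rfl : l₁ = l₂ := funext hl
  obtain rfl : X₁ = X₂ := funext fun i => eq_of_heq (hX i)
  rfl

theorem heq_addIf_addIf {N : ℕ} {b₁ b₂ b₃ : Bool} {ξ₁ ξ₂ ξ₃ : Particle} (x : Fin N → Particle)
    (h₁₂ : b₁ = true → b₂ = false) (h₃ : b₃ = (b₁ || b₂)) (h₁ : b₁ = true → ξ₁ = ξ₃)
    (h₂ : b₂ = true → ξ₂ = ξ₃) :
    HEq (addIf b₁ ξ₁ (addIf b₂ ξ₂ x)) (addIf b₃ ξ₃ x) := by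
  subst h₃
  cases b₁ <;> cases b₂
  · exact HEq.rfl
  · obtain rfl := h₂ rfl
    exact HEq.rfl
  · obtain rfl := h₁ rfl
    exact HEq.rfl
  · exact absurd (h₁₂ rfl) (by simp)

/-- Operators of distinct species act on distinct slots, so the factors √(lᵢ+1) do not influence
each other, and the order of the list affects only a sign determined by the occupation numbers. -/
theorem exists_annihilateList_eq {n : ℕ} {L : List (Fin n)} (hL : L.Nodup) (l : Fin n → ℕ) :
    ∃ ε : ℂ, ‖ε‖ = 1 ∧ ∀ (ξ : Fin n → Particle) (Ψ : ∀ l : Fin n → ℕ, Config l → ℂ) (X : Config l),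
      annihilateList L ξ Ψ l X =
        ε * (√(∏ i, if i ∈ L then (l i : ℝ) + 1 else 1) : ℝ) *
          Ψ (addOcc (fun i => decide (i ∈ L)) l) (insertFor (fun i => decide (i ∈ L)) ξ X) := by
  induction L generalizing l with
  | nil =>
    refine ⟨1, norm_one, fun ξ Ψ X => ?_⟩
    simp only [annihilateList, List.foldr_nil, List.not_mem_nil, if_false, Finset.prod_const_one,
      Real.sqrt_one, Complex.ofReal_one, one_mul]
    exact apply_congr_config Ψ (fun i => by simp [addOcc]) fun i => HEq.rfl
  | cons i L ih =>
    obtain ⟨hi, hL⟩ := List.nodup_cons.1 hL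
    obtain ⟨ε, hε, h⟩ := ih hL (incr i l)
    refine ⟨(-1) ^ (∑ j ∈ Finset.univ.filter (· < i), l j) * ε, by simp [hε], fun ξ Ψ X => ?_⟩
    have hstep : annihilateList (i :: L) ξ Ψ l X =
      (-1) ^ (∑ j ∈ Finset.univ.filter (· < i), l j) * (√((l i : ℝ) + 1) : ℂ) *
        annihilateList L ξ Ψ (incr i l) (insertParticle i (ξ i) X) := rfl
    have hprod : √(∏ i', if i' ∈ i :: L then (l i' : ℝ) + 1 else 1) =
        √((l i : ℝ) + 1) * √(∏ i', if i' ∈ L then ((incr i l i' : ℕ) : ℝ) + 1 else 1) := by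
      rw [← Real.sqrt_mul (by positivity)]
      congr 1
      have h₁ : ((l i : ℝ) + 1) = ∏ i', if i' = i then (l i' : ℝ) + 1 else 1 := by
        rw [Finset.prod_ite_eq' Finset.univ i]
        simp
      rw [h₁, ← Finset.prod_mul_distrib]
      refine Finset.prod_congr rfl fun i' _ => ?_
      by_cases h₂ : i' = i
      · subst h₂
        simp [hi]
      · simp [h₂, incr]
    have hΨ : Ψ (addOcc (fun i' => decide (i' ∈ L)) (incr i l))
        (insertFor (fun i' => decide (i' ∈ L)) ξ (insertParticle i (ξ i) X)) =
        Ψ (addOcc (fun i' => decide (i' ∈ i :: L)) l)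
          (insertFor (fun i' => decide (i' ∈ i :: L)) ξ X) := by
      refine apply_congr_config Ψ (fun i' => ?_) fun i' => ?_
      · by_cases h₂ : i' = i
        · subst h₂
          simp [addOcc, incr, hi]
        · simp [addOcc, incr, h₂]
      · refine heq_addIf_addIf (X i') ?_ ?_ (fun _ => rfl) ?_
        · intro h₂
          have h₃ : i' ∈ L := by simpa using h₂
          have h₄ : i' ≠ i := fun h₅ => hi (h₅ ▸ h₃)
          simp [h₄]
        · simp [Bool.or_comm]
        · intro h₂
          have h₃ : i' = i := by simpa using h₂
          rw [h₃]
    rw [hstep, h, hΨ, hprod]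
    push_cast
    ring

theorem exists_interactionIntegrand_eq {n : ℕ} (p : ℕ) (l : Fin n → ℕ) :
    ∃ ε : ℂ, ‖ε‖ = 1 ∧ ∀ (G : KernelSpace n) (φ ψ : FockSpace n)
      (z : (Fin n → Particle) × Config l),
      interactionIntegrand p G φ ψ l z = ε * (sectorFactor l : ℝ) * (G z.1 *
        (conj (component φ (addOcc (fun i => decide (i.val < p)) l)
            (insertFor (fun i => decide (i.val < p)) z.1 z.2)) *
          component ψ (addOcc (fun i => !decide (i.val < p)) l)
            (insertFor (fun i => !decide (i.val < p)) z.1 z.2))) := by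
  obtain ⟨ε₁, hε₁, h₁⟩ := exists_annihilateList_eq
    (List.nodup_reverse.2 ((List.nodup_finRange n).filter fun i => i.val < p)) l
  obtain ⟨ε₂, hε₂, h₂⟩ := exists_annihilateList_eq
    ((List.nodup_finRange n).filter fun i => p ≤ i.val) l
  refine ⟨conj ε₁ * ε₂, by simp [hε₁, hε₂], fun G φ ψ z => ?_⟩
  have hS : (fun i : Fin n =>
      decide (i ∈ ((List.finRange n).filter fun i => i.val < p).reverse)) =
      fun i => decide (i.val < p) := by
    funext i; simp
  have hR : (fun i : Fin n => decide (i ∈ (List.finRange n).filter fun i => p ≤ i.val)) =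
      fun i => !decide (i.val < p) := by
    funext i
    by_cases h : i.val < p
    · simp [h]
    · simp [h, not_lt.1 h]
  rw [interactionIntegrand, h₁, h₂, hS, hR, map_mul, map_mul, Complex.conj_ofReal]
  have hfac : √(∏ i, if i ∈ ((List.finRange n).filter fun i => i.val < p).reverse
        then (l i : ℝ) + 1 else 1) *
      √(∏ i, if i ∈ (List.finRange n).filter fun i => p ≤ i.val then (l i : ℝ) + 1 else 1) =
      sectorFactor l := by
    rw [← Real.sqrt_mul (Finset.prod_nonneg fun i _ => by split_ifs <;> positivity),
      ← Finset.prod_mul_distrib, sectorFactor]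
    refine congrArg _ (Finset.prod_congr rfl fun i _ => ?_)
    by_cases h : i.val < p
    · simp [h]
    · simp [h, not_lt.1 h]
  rw [← hfac]
  push_cast
  ring

/-! ### Antisymmetric representatives -/

/-- The average of sgn(σ) f∘σ over all permutations is antisymmetric at every point and agrees with
f almost everywhere. Pointwise antisymmetry is needed because the estimates restrict f to fibres. -/
theorem exists_isWave_ae_eq {n : ℕ} {l : Fin n → ℕ} (f : Sector l) :
    ∃ g : Config l → ℂ, IsWave g ∧ g =ᵐ[configMeasure l] (f : Lp ℂ 2 (configMeasure l)) := by
  have hfm : Measurable (f : Lp ℂ 2 (configMeasure l)) := (Lp.stronglyMeasurable _).measurable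
  set f₀ : Config l → ℂ := ((f : Lp ℂ 2 (configMeasure l)) : Config l → ℂ) with hf₀
  set sgn : (∀ i, Equiv.Perm (Fin (l i))) → ℂ :=
    fun σ => ((∏ i, (Equiv.Perm.sign (σ i) : ℤ) : ℤ) : ℂ) with hsgn
  have hmul : ∀ σ ρ, sgn (σ * ρ) = sgn σ * sgn ρ := fun σ ρ => by
    simp only [hsgn, Pi.mul_apply, Equiv.Perm.sign_mul, Units.val_mul, Finset.prod_mul_distrib,
      Int.cast_mul]
  have hsq : ∀ σ, sgn σ * sgn σ = 1 := fun σ => by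
    simp only [hsgn, ← Int.cast_mul, ← Finset.prod_mul_distrib, Int.units_coe_mul_self,
      Finset.prod_const_one, Int.cast_one]
  set N : ℂ := (Fintype.card (∀ i, Equiv.Perm (Fin (l i))) : ℂ) with hN
  have hN0 : N ≠ 0 := by
    rw [hN]
    exact_mod_cast Fintype.card_ne_zero
  set g : Config l → ℂ := fun X => N⁻¹ * ∑ σ, sgn σ * f₀ (permute σ X) with hg
  have hgm : Measurable g := measurable_const.mul (Finset.measurable_sum _ fun σ _ =>
    measurable_const.mul (hfm.comp (measurePreserving_permute σ).measurable))
  have hga : IsAntisymmConfig g := by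
    intro ρ X
    change g (permute ρ X) = sgn ρ * g X
    simp only [hg]
    rw [mul_left_comm]
    congr 1
    rw [Finset.mul_sum, ← Equiv.sum_comp (Equiv.mulLeft ρ)
      fun σ => sgn ρ * (sgn σ * f₀ (permute σ X))]
    refine Finset.sum_congr rfl fun σ _ => ?_
    rw [Equiv.coe_mulLeft, hmul, ← mul_assoc, ← mul_assoc, hsq, one_mul]
    rfl
  have hge : g =ᵐ[configMeasure l] f₀ := by
    have h : ∀ᵐ X ∂configMeasure l, ∀ σ : ∀ i, Equiv.Perm (Fin (l i)),
        f₀ (permute σ X) = sgn σ * f₀ X := ae_all_iff.2 fun σ => f.2 σ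
    filter_upwards [h] with X hX
    simp only [hg, hX, ← mul_assoc, hsq, one_mul, Finset.sum_const, Finset.card_univ,
      nsmul_eq_mul]
    rw [← hN, inv_mul_cancel₀ hN0, one_mul]
  refine ⟨g, ⟨hgm, hga, ?_⟩, hge⟩
  exact (sqInt_lt_top_iff hgm.aestronglyMeasurable).2 ((memLp_congr_ae hge).2 (Lp.memLp _))

theorem IsWave.conj {n : ℕ} {l : Fin n → ℕ} {f : Config l → ℂ} (hf : IsWave f) :
    IsWave fun X => conj (f X) where
  measurable := Complex.continuous_conj.measurable.comp hf.measurable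
  antisymm σ X := by
    dsimp only
    rw [hf.antisymm σ X, map_mul, map_intCast]
  lt_top := by
    have := hf.lt_top
    unfold sqInt at this ⊢
    simpa using this

theorem sqInt_congr_norm {X : Type*} [MeasurableSpace X] {μ : Measure X} {f g : X → ℂ}
    (h : ∀ᵐ x ∂μ, ‖f x‖ = ‖g x‖) : sqInt μ f = sqInt μ g := by
  refine lintegral_congr_ae ?_
  filter_upwards [h] with x hx
  rw [← ofReal_norm, hx, ofReal_norm]

/-! ### The domain of the free energy -/

theorem component_memLp {n : ℕ} (φ : FockSpace n) (l : Fin n → ℕ) :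
    MemLp (component φ l) 2 (configMeasure l) := Lp.memLp _

theorem norm_apply_eq_l2Norm {n : ℕ} (φ : FockSpace n) (l : Fin n → ℕ) :
    ‖φ l‖ = l2Norm (configMeasure l) (component φ l) :=
  (l2Norm_eq_norm ((φ l : Sector l) : Lp ℂ 2 (configMeasure l))).symm

theorem summable_norm_sq {n : ℕ} (φ : FockSpace n) : Summable fun l => ‖φ l‖ ^ 2 := by
  simpa using (lp.memℓp φ).summable (by simp)

theorem norm_sq_eq_tsum {n : ℕ} (φ : FockSpace n) : ‖φ‖ ^ 2 = ∑' l, ‖φ l‖ ^ 2 := by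
  simpa using lp.norm_rpow_eq_tsum (p := 2) (by simp) φ

theorem add_one_rpow_le {c E : ℝ} (hc : 0 ≤ c) (hE : 0 ≤ E) :
    (E + 1) ^ c ≤ 2 ^ c * (E ^ c + 1) := by
  rcases le_total E 1 with h | h
  · have h₁ : (E + 1) ^ c ≤ 2 ^ c := Real.rpow_le_rpow (by linarith) (by linarith) hc
    have h₂ : (0 : ℝ) ≤ 2 ^ c * E ^ c := by positivity
    linarith
  · have h₁ : (E + 1) ^ c ≤ (2 * E) ^ c := Real.rpow_le_rpow (by linarith) (by linarith) hc
    rw [Real.mul_rpow (by norm_num) hE] at h₁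
    have h₂ : (0 : ℝ) ≤ 2 ^ c := by positivity
    linarith

section FreeEnergy

variable {n : ℕ} {m : Fin n → ℝ} {i₀ : Fin n} {c : ℝ} {φ η₀ : FockSpace n}

theorem sqInt_energyWeight_component_le (hc : 0 ≤ c)
    (h : freeEnergyFun m i₀ (fun x => x ^ c) φ η₀) (l : Fin n → ℕ) :
    sqInt (configMeasure l) (energyWeight m i₀ c (component φ l)) ≤
      ENNReal.ofReal (2 * (2 ^ c) ^ 2) * (sqInt (configMeasure l) (component η₀ l) +
        sqInt (configMeasure l) (component φ l)) := by
  unfold sqInt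
  rw [← lintegral_add_right', ← lintegral_const_mul' _ _ ENNReal.ofReal_ne_top]
  · refine lintegral_mono_ae ?_
    filter_upwards [h l] with X hX
    have hE := energy_nonneg m i₀ X
    have h₁ : ‖energyWeight m i₀ c (component φ l) X‖ =
        (energy m i₀ X + 1) ^ c * ‖component φ l X‖ := by
      rw [energyWeight, norm_mul, Complex.norm_real, Real.norm_of_nonneg (by positivity)]
    have h₂ : ‖component η₀ l X‖ = energy m i₀ X ^ c * ‖component φ l X‖ := by
      rw [hX, norm_mul, Complex.norm_real, Real.norm_of_nonneg (by positivity)]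
    have h₃ : ‖energyWeight m i₀ c (component φ l) X‖ ≤
        2 ^ c * (‖component η₀ l X‖ + ‖component φ l X‖) := by
      rw [h₁, h₂]
      calc (energy m i₀ X + 1) ^ c * ‖component φ l X‖
          ≤ 2 ^ c * (energy m i₀ X ^ c + 1) * ‖component φ l X‖ := by
            gcongr
            exact add_one_rpow_le hc hE
        _ = _ := by ring
    rw [← ofReal_norm, ← ofReal_norm, ← ofReal_norm, ← ENNReal.ofReal_pow (norm_nonneg _),
      ← ENNReal.ofReal_pow (norm_nonneg _), ← ENNReal.ofReal_pow (norm_nonneg _),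
      ← ENNReal.ofReal_add (by positivity) (by positivity),
      ← ENNReal.ofReal_mul (by positivity)]
    refine ENNReal.ofReal_le_ofReal ?_
    calc ‖energyWeight m i₀ c (component φ l) X‖ ^ 2
        ≤ (2 ^ c * (‖component η₀ l X‖ + ‖component φ l X‖)) ^ 2 := by gcongr
      _ = (2 ^ c) ^ 2 * (‖component η₀ l X‖ + ‖component φ l X‖) ^ 2 := by ring
      _ ≤ (2 ^ c) ^ 2 * (2 * (‖component η₀ l X‖ ^ 2 + ‖component φ l X‖ ^ 2)) := by
          gcongr
          exact add_sq_le
      _ = _ := by ring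
  · exact (component_memLp φ l).1.enorm.pow_const 2

theorem sqInt_component_lt_top (φ : FockSpace n) (l : Fin n → ℕ) :
    sqInt (configMeasure l) (component φ l) < ⊤ :=
  (sqInt_lt_top_iff (component_memLp φ l).1).2 (component_memLp φ l)

theorem measurable_energyWeight {l : Fin n → ℕ} {f : Config l → ℂ} (hf : Measurable f) :
    Measurable (energyWeight m i₀ c f) :=
  (Complex.measurable_ofReal.comp
    (((measurable_energy m i₀ l).add_const 1).pow_const c)).mul hf

theorem memLp_energyWeight_component (hc : 0 ≤ c)
    (h : freeEnergyFun m i₀ (fun x => x ^ c) φ η₀) (l : Fin n → ℕ) :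
    MemLp (energyWeight m i₀ c (component φ l)) 2 (configMeasure l) := by
  have hm : Measurable (component φ l) := (Lp.stronglyMeasurable _).measurable
  refine (sqInt_lt_top_iff (measurable_energyWeight hm).aestronglyMeasurable).1
    ((sqInt_energyWeight_component_le hc h l).trans_lt ?_)
  exact ENNReal.mul_lt_top ENNReal.ofReal_lt_top
    (ENNReal.add_lt_top.2 ⟨sqInt_component_lt_top η₀ l, sqInt_component_lt_top φ l⟩)

/-- The domain of `H ^ c` is contained in the domain of `(H + 1) ^ c`. -/
theorem exists_freeEnergyFun_add_one (hc : 0 ≤ c)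
    (h : freeEnergyFun m i₀ (fun x => x ^ c) φ η₀) :
    ∃ η, freeEnergyFun m i₀ (fun x => (x + 1) ^ c) φ η := by
  have hmem := memLp_energyWeight_component hc h
  have hsec : ∀ l, (hmem l).toLp ∈ Sector l := by
    intro l σ
    have h₀ := (hmem l).coeFn_toLp
    have h₁ := (measurePreserving_permute σ).quasiMeasurePreserving.ae h₀
    filter_upwards [h₀, h₁, (φ l).2 σ] with X h₂ h₃ h₄
    rw [h₂, h₃]
    have h₅ : component φ l (permute σ X) = _ * component φ l X := h₄
    rw [energyWeight, energyWeight, energy_permute, h₅]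
    ring
  have hnorm : ∀ l, ‖(⟨(hmem l).toLp, hsec l⟩ : Sector l)‖ ^ 2 ≤
      2 * (2 ^ c) ^ 2 * (‖η₀ l‖ ^ 2 + ‖φ l‖ ^ 2) := by
    intro l
    have h₁ : ‖(⟨(hmem l).toLp, hsec l⟩ : Sector l)‖ =
        l2Norm (configMeasure l) (energyWeight m i₀ c (component φ l)) := by
      rw [← l2Norm_congr (hmem l).coeFn_toLp, l2Norm_eq_norm]
      rfl
    have h₂ := ENNReal.toReal_mono (ENNReal.mul_lt_top ENNReal.ofReal_lt_top (ENNReal.add_lt_top.2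
      ⟨sqInt_component_lt_top η₀ l, sqInt_component_lt_top φ l⟩)).ne
      (sqInt_energyWeight_component_le hc h l)
    rw [ENNReal.toReal_mul, ENNReal.toReal_ofReal (by positivity), ENNReal.toReal_add
      (sqInt_component_lt_top η₀ l).ne (sqInt_component_lt_top φ l).ne] at h₂
    rw [h₁, norm_apply_eq_l2Norm, norm_apply_eq_l2Norm]
    unfold l2Norm
    rwa [Real.sq_sqrt ENNReal.toReal_nonneg, Real.sq_sqrt ENNReal.toReal_nonneg,
      Real.sq_sqrt ENNReal.toReal_nonneg]
  have hℓ : Memℓp (fun l => (⟨(hmem l).toLp, hsec l⟩ : Sector l)) 2 := by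
    refine memℓp_gen ?_
    simp only [ENNReal.toReal_ofNat, Real.rpow_ofNat]
    exact Summable.of_nonneg_of_le (fun l => by positivity) hnorm
      (((summable_norm_sq η₀).add (summable_norm_sq φ)).mul_left _)
  exact ⟨⟨_, hℓ⟩, fun l => (hmem l).coeFn_toLp⟩

end FreeEnergy

/-! ### Summation over the sectors -/

theorem addOcc_injective {n : ℕ} (S : Fin n → Bool) : Function.Injective (addOcc S) := by
  intro l l' h
  funext i
  exact Nat.add_right_cancel (congrFun h i)

/-- By 2ab ≤ a² + b², it remains to sum two series of squared sector norms. Each is part of the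
series for ‖η‖², since shifting the occupation numbers is injective. -/
theorem summable_and_norm_tsum_le {n : ℕ} (η : FockSpace n) (S R : Fin n → Bool) {K : ℝ}
    (hK : 0 ≤ K) {t : (Fin n → ℕ) → ℂ} (ht : ∀ l, ‖t l‖ ≤ K * (‖η (addOcc S l)‖ * ‖η (addOcc R l)‖)) :
    (Summable fun l => ‖t l‖) ∧ ‖∑' l, t l‖ ≤ K * ‖η‖ ^ 2 := by
  have hs : ∀ S : Fin n → Bool, Summable fun l => ‖η (addOcc S l)‖ ^ 2 := fun S =>
    (summable_norm_sq η).comp_injective (addOcc_injective S)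
  have hle : ∀ S : Fin n → Bool, ∑' l, ‖η (addOcc S l)‖ ^ 2 ≤ ‖η‖ ^ 2 := fun S => by
    rw [norm_sq_eq_tsum]
    exact tsum_comp_le_tsum_of_inj (summable_norm_sq η) (fun l => by positivity)
      (addOcc_injective S)
  have ht' : ∀ l, ‖t l‖ ≤ K / 2 * (‖η (addOcc S l)‖ ^ 2 + ‖η (addOcc R l)‖ ^ 2) := fun l => by
    refine (ht l).trans ?_
    have := two_mul_le_add_sq ‖η (addOcc S l)‖ ‖η (addOcc R l)‖
    calc K * (‖η (addOcc S l)‖ * ‖η (addOcc R l)‖)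
        = K / 2 * (2 * ‖η (addOcc S l)‖ * ‖η (addOcc R l)‖) := by ring
      _ ≤ _ := by gcongr
  have hsum := ((hs S).add (hs R)).mul_left (K / 2)
  have hts : Summable fun l => ‖t l‖ := Summable.of_nonneg_of_le (fun l => norm_nonneg _) ht' hsum
  refine ⟨hts, (norm_tsum_le_tsum_norm hts).trans ((hts.tsum_le_tsum ht' hsum).trans ?_)⟩
  rw [tsum_mul_left, (hs S).tsum_add (hs R)]
  calc K / 2 * (∑' l, ‖η (addOcc S l)‖ ^ 2 + ∑' l, ‖η (addOcc R l)‖ ^ 2)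
      ≤ K / 2 * (‖η‖ ^ 2 + ‖η‖ ^ 2) := by
        gcongr
        · exact hle S
        · exact hle R
    _ = _ := by ring

theorem interaction_bound_of_sectorBound {n : ℕ} {m : Fin (n + 1) → ℝ} {i : Fin (n + 1)}
    {s' θ' c C W : ℝ} (hC : 0 ≤ C) (hB : SectorBound m i s' θ' c C) (hW : 0 ≤ W)
    {G : KernelSpace (n + 1)} (hG : ∀ b : Finset (Mode × (Fin n → Mode)), ∑ p ∈ b,
      (‖∫ ξ, (pairMode i p ξ : ℂ) * G ξ ∂(kernelMeasure (n + 1))‖ * interpWeight m i s' θ' p.2) ^ 2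
        ≤ W ^ 2) {φ η : FockSpace (n + 1)}
    (hη : freeEnergyFun m i (fun x => (x + 1) ^ c) φ η) (p : ℕ) :
    InteractionConverges p G φ φ ∧ ‖interactionForm p G φ φ‖ ≤ C * W * ‖η‖ ^ 2 := by
  set S : Fin (n + 1) → Bool := fun i => decide (i.val < p) with hS
  set R : Fin (n + 1) → Bool := fun i => !decide (i.val < p) with hR
  have hSR : ∀ i, R i = !S i := fun _ => rfl
  have hGt : sqInt (kernelMeasure (n + 1)) G < ⊤ :=
    (sqInt_lt_top_iff (Lp.aestronglyMeasurable G)).2 (Lp.memLp G)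
  have hGm : Measurable G := (Lp.stronglyMeasurable G).measurable
  have hwave : ∀ l, ∃ g : Config l → ℂ, IsWave g ∧ g =ᵐ[configMeasure l] component φ l :=
    fun l => exists_isWave_ae_eq (φ l)
  choose g hg hge using hwave
  have hsq : ∀ l, sqInt (configMeasure l) (energyWeight m i c (g l)) =
      sqInt (configMeasure l) (component η l) := fun l => by
    refine sqInt_congr_norm ?_
    filter_upwards [hη l, hge l] with X h₁ h₂
    rw [h₁, energyWeight, h₂]
  have hsqc : ∀ l, sqInt (configMeasure l) (energyWeight m i c fun X => conj (g l X)) =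
      sqInt (configMeasure l) (component η l) := fun l => by
    rw [← hsq l]
    refine sqInt_congr_norm (Filter.Eventually.of_forall fun X => ?_)
    simp [energyWeight]
  have hterm : ∀ l, ∃ ε : ℂ, ‖ε‖ = 1 ∧
      interactionIntegrand p G φ φ l =ᵐ[(kernelMeasure (n + 1)).prod (configMeasure l)]
        fun z => ε * (sectorFactor l : ℝ) * (G z.1 *
          (conj (g (addOcc S l) (insertFor S z.1 z.2)) *
            g (addOcc R l) (insertFor R z.1 z.2))) := by
    intro l
    obtain ⟨ε, hε, h⟩ := exists_interactionIntegrand_eq p l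
    refine ⟨ε, hε, ?_⟩
    filter_upwards [(quasiMeasurePreserving_insertFor S l).ae (hge (addOcc S l)),
      (quasiMeasurePreserving_insertFor R l).ae (hge (addOcc R l))] with z h₁ h₂
    rw [h, h₁, h₂]
  have hintg : ∀ l, Integrable (fun z : (Fin (n + 1) → Particle) × Config l => G z.1 *
      (conj (g (addOcc S l) (insertFor S z.1 z.2)) * g (addOcc R l) (insertFor R z.1 z.2)))
      ((kernelMeasure (n + 1)).prod (configMeasure l)) := fun l =>
    integrable_sectorForm hSR (hg (addOcc S l)).conj (hg (addOcc R l)) hGm hGt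
  have hbound : ∀ l, ‖interactionTerm p G φ φ l‖ ≤
      C * W * (‖η (addOcc S l)‖ * ‖η (addOcc R l)‖) := by
    intro l
    obtain ⟨ε, hε, h⟩ := hterm l
    have h₁ := hB l S R hSR _ _ (hg (addOcc S l)).conj (hg (addOcc R l))
      (by rw [hsqc]; exact sqInt_component_lt_top η _)
      (by rw [hsq]; exact sqInt_component_lt_top η _) G W hW hG
    rw [l2Norm, l2Norm, hsqc, hsq, ← l2Norm, ← l2Norm, ← norm_apply_eq_l2Norm,
      ← norm_apply_eq_l2Norm] at h₁
    rw [interactionTerm, integral_congr_ae h, integral_const_mul, norm_mul, norm_mul, hε, one_mul,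
      Complex.norm_real, Real.norm_of_nonneg (sectorFactor_pos l).le]
    exact h₁
  obtain ⟨hsum, hle⟩ := summable_and_norm_tsum_le η S R (mul_nonneg hC hW) hbound
  refine ⟨⟨fun l => ?_, hsum⟩, hle⟩
  obtain ⟨ε, -, h⟩ := hterm l
  exact (integrable_congr h).2 ((hintg l).const_mul _)

/-- The weighted coefficients of G are at most K times the coefficients of F = W G, to which
Bessel's inequality applies. -/
theorem sum_norm_mul_interpWeight_sq_le {n : ℕ} {m : Fin (n + 1) → ℝ} (hm : ∀ i, 0 ≤ m i)
    {s θ s' θ' K : ℝ} {i₀ : Fin (n + 1)}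
    (hw : ∀ β, interpWeight m i₀ s' θ' β ≤
      K * ∏ j, modeEig (β j) ^ oscExponent s θ (m (i₀.succAbove j)))
    {G F : KernelSpace (n + 1)} (h : weightOp m s θ i₀ G F) (b : Finset (Mode × (Fin n → Mode))) :
    ∑ p ∈ b, (‖∫ ξ, (pairMode i₀ p ξ : ℂ) * G ξ ∂(kernelMeasure (n + 1))‖ *
      interpWeight m i₀ s' θ' p.2) ^ 2 ≤ (K * ‖F‖) ^ 2 := by
  have hbessel := (isModeSystem_pairMode i₀).sum_norm_sq_le F b
  calc ∑ p ∈ b, (‖∫ ξ, (pairMode i₀ p ξ : ℂ) * G ξ ∂(kernelMeasure (n + 1))‖ *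
        interpWeight m i₀ s' θ' p.2) ^ 2
      ≤ ∑ p ∈ b, K ^ 2 * ‖∫ ξ, (pairMode i₀ p ξ : ℂ) * F ξ ∂(kernelMeasure (n + 1))‖ ^ 2 := by
        refine Finset.sum_le_sum fun p _ => ?_
        have hpos : 0 ≤ ∏ j, modeEig (p.2 j) ^ oscExponent s θ (m (i₀.succAbove j)) :=
          Finset.prod_nonneg fun j _ => Real.rpow_nonneg (modeEig_pos _).le _
        rw [integral_pairMode_mul_of_weightOp hm h, norm_mul, Complex.norm_real,
          Real.norm_of_nonneg hpos, ← mul_pow]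
        refine pow_le_pow_left₀ (mul_nonneg (norm_nonneg _) (interpWeight_nonneg ..)) ?_ 2
        calc _ ≤ ‖∫ ξ, (pairMode i₀ p ξ : ℂ) * G ξ ∂(kernelMeasure (n + 1))‖ *
              (K * ∏ j, modeEig (p.2 j) ^ oscExponent s θ (m (i₀.succAbove j))) := by
              gcongr
              exact hw p.2
          _ = _ := by ring
    _ ≤ (K * ‖F‖) ^ 2 := by
        rw [← Finset.mul_sum, mul_pow]
        gcongr

theorem exists_interaction_bound {n : ℕ} {m : Fin (n + 1) → ℝ} (hm : ∀ i, 0 ≤ m i) {s θ : ℝ}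
    (hs : 1 / 2 < s) (hθ₀ : 0 ≤ θ) (hθ₁ : θ ≤ 1) (i₀ : Fin (n + 1)) :
    ∃ C : ℝ, 0 ≤ C ∧ ∀ (p : ℕ) (G F : KernelSpace (n + 1)), weightOp m s θ i₀ G F →
      ∀ φ η : FockSpace (n + 1),
        freeEnergyFun m i₀ (fun x => (x + 1) ^ ((n : ℝ) / 2 * (1 - θ))) φ η →
        InteractionConverges p G φ φ ∧ ‖interactionForm p G φ φ‖ ≤ C * ‖F‖ * ‖η‖ ^ 2 := by
  obtain ⟨s', θ', C, hC, hθθ', -, hsθ, hB⟩ := exists_sectorBound m i₀ hs hθ₀ hθ₁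
  obtain ⟨K, hK, hw⟩ := exists_interpWeight_le m i₀ hθθ' hsθ
  refine ⟨C * K, by positivity, fun p G F h φ η hη => ?_⟩
  rw [mul_assoc C K]
  exact interaction_bound_of_sectorBound hC hB (by positivity)
    (sum_norm_mul_interpWeight_sq_le hm hw h) hη p

end FermiFields

/-! ### The proposition. -/

open FermiFields
theorem proposition2p3 (n : ℕ) (m : Fin n → ℝ) (hm : ∀ i, 0 ≤ m i) (s θ : ℝ) (hs : 1 / 2 < s)
    (hθ₀ : 0 ≤ θ) (hθ₁ : θ ≤ 1) :
    ∃ C : ℝ, 0 < C ∧ ∀ (p : ℕ), p ≤ n → ∀ (i₀ : Fin n) (G F : KernelSpace n),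
      weightOp m s θ i₀ G F →
      ∀ φ : FockSpace n,
        (∃ η₀, freeEnergyFun m i₀ (fun x => x ^ (((n : ℝ) - 1) / 2 * (1 - θ))) φ η₀) →
        ∃ η, freeEnergyFun m i₀ (fun x => (x + 1) ^ (((n : ℝ) - 1) / 2 * (1 - θ))) φ η ∧
          InteractionConverges p G φ φ ∧
          ‖interactionForm p G φ φ‖ ≤ C * ‖F‖ * ‖η‖ ^ 2 := by
  cases n with
  | zero => exact ⟨1, one_pos, fun _ _ i₀ => i₀.elim0⟩
  | succ n =>
    have hexp : ((n + 1 : ℕ) : ℝ) - 1 = n := by push_cast; ring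
    rw [hexp]
    have hc : 0 ≤ (n : ℝ) / 2 * (1 - θ) := mul_nonneg (by positivity) (by linarith)
    choose C hC hbound using exists_interaction_bound hm hs hθ₀ hθ₁
    -- The sum makes the constant independent of i₀, and the 1 makes it positive.
    refine ⟨1 + ∑ i, C i, add_pos_of_pos_of_nonneg one_pos (Finset.sum_nonneg fun i _ => hC i),
      fun p _ i₀ G F hW φ ⟨η₀, hη₀⟩ => ?_⟩
    obtain ⟨η, hη⟩ := exists_freeEnergyFun_add_one hc hη₀
    obtain ⟨hconv, hle⟩ := hbound i₀ p G F hW φ η hη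
    refine ⟨η, hη, hconv, hle.trans ?_⟩
    have hCi : C i₀ ≤ 1 + ∑ i, C i := by
      have := Finset.single_le_sum (fun i _ => hC i) (Finset.mem_univ i₀)
      linarith
    gcongr
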